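/- Let $n\ge 1$, let $h,\gamma\in\mathbb C$, and put $s_3=e^{h}$, $s_1=e^{-\gamma h}=s_3^{-\gamma}$, $q=s_2=e^{-(1-\gamma)h}=s_3^{-(1-\gamma)}$ (so $s_1s_2s_3=1$), $t_i=s_i-s_i^{-1}$. Assume that $s_1^as_2^b=1$ with $a,b\in\mathbb Z$ holds only for $a=b=0$. Complex powers of $s_1,s_2,s_3$ are taken with the logarithms $-\gamma h,-(1-\gamma)h,h$. For an expression $f$ in $s_1,s_2$, $f^{[r]}$ is $f$ with $s_1,s_2$ replaced by $s_1^r,s_2^r$. **Cartan matrix of $\mathfrak{osp}(2|2n)$, symmetric parity.** The nodes are $I=\{n,\dots,2,1,\bar 1\}$; $1,\bar1$ are fermionic, the others bosonic. The nonzero entries of $C$ are $c_{ii}=q+q^{-1}$ for $i\ge2$; $c_{11}=c_{\bar1\bar1}=t_3$; $c_{i,i+1}=c_{i+1,i}=-1$ for $2\le i<n$; $c_{21}=c_{2\bar1}=-1$; $c_{12}=c_{\bar12}=t_1$; $c_{1\bar1}=c_{\bar11}=qs_1^{-1}-q^{-1}s_1$. Put $B=DC$ with $d_i=-t_1t_3$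 $(i\ge2)$, $d_1=d_{\bar1}=t_3$, and let $K=\lim_{s_3\to1}t_3^{-2}B$ with $\gamma$ fixed; its nonzero entries are $K_{ii}=2\gamma$ and $K_{i,i\pm1}=-\gamma$ among the nodes $\ge 2$, $K_{12}=K_{21}=K_{\bar12}=K_{2\bar1}=-\gamma$, $K_{11}=K_{\bar1\bar1}=1$, $K_{1\bar1}=K_{\bar11}=2\gamma-1$. **Bosons.** Take a Heisenberg algebra with generators $Q_{\mathsf s_i},\mathsf s_{i,r}$ $(i\in I)$, $Q_\lambda,\lambda_r,Q_{\bar\lambda},\bar\lambda_r$ $(r\in\mathbb Z)$, where $[\mathsf s_{i,r},\mathsf s_{j,r'}]=-\frac1r\delta_{r+r',0}(t_3^{[r]})^{-2}B^{[r]}_{ij}$ for $r,r'\ne0$ and $[\mathsf s_{i,0},Q_{\mathsf s_j}]=K_{ij}$. Let $$S_i(z)=e^{Q_{\mathsf s_i}}z^{\mathsf s_{i,0}}{:}e^{\sum_{r\neq0}\mathsf s_{i,r}z^{-r}}{:},\qquad \Lambda(z)=e^{Q_\lambda}z^{\lambda_0}(s_1^2z)^{-\bar\lambda_0}{:}e^{\sum_{r\ne0}\lambda_rz^{-r}}{:},\qquad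 \bar\Lambda(z)=e^{Q_{\bar\lambda}}z^{\bar\lambda_0}(s_1^2z)^{-\lambda_0}{:}e^{\sum_{r\ne0}\bar\lambda_rz^{-r}}{:}.$$ For vertex operators, $V(z)W(w)=\langle V(z)W(w)\rangle\,{:}V(z)W(w){:}$ defines the contraction $\langle\cdot\rangle$. The remaining commutators are those for which $\langle\Lambda(z)\Lambda(w)\rangle=\frac{z-w}{z-s_3^2w}$, $\langle\bar\Lambda(z)\bar\Lambda(w)\rangle=\frac{z-w}{z-s_3^{-2}w}$, $\langle\Lambda(z)\bar\Lambda(w)\rangle=\langle\bar\Lambda(z)\Lambda(w)\rangle=1$, $\langle\Lambda(z)S_1(w)\rangle=-\langle S_1(w)\Lambda(z)\rangle=\frac1{z-w}$, $\langle\Lambda(z)S_{\bar1}(w)\rangle=-\langle S_{\bar1}(w)\Lambda(z)\rangle=s_1^2z-w$, $\langle\Lambda(z)S_i(w)\rangle=\langle S_i(w)\Lambda(z)\rangle=1$ $(i\ge2)$, and the same with $1\leftrightarrow\bar1$, $\Lambda\leftrightarrow\bar\Lambda$ (expanded in $w/z$ or $z/w$ according to the order of the factors); the zero modes of $\lambda,\bar\lambda$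 commute with $Q_\lambda,Q_{\bar\lambda}$. All operators act on the direct sum of all Fock modules of this algebra (arbitrary complex zero-mode eigenvalues). Put $\mathsf x_{i,r}=(t_3^{[r]})^2\sum_k((B^{[r]})^{-1})_{ik}\mathsf s_{k,r}$ $(r\neq0)$, $\mathsf x_{i,0}=\sum_k(K^{-1})_{ik}\mathsf s_{k,0}$, $Q_{\mathsf x_i}=\sum_k(K^{-1})_{ik}Q_{\mathsf s_k}$, $X_i(z)=e^{Q_{\mathsf x_i}}z^{\mathsf x_{i,0}}{:}e^{\sum_{r\ne0}\mathsf x_{i,r}z^{-r}}{:}$, and $Y_i(z)={:}X_i(s_1z)/X_i(s_1^{-1}z){:}$ for $i\ge2$, $Y_i(z)={:}1/X_i(z){:}$ for $i=1,\bar1$. Define $\Lambda',\bar\Lambda'$ by $\Lambda(z)={:}\Lambda'(z)Y_1(z)/Y_{\bar1}(s_1^2z){:}$ and $\bar\Lambda(z)={:}\bar\Lambda'(z)Y_{\bar1}(z)/Y_1(s_1^2z){:}$. **Currents.** For $\nu=(\nu_n,\dots,\nu_1)\in\{0,1\}^n$ put $c_\nu=(-1)^{\sum_i\nu_i}q^{n(n-1)/2-2\sum_i(i-1)\nu_i}$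 and $$\tilde\xi_\nu(z)={:}\prod_{i=2}^nY_i\bigl(q^{\,i+2\sum_{j>i}\nu_j+\nu_i-\nu_{i-1}}s_1z\bigr)^{-\nu_i+\nu_{i-1}}\;Y_1\bigl(q^{2\sum_j\nu_j}s_1^{2\nu_1}z\bigr)\;Y_{\bar1}\bigl(q^{2\sum_j\nu_j}s_1^{2-2\nu_1}z\bigr)^{-1}{:}\,,$$ and let $\tilde\eta_\nu(z)$ be obtained from $\tilde\xi_\nu(z)$ by $Y_1\leftrightarrow Y_{\bar1}$. The rationalized currents are $$E(z)=\sum_\nu c_\nu\,{:}\Lambda'(z)\tilde\xi_\nu(z){:}\,,\qquad F(z)=\sum_\nu c_\nu\,{:}\bar\Lambda'(z)\tilde\eta_\nu(z){:}\,.$$ **Theorem.** The product $E(z)E(w)$ (resp. $F(z)F(w)$) is regular except for a simple pole at $z=s_3^2w$ (resp. $z=s_3^{-2}w$). That is, every matrix element of $(z-s_3^{2}w)E(z)E(w)$ (resp. $(z-s_3^{-2}w)F(z)F(w)$) is a finite linear combination of monomials $z^aw^b$, $a,b\in\mathbb C$, while this fails for some matrix element of $E(z)E(w)$ (resp. $F(z)F(w)$)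 itself. Moreover, as identities of formal series of operators, $$(z-s_3^2w)E(z)E(w)+(w-s_3^2z)E(w)E(z)=0,\qquad (z-s_3^{-2}w)F(z)F(w)+(w-s_3^{-2}z)F(w)F(z)=0 .$$ -/

import Mathlib

noncomputable section

namespace OspW

/-! ### Free bosons, Fock space and vertex operators

`J` labels finitely many bosons.  The Heisenberg algebra has generators `h_{j,r}` (`r : ℤ`) and `Q_j`
(`j : J`), and it acts on the direct sum of all its Fock modules. -/

/-- The nontrivial commutators `[h_{j,r}, h_{l,-r}] = osc r j l` for `r > 0`, and
`[h_{j,0}, Q_l] = zero j l`.  All the other commutators vanish. -/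
structure Heisenberg (J : Type) where
  osc : ℕ → Matrix J J ℂ
  zero : Matrix J J ℂ

/-- Polynomials in the creation modes: the variable `(j, k)` stands for `h_{j,-(k+1)}`. -/
abbrev Osc (J : Type) : Type := MvPolynomial (J × ℕ) ℂ

/-- The direct sum over all momenta `p : J → ℂ` (the eigenvalues of the zero modes `h_{j,0}`)
of the Fock modules of momentum `p`. -/
abbrev Fock (J : Type) : Type := (J → ℂ) →₀ Osc J

/-- The action of `h_{j,-(k+1)}`. -/
def creation {J : Type} (j : J) (k : ℕ) : Module.End ℂ (Osc J) :=
  LinearMap.mulLeft ℂ (MvPolynomial.X (j, k))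

/-- The action of `h_{j,k+1}`. -/
def annihilation {J : Type} [Fintype J] (H : Heisenberg J) (j : J) (k : ℕ) :
    Module.End ℂ (Osc J) :=
  ∑ l, H.osc (k + 1) j l • (MvPolynomial.pderiv (R := ℂ) (l, k)).toLinearMap

/-- The coefficient of `x ^ m` in `exp (A x)`, where `A` is a power series of operators without
constant term. -/
def expCoeff {M : Type} [AddCommGroup M] [Module ℂ M] (A : PowerSeries (Module.End ℂ M)) (m : ℕ) :
    Module.End ℂ M :=
  ∑ k ∈ Finset.range (m + 1), ((k.factorial : ℂ)⁻¹) • PowerSeries.coeff m (A ^ k)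

/-- The vertex operator
`V(z) = e^{∑ charge_j Q_j} e^{∑ const_j h_{j,0}} z^{∑ pow_j h_{j,0}} :exp(∑_{r ≠ 0} ∑_j mode_{r,j} h_{j,r} z^{-r}):`,
given by its exponents (`mode 0` plays no role). -/
@[ext] structure Vertex (J : Type) where
  charge : J → ℂ
  const : J → ℂ
  pow : J → ℂ
  mode : ℤ → J → ℂ

namespace Vertex

variable {J : Type}

/-- `V * W` is the normally ordered product `:V(z) W(z):`. -/
instance : Mul (Vertex J) :=
  ⟨fun V W => ⟨V.charge + W.charge, V.const + W.const, V.pow + W.pow, V.mode + W.mode⟩⟩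
instance : One (Vertex J) := ⟨⟨0, 0, 0, 0⟩⟩
/-- `V⁻¹` is `:1 / V(z):`. -/
instance : Inv (Vertex J) := ⟨fun V => ⟨-V.charge, -V.const, -V.pow, -V.mode⟩⟩
instance : Div (Vertex J) :=
  ⟨fun V W => ⟨V.charge - W.charge, V.const - W.const, V.pow - W.pow, V.mode - W.mode⟩⟩
instance : Pow (Vertex J) ℕ :=
  ⟨fun V m => ⟨m • V.charge, m • V.const, m • V.pow, m • V.mode⟩⟩
instance : Pow (Vertex J) ℤ :=
  ⟨fun V m => ⟨m • V.charge, m • V.const, m • V.pow, m • V.mode⟩⟩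

/-- The exponents of a vertex operator as a tuple. -/
def toTuple (V : Vertex J) :
    Multiplicative ((J → ℂ) × (J → ℂ) × (J → ℂ) × (ℤ → J → ℂ)) :=
  Multiplicative.ofAdd (V.charge, V.const, V.pow, V.mode)

theorem toTuple_injective : Function.Injective (toTuple (J := J)) := by
  intro V W hVW
  have h1 := Multiplicative.ofAdd.injective hVW
  simp only [Prod.mk.injEq] at h1
  exact Vertex.ext h1.1 h1.2.1 h1.2.2.1 h1.2.2.2

instance : CommGroup (Vertex J) :=
  toTuple_injective.commGroup toTuple rfl (fun _ _ => rfl) (fun _ => rfl) (fun _ _ => rfl)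
    (fun _ _ => rfl) (fun _ _ => rfl)

/-- The vertex operator `V(e^α z)`. -/
def shift (α : ℂ) (V : Vertex J) : Vertex J where
  charge := V.charge
  const := V.const + α • V.pow
  pow := V.pow
  mode := fun r => Complex.exp (-(r : ℂ) * α) • V.mode r

variable [Fintype J]

/-- `∑_{r > 0} ∑_j mode_{-r,j} h_{j,-r} x^r`. -/
def creationSeries (V : Vertex J) : PowerSeries (Module.End ℂ (Osc J)) :=
  PowerSeries.mk fun r => match r with
    | 0 => 0
    | k + 1 => ∑ j, V.mode (-((k : ℤ) + 1)) j • creation j k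

/-- `∑_{r > 0} ∑_j mode_{r,j} h_{j,r} x^r` (to be used with `x = z⁻¹`). -/
def annihilationSeries (H : Heisenberg J) (V : Vertex J) : PowerSeries (Module.End ℂ (Osc J)) :=
  PowerSeries.mk fun r => match r with
    | 0 => 0
    | k + 1 => ∑ j, V.mode ((k : ℤ) + 1) j • annihilation H j k

end Vertex

/-- The weight of a monomial, where `h_{j,-r}` has weight `r`. -/
def weight {J : Type} (d : J × ℕ →₀ ℕ) : ℕ := Finsupp.weight (fun x : J × ℕ => x.2 + 1) d

/-- The polynomials all of whose monomials have weight at most `N`. -/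
def weightLE (J : Type) (N : ℤ) : Submodule ℂ (Osc J) :=
  Submodule.span ℂ {f | ∃ d : J × ℕ →₀ ℕ, (weight d : ℤ) ≤ N ∧ f = MvPolynomial.monomial d 1}

theorem weightLE_neg (J : Type) {N : ℤ} (hN : N < 0) : weightLE J N = ⊥ := by
  rw [weightLE, Submodule.span_eq_bot]
  rintro f ⟨d, hd, -⟩
  omega

theorem annihilation_mem {J : Type} [Fintype J] (H : Heisenberg J) (j : J) (k : ℕ) {N : ℤ}
    {f : Osc J} (hf : f ∈ weightLE J N) : annihilation H j k f ∈ weightLE J (N - (k + 1)) := by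
  have key : weightLE J N ≤ (weightLE J (N - (k + 1))).comap (annihilation H j k) := by
    rw [weightLE, Submodule.span_le]
    rintro f ⟨d, hd, rfl⟩
    simp only [Submodule.comap_coe, Set.mem_preimage, SetLike.mem_coe, annihilation,
      LinearMap.sum_apply, LinearMap.smul_apply]
    refine Submodule.sum_mem _ fun l _ => Submodule.smul_mem _ _ ?_
    change MvPolynomial.pderiv (l, k) (MvPolynomial.monomial d 1) ∈ _
    rw [MvPolynomial.pderiv_monomial]
    by_cases hl : d (l, k) = 0
    · simp [hl]
    · have hsplit : d - Finsupp.single (l, k) 1 + Finsupp.single (l, k) 1 = d := by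
        apply tsub_add_cancel_of_le
        rw [Finsupp.single_le_iff]
        omega
      have hw : weight (d - Finsupp.single (l, k) 1) + (k + 1) = weight d := by
        conv_rhs => rw [← hsplit]
        simp [weight, map_add, Finsupp.weight_single]
      have hm : MvPolynomial.monomial (d - Finsupp.single (l, k) 1) (1 * (d (l, k) : ℂ))
          = (d (l, k) : ℂ) • MvPolynomial.monomial (d - Finsupp.single (l, k) 1) (1 : ℂ) := by
        rw [MvPolynomial.smul_monomial]
        simp
      rw [hm]
      refine Submodule.smul_mem _ _ (Submodule.subset_span ⟨_, ?_, rfl⟩)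
      omega
  exact key hf

/-- The annihilation part of a vertex operator is a finite sum on each monomial. -/
theorem expCoeff_annihilationSeries_monomial {J : Type} [Fintype J] (H : Heisenberg J)
    (V : Vertex J) (d : J × ℕ →₀ ℕ) (k : ℕ) (hk : weight d < k) :
    expCoeff (V.annihilationSeries H) k (MvPolynomial.monomial d 1) = 0 := by
  have h1 : ∀ (i m : ℕ) (N : ℤ) (f : Osc J), f ∈ weightLE J N →
      PowerSeries.coeff m ((V.annihilationSeries H) ^ i) f ∈ weightLE J (N - m) := by
    intro i
    induction i with
    | zero =>
      intro m N f hf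
      rw [pow_zero, PowerSeries.coeff_one]
      split_ifs with hm
      · simpa [hm] using hf
      · simp
    | succ i ih =>
      intro m N f hf
      rw [pow_succ, PowerSeries.coeff_mul, LinearMap.sum_apply]
      refine Submodule.sum_mem _ fun x hx => ?_
      have hx' := Finset.HasAntidiagonal.mem_antidiagonal.mp hx
      have h2 : PowerSeries.coeff x.2 (V.annihilationSeries H) f ∈ weightLE J (N - x.2) := by
        rw [Vertex.annihilationSeries, PowerSeries.coeff_mk]
        rcases x.2 with _ | r
        · simp
        · simp only [LinearMap.sum_apply, LinearMap.smul_apply]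
          refine Submodule.sum_mem _ fun j _ => Submodule.smul_mem _ _ ?_
          simpa using annihilation_mem H j r hf
      have h3 := ih x.1 _ _ h2
      have h4 : N - (x.2 : ℤ) - (x.1 : ℤ) = N - m := by omega
      rw [h4] at h3
      exact h3
  rw [expCoeff, LinearMap.sum_apply]
  refine Finset.sum_eq_zero fun i _ => ?_
  have h5 := h1 i k (weight d) _ (Submodule.subset_span ⟨d, le_rfl, rfl⟩)
  rw [weightLE_neg J (by omega), Submodule.mem_bot] at h5
  rw [LinearMap.smul_apply, h5, smul_zero]

/-- The coefficient of `z ^ m` in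
`exp(∑_{r > 0} ∑_j mode_{-r,j} h_{j,-r} z^r) exp(∑_{r > 0} ∑_j mode_{r,j} h_{j,r} z^{-r})`.
On a monomial of weight `N` the coefficient of `z ^ (-k)` in the second factor vanishes for `k > N`
(`expCoeff_annihilationSeries_monomial`), so the sum that defines the product is finite. -/
def Vertex.oscCoeff {J : Type} [Fintype J] (H : Heisenberg J) (V : Vertex J) (m : ℤ) :
    Module.End ℂ (Osc J) :=
  (MvPolynomial.basisMonomials (J × ℕ) ℂ).constr ℂ fun d =>
    ∑ k ∈ Finset.range (weight d + 1),
      if 0 ≤ m + (k : ℤ) then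
        expCoeff V.creationSeries (m + (k : ℤ)).toNat
          (expCoeff (V.annihilationSeries H) k (MvPolynomial.monomial d 1))
      else 0

open Classical in
/-- The same, for a complex exponent of `z`. -/
def Vertex.oscCoeffC {J : Type} [Fintype J] (H : Heisenberg J) (V : Vertex J) (b : ℂ) :
    Module.End ℂ (Osc J) :=
  if hb : ∃ m : ℤ, (m : ℂ) = b then V.oscCoeff H hb.choose else 0

/-- A current `∑_{a ∈ ℂ} C_a z^a`, given by its coefficients `C_a`, operators on the Fock space. -/
abbrev Current (J : Type) : Type := ℂ → Module.End ℂ (Fock J)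

/-- The vertex operator `V(z)` acting on the Fock space.  On momentum `p`, the zero mode `h_{j,0}`
is `p j`, and `e^{Q_l}` raises `p j` by `[h_{j,0}, Q_l]`. -/
def Vertex.current {J : Type} [Fintype J] (H : Heisenberg J) (V : Vertex J) : Current J :=
  fun a => Finsupp.lsum ℂ fun p : J → ℂ =>
    (Finsupp.lsingle (p + H.zero.mulVec V.charge)).comp
      (Complex.exp (∑ j, V.const j * p j) • V.oscCoeffC H (a - ∑ j, V.pow j * p j))

/-- The coefficient of `z^a w^b` in `A(z) B(w)`. -/
def prodCoeff {J : Type} (A B : Current J) (a b : ℂ) : Module.End ℂ (Fock J) := A a * B b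

/-- The coefficient of `z^a w^b` in `(z - c w) A(z) B(w)`. -/
def mulProdCoeff {J : Type} (c : ℂ) (A B : Current J) (a b : ℂ) : Module.End ℂ (Fock J) :=
  prodCoeff A B (a - 1) b - c • prodCoeff A B a (b - 1)

/-- All matrix elements of a formal series `∑ T_{a,b} z^a w^b` of operators are finite sums. -/
def IsRegular {J : Type} (T : ℂ → ℂ → Module.End ℂ (Fock J)) : Prop :=
  ∀ (v : Fock J) (p : J → ℂ) (d : J × ℕ →₀ ℕ),
    {ab : ℂ × ℂ | MvPolynomial.coeff d (T ab.1 ab.2 v p) ≠ 0}.Finite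

/-- `A(z) B(w)` is regular except for a simple pole at `z = c w`: it becomes regular after
multiplication by `z - c w`, and it is not itself regular. -/
def RegularExceptSimplePole {J : Type} (c : ℂ) (A B : Current J) : Prop :=
  IsRegular (mulProdCoeff c A B) ∧ ¬ IsRegular (prodCoeff A B)

/-! ### Parameters and the deformed Cartan matrix of `osp(2|2n)` in the symmetric parity

`s₃ = e^h`, `s₁ = s₃^{-γ}`, `q = s₂ = s₃^{-(1-γ)}`.  The node `0 : Fin (n + 1)` is the fermionic node
`1̄`, and the node `i ≥ 1` is the node `i`. -/

/-- The logarithm of the monomial `q^a s₁^b`. -/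
def logMon (h γ : ℂ) (a b : ℤ) : ℂ := -((a : ℂ) * (1 - γ) + (b : ℂ) * γ) * h

def s1 (h γ : ℂ) : ℂ := Complex.exp (-γ * h)
def s2 (h γ : ℂ) : ℂ := Complex.exp (-(1 - γ) * h)
def s3 (h : ℂ) : ℂ := Complex.exp h

/-- `x - x⁻¹`. -/
def t (x : ℂ) : ℂ := x - x⁻¹

/-- The deformed Cartan matrix at `s₁ = a`, `s₂ = b`, `s₃ = (a b)⁻¹`. -/
def cartan (n : ℕ) (a b : ℂ) : Matrix (Fin (n + 1)) (Fin (n + 1)) ℂ :=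
  Matrix.of fun i j =>
    if 2 ≤ i.val then
      if 2 ≤ j.val then
        if i = j then b + b⁻¹
        else if i.val + 1 = j.val ∨ j.val + 1 = i.val then -1 else 0
      else if i.val = 2 then -1 else 0
    else
      if 2 ≤ j.val then
        if j.val = 2 then t a else 0
      else if i = j then t (a * b)⁻¹ else b * a⁻¹ - a * b⁻¹

/-- The symmetrizing factors: `-t₁ t₃` on bosonic nodes and `t₃` on fermionic nodes. -/
def symmetrizer (n : ℕ) (a b : ℂ) (i : Fin (n + 1)) : ℂ :=
  if 2 ≤ i.val then -(t a * t (a * b)⁻¹) else t (a * b)⁻¹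

/-- The symmetrized Cartan matrix with `s₁, s₂` replaced by `s₁^r, s₂^r`. -/
def symCartan (n : ℕ) (h γ : ℂ) (r : ℤ) : Matrix (Fin (n + 1)) (Fin (n + 1)) ℂ :=
  Matrix.diagonal (symmetrizer n (s1 h γ ^ r) (s2 h γ ^ r)) * cartan n (s1 h γ ^ r) (s2 h γ ^ r)

/-- The limit of `t₃^{-2} B` for `s₃ → 1` with `γ` fixed. -/
def limitMatrix (n : ℕ) (γ : ℂ) : Matrix (Fin (n + 1)) (Fin (n + 1)) ℂ :=
  Matrix.of fun i j =>
    if 2 ≤ i.val then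
      if 2 ≤ j.val then
        if i = j then 2 * γ
        else if i.val + 1 = j.val ∨ j.val + 1 = i.val then -γ else 0
      else if i.val = 2 then -γ else 0
    else
      if 2 ≤ j.val then
        if j.val = 2 then -γ else 0
      else if i = j then 1 else 2 * γ - 1

/-! ### The bosons

`Sum.inl i` is the boson `s_i`; `Sum.inr false` is `λ` and `Sum.inr true` is `λ̄`. -/

abbrev Boson (n : ℕ) : Type := Fin (n + 1) ⊕ Bool

/-- The node `1` for `λ` and `E`, the node `1̄` for `λ̄` and `F`. -/
def node (n : ℕ) (e : Bool) : Fin (n + 1) := if e then 0 else 1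

/-- The commutators.  Those that involve `λ, λ̄` say that
`Λ(z)Λ(w) = (z-w)/(z-s₃²w) :Λ(z)Λ(w):`, `Λ̄(z)Λ̄(w) = (z-w)/(z-s₃⁻²w) :Λ̄(z)Λ̄(w):`,
that `Λ` and `Λ̄` have contraction `1`, and that the contractions of `Λ(z)` with the screening currents
`S_1(w)`, `S_1̄(w)`, `S_i(w)` (`i ≥ 2`) are `1/(z-w)`, `s₁²z-w`, `1` in this order, and
`-1/(z-w)`, `-(s₁²z-w)`, `1` in the opposite order; the same with `1 ↔ 1̄`, `Λ ↔ Λ̄`. -/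
def heisenberg (n : ℕ) (h γ : ℂ) : Heisenberg (Boson n) where
  osc r := Matrix.of fun x y => match x, y with
    | Sum.inl i, Sum.inl j => -(1 / (r : ℂ)) * ((t (s3 h ^ r)) ^ 2)⁻¹ * symCartan n h γ r i j
    | Sum.inl i, Sum.inr e =>
        if i = node n e then 1 / (r : ℂ)
        else if i = node n (!e) then -(s1 h γ ^ (2 * r)) / (r : ℂ) else 0
    | Sum.inr e, Sum.inl i =>
        if i = node n e then 1 / (r : ℂ)
        else if i = node n (!e) then -((s1 h γ ^ (2 * r))⁻¹) / (r : ℂ) else 0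
    | Sum.inr false, Sum.inr false => (s3 h ^ (2 * r) - 1) / (r : ℂ)
    | Sum.inr true, Sum.inr true => ((s3 h ^ (2 * r))⁻¹ - 1) / (r : ℂ)
    | Sum.inr _, Sum.inr _ => 0
  zero := Matrix.of fun x y => match x, y with
    | Sum.inl i, Sum.inl j => limitMatrix n γ i j
    | Sum.inl i, Sum.inr e => if i = node n e then -1 else if i = node n (!e) then 1 else 0
    | Sum.inr e, Sum.inl i => if i = node n e then -1 else 0
    | Sum.inr _, Sum.inr _ => 0

/-! ### The currents -/

/-- `X_i(z) = e^{Q_{x_i}} z^{x_{i,0}} :exp(∑_{r ≠ 0} x_{i,r} z^{-r}):`, where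
`x_{i,r} = (t₃^{[r]})² ∑_k ((B^{[r]})⁻¹)_{i,k} s_{k,r}`, `x_{i,0} = ∑_k (K⁻¹)_{i,k} s_{k,0}`, and
`Q_{x_i} = ∑_k (K⁻¹)_{i,k} Q_{s_k}`. -/
def X (n : ℕ) (h γ : ℂ) (i : Fin (n + 1)) : Vertex (Boson n) where
  charge := Sum.elim (fun k => (limitMatrix n γ)⁻¹ i k) 0
  const := 0
  pow := Sum.elim (fun k => (limitMatrix n γ)⁻¹ i k) 0
  mode := fun r => Sum.elim (fun k => (t (s3 h ^ r)) ^ 2 * (symCartan n h γ r)⁻¹ i k) 0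

/-- The `Y` currents. -/
def Y (n : ℕ) (h γ : ℂ) (i : Fin (n + 1)) : Vertex (Boson n) :=
  if 2 ≤ i.val then
    Vertex.shift (logMon h γ 0 1) (X n h γ i) / Vertex.shift (logMon h γ 0 (-1)) (X n h γ i)
  else (X n h γ i)⁻¹

/-- `Λ(z) = e^{Q_λ} z^{λ_0} (s₁²z)^{-λ̄_0} :exp(∑_{r ≠ 0} λ_r z^{-r}):` for `e = false`, and `Λ̄(z)`,
with `λ` and `λ̄` interchanged, for `e = true`. -/
def Lam (n : ℕ) (h γ : ℂ) (e : Bool) : Vertex (Boson n) where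
  charge := Pi.single (Sum.inr e) 1
  const := Pi.single (Sum.inr (!e)) (-logMon h γ 0 2)
  pow := Pi.single (Sum.inr e) 1 - Pi.single (Sum.inr (!e)) 1
  mode := fun _ => Pi.single (Sum.inr e) 1

/-- `Λ'(z)`, defined by `Λ(z) = :Λ'(z) Y_1(z) / Y_1̄(s₁²z):`, and `Λ̄'(z)`, defined by
`Λ̄(z) = :Λ̄'(z) Y_1̄(z) / Y_1(s₁²z):`. -/
def LamPrime (n : ℕ) (h γ : ℂ) (e : Bool) : Vertex (Boson n) :=
  Lam n h γ e * (Y n h γ (node n e))⁻¹ * Vertex.shift (logMon h γ 0 2) (Y n h γ (node n (!e)))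

/-- `ν_i` for `1 ≤ i ≤ n`. -/
def nu {n : ℕ} (ν : Fin n → Fin 2) (i : ℕ) : ℤ :=
  if hi : 1 ≤ i ∧ i ≤ n then ((ν ⟨i - 1, by omega⟩).val : ℤ) else 0

/-- The bosonization of the monomial `ξ̃_ν` of the `qq`-character `ξ` for `e = false`, and of the
monomial of `η`, obtained by `1 ↔ 1̄`, for `e = true`. -/
def xiTerm (n : ℕ) (h γ : ℂ) (e : Bool) (ν : Fin n → Fin 2) : Vertex (Boson n) :=
  (∏ i : Fin (n + 1),
    if 2 ≤ i.val then
      (Vertex.shift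
        (logMon h γ (i.val + 2 * (∑ j ∈ Finset.Icc (i.val + 1) n, nu ν j)
          + nu ν i.val - nu ν (i.val - 1)) 1)
        (Y n h γ i)) ^ (-nu ν i.val + nu ν (i.val - 1))
    else 1)
  * Vertex.shift (logMon h γ (2 * ∑ j ∈ Finset.Icc 1 n, nu ν j) (2 * nu ν 1)) (Y n h γ (node n e))
  * (Vertex.shift (logMon h γ (2 * ∑ j ∈ Finset.Icc 1 n, nu ν j) (2 - 2 * nu ν 1))
      (Y n h γ (node n (!e))))⁻¹

/-- `c_ν = (-1)^{∑ ν_i} q^{n(n-1)/2 - 2 ∑ (i-1) ν_i}`. -/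
def xiCoeff (n : ℕ) (h γ : ℂ) (ν : Fin n → Fin 2) : ℂ :=
  (-1) ^ (∑ i ∈ Finset.Icc 1 n, nu ν i) *
    s2 h γ ^ (((n * (n - 1) / 2 : ℕ) : ℤ) - 2 * ∑ i ∈ Finset.Icc 1 n, ((i : ℤ) - 1) * nu ν i)

/-- The rationalized current `:Λ'(z) V_ξ(z):` for `e = false`, `:Λ̄'(z) V_η(z):` for `e = true`. -/
def ratCurrent (n : ℕ) (h γ : ℂ) (e : Bool) : Current (Boson n) :=
  fun a => ∑ ν : Fin n → Fin 2,
    xiCoeff n h γ ν • (LamPrime n h γ e * xiTerm n h γ e ν).current (heisenberg n h γ) a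

/-- The current `E(z)`. -/
def E (n : ℕ) (h γ : ℂ) : Current (Boson n) := ratCurrent n h γ false

/-- The current `F(z)`. -/
def F (n : ℕ) (h γ : ℂ) : Current (Boson n) := ratCurrent n h γ true

end OspW

end

namespace OspW
open PowerSeries

section ExpCoeff

variable {R : Type} [Ring R]

theorem coeff_pow_eq_zero {A : PowerSeries R} (hA : coeff 0 A = 0) {m k : ℕ} (h : m < k) :
    coeff m (A ^ k) = 0 := by
  apply PowerSeries.coeff_of_lt_order
  refine lt_of_lt_of_le ?_ (PowerSeries.le_order_pow_of_constantCoeff_eq_zero k ?_)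
  · exact_mod_cast h
  · simpa using hA

/-- Commuting past `T` when `[A, T] = a x ^ s` with a scalar `a`. -/
theorem pow_mul_C_of_commutator [Algebra ℂ R] {A : PowerSeries R} {T : R} {a : ℂ} {s : ℕ}
    (h : ∀ r, coeff r A * T = T * coeff r A + if r = s then algebraMap ℂ R a else 0)
    (k m : ℕ) :
    coeff m (A ^ (k + 1)) * T
      = T * coeff m (A ^ (k + 1))
        + if s ≤ m then ((k + 1 : ℂ) * a) • coeff (m - s) (A ^ k) else 0 := by
  have hA : A * C T = C T * A + C (algebraMap ℂ R a) * PowerSeries.X ^ s := by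
    ext r
    simp only [coeff_mul_C, map_add, coeff_C_mul, coeff_X_pow, h, mul_ite, mul_one, mul_zero]
  have hc : ∀ B : PowerSeries R, B * (C (algebraMap ℂ R a) * PowerSeries.X ^ s) =
      a • (B * PowerSeries.X ^ s) := by
    intro B
    have h1 : C (algebraMap ℂ R a) * PowerSeries.X ^ s = a • (PowerSeries.X ^ s : PowerSeries R) := by
      ext r
      rw [coeff_C_mul, coeff_smul, coeff_X_pow, Algebra.smul_def]
    rw [h1, mul_smul_comm]
  have hX : ∀ B : PowerSeries R, PowerSeries.X ^ s * B = B * PowerSeries.X ^ s := fun B => PowerSeries.X_pow_mul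
  have key : ∀ k : ℕ, A ^ (k + 1) * C T
      = C T * A ^ (k + 1) + ((k + 1 : ℂ) * a) • (A ^ k * PowerSeries.X ^ s) := by
    intro k
    induction k with
    | zero =>
      simp only [zero_add, pow_one, hA, pow_zero, one_mul]
      have := hc 1
      rw [one_mul, one_mul] at this
      rw [this]; simp
    | succ k ih =>
      rw [pow_succ A (k + 1), mul_assoc, hA, mul_add, ← mul_assoc, ih, hc, add_mul, smul_mul_assoc,
        mul_assoc, mul_assoc (A ^ k), hX, ← mul_assoc (A ^ k), add_assoc, ← pow_succ A k, ← add_smul]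
      congr 2
      push_cast; ring
  have := congrArg (coeff m) (key k)
  rw [coeff_mul_C, map_add, coeff_C_mul] at this
  rw [this]
  congr 1
  rw [coeff_smul, coeff_mul_X_pow']
  split_ifs <;> simp

end ExpCoeff

section Exp

variable {M : Type} [AddCommGroup M] [Module ℂ M]

theorem expCoeff_eq_sum_of_le {A : PowerSeries (Module.End ℂ M)} (hA : coeff 0 A = 0) {m N : ℕ}
    (h : m ≤ N) :
    expCoeff A m = ∑ k ∈ Finset.range (N + 1), ((k.factorial : ℂ)⁻¹) • coeff m (A ^ k) := by
  rw [expCoeff]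
  refine Finset.sum_subset (by simpa using h) fun k _ hk => ?_
  rw [coeff_pow_eq_zero hA (by simpa using hk), smul_zero]

theorem expCoeff_zero {A : PowerSeries (Module.End ℂ M)} : expCoeff A 0 = 1 := by
  simp [expCoeff]

/-- `exp(A) T = T exp(A) + a x ^ s exp(A)` if `[A, T] = a x ^ s` with a scalar `a`. -/
theorem expCoeff_mul_of_commutator {A : PowerSeries (Module.End ℂ M)} (hA : coeff 0 A = 0)
    {T : Module.End ℂ M} {a : ℂ} {s : ℕ}
    (h : ∀ r, coeff r A * T = T * coeff r A + if r = s then algebraMap ℂ _ a else 0) (m : ℕ) :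
    expCoeff A m * T = T * expCoeff A m + if s ≤ m then a • expCoeff A (m - s) else 0 := by
  rw [expCoeff_eq_sum_of_le hA (Nat.le_succ m), Finset.sum_range_succ', add_mul, mul_add,
    Finset.sum_mul, Finset.mul_sum]
  have h0 : (((0 : ℕ).factorial : ℂ)⁻¹ • coeff m (A ^ 0)) * T
      = T * ((((0 : ℕ).factorial : ℂ)⁻¹) • coeff m (A ^ 0)) := by
    rw [pow_zero, coeff_one]
    split_ifs <;> simp
  have h1 : ∀ k ∈ Finset.range (m + 1),
      ((((k + 1).factorial : ℂ)⁻¹) • coeff m (A ^ (k + 1))) * T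
      = T * ((((k + 1).factorial : ℂ)⁻¹) • coeff m (A ^ (k + 1)))
        + if s ≤ m then a • ((k.factorial : ℂ)⁻¹ • coeff (m - s) (A ^ k)) else 0 := by
    intro k _
    rw [smul_mul_assoc, pow_mul_C_of_commutator h, smul_add, mul_smul_comm]
    congr 1
    split_ifs with hs
    · rw [smul_smul, smul_smul]
      congr 1
      rw [Nat.factorial_succ]
      have : (k.factorial : ℂ) ≠ 0 := by exact_mod_cast k.factorial_ne_zero
      have h2 : (k + 1 : ℂ) ≠ 0 := by exact_mod_cast k.succ_ne_zero
      push_cast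
      field_simp
    · simp
  rw [Finset.sum_congr rfl h1, Finset.sum_add_distrib, h0, add_right_comm]
  congr 1
  split_ifs with hs
  · rw [← Finset.smul_sum, expCoeff_eq_sum_of_le hA (by omega : m - s ≤ m)]
  · simp

theorem expCoeff_commute {A : PowerSeries (Module.End ℂ M)} 
    {T : Module.End ℂ M} (h : ∀ r, coeff r A * T = T * coeff r A) (m : ℕ) :
    expCoeff A m * T = T * expCoeff A m := by
  have hA : Commute A (C T) := by
    ext1 r
    rw [coeff_mul_C, coeff_C_mul, h]
  rw [expCoeff, Finset.sum_mul, Finset.mul_sum]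
  refine Finset.sum_congr rfl fun k _ => ?_
  have := congrArg (coeff m) (hA.pow_left k).eq
  rw [coeff_mul_C, coeff_C_mul] at this
  rw [smul_mul_assoc, mul_smul_comm, this]

/-- The logarithmic derivative of `exp(A)`. -/
theorem natCast_smul_expCoeff {A : PowerSeries (Module.End ℂ M)} (hA : coeff 0 A = 0)
    (hcomm : ∀ r s, coeff r A * coeff s A = coeff s A * coeff r A) (m : ℕ) :
    (m : ℂ) • expCoeff A m
      = ∑ x ∈ Finset.HasAntidiagonal.antidiagonal m, ((x.1 : ℂ) • coeff x.1 A) * expCoeff A x.2 := by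
  let δ : PowerSeries (Module.End ℂ M) → PowerSeries (Module.End ℂ M) :=
    fun B => PowerSeries.mk fun r => (r : ℂ) • coeff r B
  have hδ : ∀ B D, δ (B * D) = δ B * D + B * δ D := by
    intro B D
    ext1 r
    simp only [δ, coeff_mk, map_add, coeff_mul, Finset.smul_sum, ← Finset.sum_add_distrib]
    refine Finset.sum_congr rfl fun x hx => ?_
    rw [← Finset.HasAntidiagonal.mem_antidiagonal.mp hx, smul_mul_assoc, mul_smul_comm, ← add_smul]
    push_cast; rfl
  have hA' : Commute A (δ A) := by
    ext1 r
    rw [coeff_mul, coeff_mul, ← Finset.Nat.sum_antidiagonal_swap]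
    refine Finset.sum_congr rfl fun x _ => ?_
    simp only [δ, coeff_mk, Prod.fst_swap, Prod.snd_swap, mul_smul_comm, smul_mul_assoc]
    rw [hcomm]
  have hpow : ∀ k : ℕ, δ (A ^ (k + 1)) = (k + 1 : ℂ) • (δ A * A ^ k) := by
    intro k
    induction k with
    | zero => simp
    | succ k ih =>
      rw [pow_succ, hδ, ih, smul_mul_assoc, mul_assoc, ← pow_succ, (hA'.pow_left (k + 1)).eq]
      push_cast
      rw [add_smul (k + 1 : ℂ) 1, one_smul]
  have h1 : ∀ k : ℕ, (m : ℂ) • coeff m (A ^ (k + 1))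
      = (k + 1 : ℂ) • ∑ x ∈ Finset.HasAntidiagonal.antidiagonal m, ((x.1 : ℂ) • coeff x.1 A) * coeff x.2 (A ^ k) := by
    intro k
    have := congrArg (coeff m) (hpow k)
    rw [coeff_smul, coeff_mul] at this
    simpa only [δ, coeff_mk] using this
  rw [expCoeff_eq_sum_of_le hA (Nat.le_succ m), Finset.sum_range_succ', smul_add]
  have h0 : (m : ℂ) • ((((0 : ℕ).factorial : ℂ)⁻¹) • coeff m (A ^ 0)) = 0 := by
    rw [pow_zero, coeff_one]
    split_ifs with h <;> simp [h]
  rw [h0, add_zero, Finset.smul_sum]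
  have h2 : ∀ x ∈ Finset.HasAntidiagonal.antidiagonal m, ((x.1 : ℂ) • coeff x.1 A) * expCoeff A x.2
      = ∑ k ∈ Finset.range (m + 1), ((k.factorial : ℂ)⁻¹) •
        (((x.1 : ℂ) • coeff x.1 A) * coeff x.2 (A ^ k)) := by
    intro x hx
    have := Finset.HasAntidiagonal.mem_antidiagonal.mp hx
    rw [expCoeff_eq_sum_of_le hA (by omega : x.2 ≤ m), Finset.mul_sum]
    simp only [mul_smul_comm]
  rw [Finset.sum_congr rfl h2, Finset.sum_comm]
  refine Finset.sum_congr rfl fun k _ => ?_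
  rw [smul_comm, h1, smul_smul, ← Finset.smul_sum]
  congr 1
  rw [Nat.factorial_succ]
  have : (k.factorial : ℂ) ≠ 0 := by exact_mod_cast k.factorial_ne_zero
  have h2 : (k + 1 : ℂ) ≠ 0 := by exact_mod_cast k.succ_ne_zero
  push_cast
  field_simp

end Exp
end OspW

namespace OspW
open Filter

section Commutators

variable {J : Type}

/-- Differentiation with respect to the variable `x`, as an operator. -/
noncomputable abbrev pd (x : J × ℕ) : Module.End ℂ (Osc J) := (MvPolynomial.pderiv (R := ℂ) x).toLinearMap

/-- Multiplication by the variable `x`, as an operator. -/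
noncomputable abbrev mulX (x : J × ℕ) : Module.End ℂ (Osc J) := LinearMap.mulLeft ℂ (MvPolynomial.X x)

/-- The coefficient of `h_{j,-(k+1)}` in a vertex operator, `x = (j, k)`. -/
def Vertex.creationMode (V : Vertex J) (x : J × ℕ) : ℂ := V.mode (-((x.2 : ℤ) + 1)) x.1

/-- The commutator of the annihilation part with `h_{l,-(k+1)}`, `x = (l, k)`. -/
noncomputable def Vertex.annihilationMode [Fintype J] (H : Heisenberg J) (V : Vertex J) (x : J × ℕ) : ℂ :=
  ∑ j, V.mode ((x.2 : ℤ) + 1) j * H.osc (x.2 + 1) j x.1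

/-- The coefficient of `z ^ m` in the creation part of a vertex operator. -/
noncomputable def creationCoeff [Fintype J] (V : Vertex J) (m : ℤ) : Module.End ℂ (Osc J) :=
  if 0 ≤ m then expCoeff V.creationSeries m.toNat else 0

theorem pd_mul_mulX [DecidableEq J] (x y : J × ℕ) :
    pd x * mulX y = mulX y * pd x + if x = y then 1 else 0 := by
  apply LinearMap.ext
  intro f
  simp only [Module.End.mul_apply, LinearMap.add_apply, LinearMap.mulLeft_apply]
  change MvPolynomial.pderiv x (MvPolynomial.X y * f) = _ * MvPolynomial.pderiv x f + _
  rw [Derivation.leibniz, MvPolynomial.pderiv_X]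
  by_cases h : x = y
  · subst h; simp [add_comm]
  · simp [h, Ne.symm h]

theorem pd_mul_pd (x y : J × ℕ) : pd x * pd y = pd y * pd x := by
  have h : ⁅MvPolynomial.pderiv (R := ℂ) x, MvPolynomial.pderiv (R := ℂ) y⁆ = 0 := by
    classical
    apply MvPolynomial.derivation_ext
    intro i
    rw [Derivation.commutator_apply]
    simp [MvPolynomial.pderiv_X, Pi.single_apply, apply_ite]
  apply LinearMap.ext
  intro f
  have := DFunLike.congr_fun h f
  rw [Derivation.commutator_apply] at this
  exact sub_eq_zero.mp this

theorem mulX_mul_mulX (x y : J × ℕ) : mulX x * mulX y = mulX y * mulX x := by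
  apply LinearMap.ext
  intro f
  simp only [Module.End.mul_apply, LinearMap.mulLeft_apply]
  ring

variable [Fintype J]

theorem coeff_zero_creationSeries (V : Vertex J) :
    PowerSeries.coeff 0 V.creationSeries = 0 := by
  simp [Vertex.creationSeries]

theorem coeff_succ_creationSeries (V : Vertex J) (k : ℕ) :
    PowerSeries.coeff (k + 1) V.creationSeries
      = ∑ j, V.creationMode (j, k) • mulX (j, k) := by
  simp [Vertex.creationSeries, Vertex.creationMode, creation]

theorem coeff_zero_annihilationSeries (H : Heisenberg J) (V : Vertex J) :
    PowerSeries.coeff 0 (V.annihilationSeries H) = 0 := by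
  simp [Vertex.annihilationSeries]

theorem coeff_succ_annihilationSeries (H : Heisenberg J) (V : Vertex J) (k : ℕ) :
    PowerSeries.coeff (k + 1) (V.annihilationSeries H)
      = ∑ l, V.annihilationMode H (l, k) • pd (l, k) := by
  simp only [Vertex.annihilationSeries, Vertex.annihilationMode, annihilation,
    PowerSeries.coeff_mk, Finset.smul_sum, smul_smul, Finset.sum_smul]
  exact Finset.sum_comm

theorem coeff_creationSeries_mul_pd (V : Vertex J) (x : J × ℕ) (r : ℕ) :
    PowerSeries.coeff r V.creationSeries * pd x
      = pd x * PowerSeries.coeff r V.creationSeries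
        + if r = x.2 + 1 then algebraMap ℂ _ (-V.creationMode x) else 0 := by
  classical
  obtain ⟨j, k⟩ := x
  rcases r with _ | r
  · simp [coeff_zero_creationSeries]
  · rw [coeff_succ_creationSeries, Finset.sum_mul, Finset.mul_sum]
    have h : ∀ i, (V.creationMode (i, r) • mulX (i, r)) * pd (j, k)
        = pd (j, k) * (V.creationMode (i, r) • mulX (i, r))
          - if (j, k) = (i, r) then algebraMap ℂ _ (V.creationMode (i, r)) else 0 := by
      intro i
      rw [mul_smul_comm, pd_mul_mulX, smul_mul_assoc, smul_add]
      split_ifs <;> simp [Algebra.algebraMap_eq_smul_one]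
    rw [Finset.sum_congr rfl fun i _ => h i, Finset.sum_sub_distrib, sub_eq_add_neg]
    simp only [Prod.mk.injEq]
    congr 1
    by_cases hk : k = r
    · subst hk; simp
    · simp [hk, Ne.symm hk]

theorem coeff_annihilationSeries_mul_mulX (H : Heisenberg J) (V : Vertex J) (x : J × ℕ) (r : ℕ) :
    PowerSeries.coeff r (V.annihilationSeries H) * mulX x
      = mulX x * PowerSeries.coeff r (V.annihilationSeries H)
        + if r = x.2 + 1 then algebraMap ℂ _ (V.annihilationMode H x) else 0 := by
  classical
  obtain ⟨j, k⟩ := x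
  rcases r with _ | r
  · simp [coeff_zero_annihilationSeries]
  · rw [coeff_succ_annihilationSeries, Finset.sum_mul, Finset.mul_sum]
    have h : ∀ i, (V.annihilationMode H (i, r) • pd (i, r)) * mulX (j, k)
        = mulX (j, k) * (V.annihilationMode H (i, r) • pd (i, r))
          + if (i, r) = (j, k) then algebraMap ℂ _ (V.annihilationMode H (i, r)) else 0 := by
      intro i
      rw [mul_smul_comm, smul_mul_assoc, pd_mul_mulX, smul_add]
      split_ifs <;> simp [Algebra.algebraMap_eq_smul_one]
    simp only [h, Finset.sum_add_distrib, Prod.mk.injEq]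
    congr 1
    by_cases hk : r = k
    · subst hk; simp
    · simp [hk]

theorem creationCoeff_mul_pd (V : Vertex J) (x : J × ℕ) (m : ℤ) :
    creationCoeff V m * pd x
      = pd x * creationCoeff V m - V.creationMode x • creationCoeff V (m - (x.2 + 1)) := by
  simp only [creationCoeff]
  by_cases hm : 0 ≤ m
  · rw [if_pos hm, expCoeff_mul_of_commutator (coeff_zero_creationSeries V)
      (coeff_creationSeries_mul_pd V x), sub_eq_add_neg]
    congr 1
    by_cases h : x.2 + 1 ≤ m.toNat
    · rw [if_pos h, if_pos (by omega)]
      have h1 : m.toNat - (x.2 + 1) = (m - (x.2 + 1)).toNat := by omega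
      rw [h1]
      module
    · rw [if_neg h, if_neg (by omega)]; simp
  · rw [if_neg hm, if_neg (by omega)]; simp

theorem creationCoeff_mul_mulX (V : Vertex J) (x : J × ℕ) (m : ℤ) :
    creationCoeff V m * mulX x = mulX x * creationCoeff V m := by
  simp only [creationCoeff]
  split_ifs with hm
  · apply expCoeff_commute
    intro r
    rcases r with _ | r
    · simp [coeff_zero_creationSeries]
    · rw [coeff_succ_creationSeries, Finset.sum_mul, Finset.mul_sum]
      refine Finset.sum_congr rfl fun i _ => ?_
      rw [smul_mul_assoc, mulX_mul_mulX, mul_smul_comm]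
  · simp

theorem expCoeff_annihilationSeries_mul_mulX (H : Heisenberg J) (V : Vertex J) (x : J × ℕ)
    (m : ℕ) :
    expCoeff (V.annihilationSeries H) m * mulX x
      = mulX x * expCoeff (V.annihilationSeries H) m
        + if x.2 + 1 ≤ m then
            V.annihilationMode H x • expCoeff (V.annihilationSeries H) (m - (x.2 + 1)) else 0 :=
  expCoeff_mul_of_commutator (coeff_zero_annihilationSeries H V)
    (coeff_annihilationSeries_mul_mulX H V x) m

theorem expCoeff_annihilationSeries_mul_pd (H : Heisenberg J) (V : Vertex J) (x : J × ℕ)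
    (m : ℕ) :
    expCoeff (V.annihilationSeries H) m * pd x = pd x * expCoeff (V.annihilationSeries H) m := by
  apply expCoeff_commute
  intro r
  rcases r with _ | r
  · simp [coeff_zero_annihilationSeries]
  · rw [coeff_succ_annihilationSeries, Finset.sum_mul, Finset.mul_sum]
    refine Finset.sum_congr rfl fun i _ => ?_
    rw [smul_mul_assoc, pd_mul_pd, mul_smul_comm]

theorem oscCoeff_apply (H : Heisenberg J) (V : Vertex J) (f : Osc J) :
    ∀ᶠ N in atTop, ∀ m, V.oscCoeff H m f
      = ∑ k ∈ Finset.range N, creationCoeff V (m + k) (expCoeff (V.annihilationSeries H) k f) := by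
  induction f using MvPolynomial.induction_on' with
  | monomial d a =>
    filter_upwards [eventually_ge_atTop (weight d + 1)] with N hN m
    have h : MvPolynomial.monomial d a = a • MvPolynomial.basisMonomials (J × ℕ) ℂ d := by
      simp [MvPolynomial.smul_monomial]
    have h1 : V.oscCoeff H m (MvPolynomial.monomial d 1) = ∑ k ∈ Finset.range (weight d + 1),
        creationCoeff V (m + k)
          (expCoeff (V.annihilationSeries H) k (MvPolynomial.monomial d 1)) := by
      have h2 : MvPolynomial.monomial d (1 : ℂ) = MvPolynomial.basisMonomials (J × ℕ) ℂ d := by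
        simp
      conv_lhs => rw [h2]
      rw [Vertex.oscCoeff, Module.Basis.constr_basis]
      refine Finset.sum_congr rfl fun k _ => ?_
      simp only [creationCoeff]
      split_ifs <;> rfl
    simp only [h, map_smul, ← Finset.smul_sum, MvPolynomial.coe_basisMonomials, h1]
    congr 1
    refine Finset.sum_subset (by simpa using hN) fun k _ hk => ?_
    rw [expCoeff_annihilationSeries_monomial H V d k (by simpa using hk), map_zero]
  | add f g hf hg =>
    filter_upwards [hf, hg] with N hf hg m
    simp only [map_add, hf, hg, Finset.sum_add_distrib]

theorem oscCoeff_mulX (H : Heisenberg J) (V : Vertex J) (x : J × ℕ) (m : ℤ) (f : Osc J) :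
    V.oscCoeff H m (MvPolynomial.X x * f)
      = MvPolynomial.X x * V.oscCoeff H m f
        + V.annihilationMode H x • V.oscCoeff H (m + (x.2 + 1)) f := by
  obtain ⟨N, h1, h2, h3⟩ := (((tendsto_add_atTop_nat (x.2 + 1)).eventually
    (oscCoeff_apply H V (MvPolynomial.X x * f))).and
    (((tendsto_add_atTop_nat (x.2 + 1)).eventually (oscCoeff_apply H V f)).and
      (oscCoeff_apply H V f))).exists
  rw [h1, h2, h3, Finset.mul_sum, Finset.smul_sum]
  have h4 : ∀ k : ℕ, creationCoeff V (m + k)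
        (expCoeff (V.annihilationSeries H) k (MvPolynomial.X x * f))
      = MvPolynomial.X x * creationCoeff V (m + k) (expCoeff (V.annihilationSeries H) k f)
        + if x.2 + 1 ≤ k then V.annihilationMode H x •
            creationCoeff V (m + k) (expCoeff (V.annihilationSeries H) (k - (x.2 + 1)) f)
          else 0 := by
    intro k
    have h5 := DFunLike.congr_fun (expCoeff_annihilationSeries_mul_mulX H V x k) f
    have h6 := DFunLike.congr_fun (creationCoeff_mul_mulX V x (m + k))
      (expCoeff (V.annihilationSeries H) k f)
    simp only [Module.End.mul_apply, LinearMap.add_apply, LinearMap.mulLeft_apply] at h5 h6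
    rw [h5, map_add, h6]
    congr 1
    split_ifs <;> simp
  rw [Finset.sum_congr rfl fun k _ => h4 k, Finset.sum_add_distrib]
  congr 1
  rw [add_comm N, Finset.sum_range_add, Finset.sum_eq_zero, zero_add]
  · refine Finset.sum_congr rfl fun k _ => ?_
    rw [if_pos (by omega)]
    congr 3
    · push_cast; ring
    · congr 1; omega
  · intro k hk
    rw [if_neg]
    simpa using hk

theorem pd_oscCoeff (H : Heisenberg J) (V : Vertex J) (x : J × ℕ) (m : ℤ) (f : Osc J) :
    MvPolynomial.pderiv x (V.oscCoeff H m f)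
      = V.oscCoeff H m (MvPolynomial.pderiv x f)
        + V.creationMode x • V.oscCoeff H (m - (x.2 + 1)) f := by
  obtain ⟨N, h1, h2⟩ := ((oscCoeff_apply H V (MvPolynomial.pderiv x f)).and
    (oscCoeff_apply H V f)).exists
  rw [h1, h2, h2, map_sum, Finset.smul_sum, ← Finset.sum_add_distrib]
  refine Finset.sum_congr rfl fun k _ => ?_
  have h5 := DFunLike.congr_fun (expCoeff_annihilationSeries_mul_pd H V x k) f
  have h6 := DFunLike.congr_fun (creationCoeff_mul_pd V x (m + k))
      (expCoeff (V.annihilationSeries H) k f)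
  simp only [Module.End.mul_apply, LinearMap.sub_apply, LinearMap.smul_apply] at h5 h6
  change _ = MvPolynomial.pderiv x _ at h5
  change creationCoeff V (m + k) (MvPolynomial.pderiv x _) = MvPolynomial.pderiv x _ - _ at h6
  change _ = creationCoeff V (m + k) (expCoeff _ _ (pd x f)) + _
  rw [h5, h6, sub_add_eq_add_sub, eq_sub_iff_add_eq]
  congr 3
  congr 1
  ring

theorem expCoeff_annihilationSeries_one (H : Heisenberg J) (V : Vertex J) (k : ℕ) :
    expCoeff (V.annihilationSeries H) k 1 = if k = 0 then 1 else 0 := by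
  split_ifs with h
  · subst h; rw [expCoeff_zero]; rfl
  · have h1 : (1 : Osc J) = MvPolynomial.monomial 0 1 := rfl
    rw [h1, expCoeff_annihilationSeries_monomial]
    simp only [weight, map_zero]
    omega

theorem oscCoeff_one (H : Heisenberg J) (V : Vertex J) (m : ℤ) :
    V.oscCoeff H m 1 = creationCoeff V m 1 := by
  obtain ⟨N, h1, h2⟩ := ((oscCoeff_apply H V 1).and (eventually_ge_atTop 1)).exists
  rw [h1, Finset.sum_eq_single 0]
  · simp [expCoeff_annihilationSeries_one]
  · intro k _ hk
    rw [expCoeff_annihilationSeries_one, if_neg hk, map_zero]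
  · intro h
    simp at h
    omega

theorem creationCoeff_zero (V : Vertex J) : creationCoeff V 0 = 1 := by
  simp [creationCoeff, expCoeff_zero]

theorem creationCoeff_neg (V : Vertex J) {m : ℤ} (hm : m < 0) : creationCoeff V m = 0 := by
  rw [creationCoeff, if_neg (by omega)]

theorem natCast_smul_creationCoeff (V : Vertex J) (m : ℕ) :
    (m : ℂ) • creationCoeff V m
      = ∑ k ∈ Finset.range m, ((k : ℂ) + 1) •
          ∑ j, V.creationMode (j, k) • (mulX (j, k) * creationCoeff V ((m : ℤ) - (k + 1))) := by
  have h := natCast_smul_expCoeff (coeff_zero_creationSeries V) (fun r s => by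
    rcases r with _ | r
    · simp [coeff_zero_creationSeries]
    rcases s with _ | s
    · simp [coeff_zero_creationSeries]
    rw [coeff_succ_creationSeries, coeff_succ_creationSeries, Finset.sum_mul_sum,
      Finset.sum_mul_sum, Finset.sum_comm]
    refine Finset.sum_congr rfl fun i _ => Finset.sum_congr rfl fun j _ => ?_
    rw [smul_mul_smul_comm, smul_mul_smul_comm, mulX_mul_mulX, mul_comm]) m
  have h0 : ∀ r : ℕ, creationCoeff V r = expCoeff V.creationSeries r := by
    intro r; simp [creationCoeff]
  rw [h0, h, Finset.Nat.sum_antidiagonal_eq_sum_range_succ_mk, Finset.sum_range_succ']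
  simp only [Nat.cast_zero, zero_smul, zero_mul, add_zero]
  refine Finset.sum_congr rfl fun k hk => ?_
  have hk' : k < m := by simpa using hk
  have h1 : (m : ℤ) - (k + 1) = ((m - (k + 1) : ℕ) : ℤ) := by omega
  rw [coeff_succ_creationSeries, smul_mul_assoc, Finset.sum_mul, h1, h0]
  push_cast
  simp only [smul_mul_assoc]

end Commutators
end OspW

namespace OspW
open Filter

section Contraction

variable {J : Type} [Fintype J]

/-- `C(w / z)` is the contraction of the oscillator parts of `V(z)` and `W(w)`: it is characterized
by its logarithmic derivative. -/
def IsContraction (H : Heisenberg J) (V W : Vertex J) (C : PowerSeries ℂ) : Prop :=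
  PowerSeries.coeff 0 C = 1 ∧ ∀ m : ℕ, (m : ℂ) * PowerSeries.coeff m C
    = ∑ k ∈ Finset.range m, ((k : ℂ) + 1) *
        (∑ j, V.annihilationMode H (j, k) * W.creationMode (j, k)) *
          PowerSeries.coeff (m - (k + 1)) C

theorem constantCoeff_creationCoeff_one (V : Vertex J) (m : ℤ) :
    MvPolynomial.constantCoeff (creationCoeff V m 1) = if m = 0 then 1 else 0 := by
  split_ifs with h
  · subst h; rw [creationCoeff_zero]; simp
  · rcases lt_or_ge m 0 with hm | hm
    · rw [creationCoeff_neg V hm]; simp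
    · lift m to ℕ using hm
      have hm0 : (m : ℂ) ≠ 0 := by exact_mod_cast h
      have h1 := congrArg (fun T => MvPolynomial.constantCoeff (T (1 : Osc J)))
        (natCast_smul_creationCoeff V m)
      simp only [LinearMap.smul_apply, LinearMap.sum_apply, Module.End.mul_apply,
        LinearMap.mulLeft_apply, map_sum, MvPolynomial.constantCoeff_smul, map_mul,
        MvPolynomial.constantCoeff_X, zero_mul, smul_zero, Finset.sum_const_zero] at h1
      simpa [hm0] using h1

theorem constantCoeff_oscCoeff_creationCoeff (H : Heisenberg J) (V W : Vertex J)
    {C : PowerSeries ℂ} (hC : IsContraction H V W C) (l : ℕ) (m : ℤ) :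
    MvPolynomial.constantCoeff (V.oscCoeff H m (creationCoeff W l 1))
      = if m = -l then PowerSeries.coeff l C else 0 := by
  induction l using Nat.strong_induction_on generalizing m with
  | _ l ih =>
  rcases Nat.eq_zero_or_pos l with rfl | hl
  · rw [Nat.cast_zero, creationCoeff_zero, Module.End.one_apply, oscCoeff_one,
      constantCoeff_creationCoeff_one, hC.1, neg_zero]
  · have hl0 : (l : ℂ) ≠ 0 := by exact_mod_cast hl.ne'
    have h1 := congrArg (fun T => MvPolynomial.constantCoeff (V.oscCoeff H m (T (1 : Osc J))))
      (natCast_smul_creationCoeff W l)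
    simp only [LinearMap.smul_apply, LinearMap.sum_apply, Module.End.mul_apply, map_smul,
      LinearMap.mulLeft_apply, map_sum, MvPolynomial.constantCoeff_smul, oscCoeff_mulX,
      map_add, map_mul, MvPolynomial.constantCoeff_X, zero_mul, zero_add] at h1
    apply mul_left_cancel₀ hl0
    rw [smul_eq_mul] at h1
    have h3 : (if m = -(l : ℤ) then (l : ℂ) * PowerSeries.coeff l C else 0)
        = ∑ k ∈ Finset.range l, if m = -(l : ℤ) then ((k : ℂ) + 1) *
        (∑ j, V.annihilationMode H (j, k) * W.creationMode (j, k)) *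
          PowerSeries.coeff (l - (k + 1)) C else 0 := by
      split_ifs
      · exact hC.2 l
      · simp
    rw [h1, mul_ite, mul_zero, h3]
    refine Finset.sum_congr rfl fun k hk => ?_
    have hk' : k < l := by simpa using hk
    have h2 : (l : ℤ) - (k + 1) = ((l - (k + 1) : ℕ) : ℤ) := by omega
    rw [h2, ih _ (by omega)]
    by_cases hm : m = -l
    · rw [if_pos hm, if_pos (by omega)]
      simp only [smul_eq_mul, Finset.sum_mul, Finset.mul_sum]
      refine Finset.sum_congr rfl fun j _ => ?_
      ring
    · rw [if_neg hm, if_neg (by omega)]; simp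

end Contraction

section FormalField

/-- Formal series in `z` and `w`, expanded in `w / z`; `toLex (l, s)` is the exponent of
`(w / z) ^ l z ^ s`. -/
abbrev FormalField : Type := HahnSeries (ℤ ×ₗ ℤ) ℂ

noncomputable def zVar : FormalField := HahnSeries.single (toLex (0, 1)) 1
noncomputable def wVar : FormalField := HahnSeries.single (toLex (1, 1)) 1

/-- The coefficient of `z ^ m w ^ l`. -/
noncomputable def zwCoeff (m l : ℤ) : FormalField →ₗ[ℂ] ℂ where
  toFun k := k.coeff (toLex (l, m + l))
  map_add' _ _ := rfl
  map_smul' _ _ := rfl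

def ratioExponent : ℤ →+ (ℤ ×ₗ ℤ) where
  toFun l := toLex (l, 0)
  map_zero' := rfl
  map_add' a b := by
    change _ = toLex ((a, (0:ℤ)) + (b, 0))
    simp

theorem ratioExponent_injective : Function.Injective ratioExponent := by
  intro a b h
  exact congrArg (fun x => (ofLex x).1) h

theorem ratioExponent_le (a b : ℤ) : ratioExponent a ≤ ratioExponent b ↔ a ≤ b := by
  change toLex (a, (0:ℤ)) ≤ toLex (b, 0) ↔ _
  rw [Prod.Lex.toLex_le_toLex]
  simp [le_iff_lt_or_eq]

/-- The substitution of `w / z` into a power series. -/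
noncomputable def ratioSeries : PowerSeries ℂ →+* FormalField :=
  (HahnSeries.embDomainRingHom ratioExponent ratioExponent_injective ratioExponent_le).comp
    (HahnSeries.ofPowerSeries ℤ ℂ)

theorem zwCoeff_ratioSeries (C : PowerSeries ℂ) (m l : ℤ) :
    zwCoeff m l (ratioSeries C)
      = if m = -l ∧ 0 ≤ l then PowerSeries.coeff l.toNat C else 0 := by
  change (HahnSeries.embDomain ⟨⟨ratioExponent, ratioExponent_injective⟩, ratioExponent_le _ _⟩
    (HahnSeries.ofPowerSeries ℤ ℂ C)).coeff (toLex (l, m + l)) = _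
  by_cases h : m = -l
  · have h1 : toLex (l, m + l) = (⟨⟨ratioExponent, ratioExponent_injective⟩, ratioExponent_le _ _⟩ :
        ℤ ↪o (ℤ ×ₗ ℤ)) l := by
      subst h
      change toLex (l, -l + l) = toLex (l, 0)
      simp
    rw [h1, HahnSeries.embDomain_coeff]
    by_cases hl : 0 ≤ l
    · rw [if_pos ⟨h, hl⟩]
      lift l to ℕ using hl
      rw [HahnSeries.ofPowerSeries_apply_coeff]; simp
    · rw [if_neg (fun h => hl h.2), HahnSeries.ofPowerSeries_apply, HahnSeries.embDomain_of_notMem_range]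
      rintro ⟨a, ha⟩
      apply hl
      rw [← ha]
      exact Int.natCast_nonneg a
  · rw [if_neg (fun h' => h h'.1), HahnSeries.embDomain_of_notMem_range]
    rintro ⟨a, ha⟩
    have h1 : ((a : ℤ), (0 : ℤ)) = (l, m + l) := ha
    rw [Prod.mk.injEq] at h1
    omega

theorem zVar_ne_zero : zVar ≠ 0 := HahnSeries.single_ne_zero one_ne_zero
theorem wVar_ne_zero : wVar ≠ 0 := HahnSeries.single_ne_zero one_ne_zero

theorem zwCoeff_zVar_mul (m l : ℤ) (k : FormalField) :
    zwCoeff m l (zVar * k) = zwCoeff (m - 1) l k := by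
  have h : toLex (l, m + l) = toLex (l, m - 1 + l) + toLex (0, 1) := by
    change toLex (l, m + l) = toLex ((l, m - 1 + l) + (0, 1))
    congr 1
    ext <;> simp
    ring
  change (zVar * k).coeff _ = k.coeff _
  rw [h, zVar, HahnSeries.coeff_single_mul_add, one_mul]

theorem zwCoeff_wVar_mul (m l : ℤ) (k : FormalField) :
    zwCoeff m l (wVar * k) = zwCoeff m (l - 1) k := by
  have h : toLex (l, m + l) = toLex (l - 1, m + (l - 1)) + toLex (1, 1) := by
    change toLex (l, m + l) = toLex ((l - 1, m + (l - 1)) + (1, 1))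
    congr 1
    ext <;> simp
    ring
  change (wVar * k).coeff _ = k.coeff _
  rw [h, wVar, HahnSeries.coeff_single_mul_add, one_mul]

theorem zwCoeff_zpow_mul (m l a : ℤ) (k : FormalField) :
    zwCoeff m l (zVar ^ a * k) = zwCoeff (m - a) l k := by
  induction a using Int.induction_on generalizing m k with
  | zero => simp
  | succ a ih =>
    rw [zpow_add₀ zVar_ne_zero, mul_assoc, ih, zpow_one, zwCoeff_zVar_mul, sub_sub]
  | pred a ih =>
    have h := zwCoeff_zVar_mul (m + 1) l (zVar ^ (-(a : ℤ) - 1) * k)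
    rw [add_sub_cancel_right, ← mul_assoc, ← zpow_one_add₀ zVar_ne_zero, add_sub_cancel, ih] at h
    rw [← h]; congr 2; ring

theorem zwCoeff_wpow_mul (m l a : ℤ) (k : FormalField) :
    zwCoeff m l (wVar ^ a * k) = zwCoeff m (l - a) k := by
  induction a using Int.induction_on generalizing l k with
  | zero => simp
  | succ a ih =>
    rw [zpow_add₀ wVar_ne_zero, mul_assoc, ih, zpow_one, zwCoeff_wVar_mul, sub_sub]
  | pred a ih =>
    have h := zwCoeff_wVar_mul m (l + 1) (wVar ^ (-(a : ℤ) - 1) * k)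
    rw [add_sub_cancel_right, ← mul_assoc, ← zpow_one_add₀ wVar_ne_zero, add_sub_cancel, ih] at h
    rw [← h]; congr 2; ring

theorem ratioSeries_C (c : ℂ) : ratioSeries (PowerSeries.C c) = algebraMap ℂ FormalField c := by
  rw [ratioSeries, RingHom.comp_apply, HahnSeries.ofPowerSeries_C,
    HahnSeries.embDomainRingHom_C]
  rfl

theorem zwCoeff_algebraMap_mul (m l : ℤ) (c : ℂ) (k : FormalField) :
    zwCoeff m l (algebraMap ℂ _ c * k) = c * zwCoeff m l k := by
  have h : algebraMap ℂ FormalField c = HahnSeries.C c := rfl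
  change (algebraMap ℂ _ c * k).coeff _ = c * k.coeff _
  rw [h, HahnSeries.C_apply, HahnSeries.coeff_single_zero_mul]

theorem ratioSeries_X : ratioSeries PowerSeries.X = wVar / zVar := by
  rw [eq_div_iff zVar_ne_zero, ratioSeries, RingHom.comp_apply, HahnSeries.ofPowerSeries_X]
  change HahnSeries.embDomain _ _ * _ = _
  rw [HahnSeries.embDomain_single, zVar, HahnSeries.single_mul_single, wVar, one_mul]
  rfl

end FormalField
end OspW

namespace OspW

section Kernel

variable {J : Type} [Fintype J]

/-- The coefficient of the creation mode `x` in `:V(z) W(w):`. -/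
noncomputable def creationSymbol (V W : Vertex J) (x : J × ℕ) : FormalField :=
  algebraMap ℂ _ (V.creationMode x) * zVar ^ ((x.2 : ℤ) + 1)
    + algebraMap ℂ _ (W.creationMode x) * wVar ^ ((x.2 : ℤ) + 1)

/-- The shift of the variable `x` by the annihilation part of `:V(z) W(w):`. -/
noncomputable def annihilationSymbol (H : Heisenberg J) (V W : Vertex J) (x : J × ℕ) :
    FormalField :=
  algebraMap ℂ _ (V.annihilationMode H x) * zVar ^ (-((x.2 : ℤ) + 1))
    + algebraMap ℂ _ (W.annihilationMode H x) * wVar ^ (-((x.2 : ℤ) + 1))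

theorem zwCoeff_symbol_mul (a b : ℂ) (r m l : ℤ) (A B : FormalField) :
    zwCoeff m l (A * ((algebraMap ℂ _ a * zVar ^ r + algebraMap ℂ _ b * wVar ^ r) * B))
      = a * zwCoeff (m - r) l (A * B) + b * zwCoeff m (l - r) (A * B) := by
  have h : A * ((algebraMap ℂ _ a * zVar ^ r + algebraMap ℂ _ b * wVar ^ r) * B)
      = algebraMap ℂ _ a * (zVar ^ r * (A * B)) + algebraMap ℂ _ b * (wVar ^ r * (A * B)) := by
    ring
  rw [h, map_add, zwCoeff_algebraMap_mul, zwCoeff_algebraMap_mul, zwCoeff_zpow_mul,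
    zwCoeff_wpow_mul]

theorem constantCoeff_oscCoeff_oscCoeff_one (H : Heisenberg J) (V W : Vertex J)
    {C : PowerSeries ℂ} (hC : IsContraction H V W C) (m l : ℤ) :
    MvPolynomial.coeff 0 (V.oscCoeff H m (W.oscCoeff H l 1)) = zwCoeff m l (ratioSeries C) := by
  rw [oscCoeff_one, zwCoeff_ratioSeries]
  rcases lt_or_ge l 0 with hl | hl
  · rw [creationCoeff_neg W hl, if_neg (by omega)]; simp
  · lift l to ℕ using hl
    have := constantCoeff_oscCoeff_creationCoeff H V W hC l m
    rw [MvPolynomial.constantCoeff_eq] at this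
    rw [this]
    simp

theorem exists_kernel_one (H : Heisenberg J) (d : J × ℕ →₀ ℕ) :
    ∃ P : MvPolynomial ((J × ℕ) ⊕ (J × ℕ)) ℂ, ∀ (V W : Vertex J) (C : PowerSeries ℂ),
      IsContraction H V W C → ∀ m l : ℤ,
        MvPolynomial.coeff d (V.oscCoeff H m (W.oscCoeff H l 1))
          = zwCoeff m l (ratioSeries C * MvPolynomial.aeval
              (Sum.elim (creationSymbol V W) (annihilationSymbol H V W)) P) := by
  classical
  induction hN : d.degree generalizing d with
  | zero =>
    refine ⟨1, fun V W C hC m l => ?_⟩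
    have hd : d = 0 := by simpa [Finsupp.degree_eq_zero_iff] using hN
    rw [hd, map_one (MvPolynomial.aeval _), mul_one, constantCoeff_oscCoeff_oscCoeff_one H V W hC]
  | succ N ih =>
    have hd : d ≠ 0 := by
      rintro rfl; simp at hN
    obtain ⟨x, hx⟩ := Finsupp.ne_iff.mp hd
    obtain ⟨d', rfl⟩ : ∃ d', d = d' + Finsupp.single x 1 :=
      ⟨d - Finsupp.single x 1, (tsub_add_cancel_of_le (by
        rw [Finsupp.single_le_iff]; exact Nat.one_le_iff_ne_zero.mpr hx)).symm⟩
    obtain ⟨P, hP⟩ := ih d' (by simpa using hN)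
    have hx0 : (d' x : ℂ) + 1 ≠ 0 := by exact_mod_cast Nat.succ_ne_zero (d' x)
    refine ⟨MvPolynomial.C ((d' x : ℂ) + 1)⁻¹ * (MvPolynomial.X (Sum.inl x) * P),
      fun V W C hC m l => ?_⟩
    have h1 : ∀ g : Osc J, MvPolynomial.coeff (d' + Finsupp.single x 1) g
        = ((d' x : ℂ) + 1)⁻¹ * MvPolynomial.coeff d' (MvPolynomial.pderiv x g) := by
      intro g
      rw [MvPolynomial.coeff_pderiv]
      field_simp
    rw [h1, pd_oscCoeff, pd_oscCoeff]
    have h2 : MvPolynomial.pderiv x (1 : Osc J) = 0 := Derivation.map_one_eq_zero _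
    rw [h2, map_zero, zero_add, map_smul, MvPolynomial.coeff_add, MvPolynomial.coeff_smul,
      MvPolynomial.coeff_smul, hP V W C hC, hP V W C hC, map_mul (MvPolynomial.aeval _),
      map_mul (MvPolynomial.aeval _), MvPolynomial.aeval_X, MvPolynomial.aeval_C, Sum.elim_inl,
      creationSymbol]
    have h3 : ∀ (c : ℂ) (A B : FormalField), A * (algebraMap ℂ _ c * B)
        = algebraMap ℂ _ c * (A * B) := fun c A B => by ring
    rw [h3, zwCoeff_algebraMap_mul, zwCoeff_symbol_mul, smul_eq_mul, smul_eq_mul]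
    ring

/-- A matrix element of `V(z) W(w)` is the contraction times a Laurent polynomial, which depends on
`V` and `W` only through their symbols. -/
theorem exists_kernel (H : Heisenberg J) (d : J × ℕ →₀ ℕ) (f : Osc J) :
    ∃ P : MvPolynomial ((J × ℕ) ⊕ (J × ℕ)) ℂ, ∀ (V W : Vertex J) (C : PowerSeries ℂ),
      IsContraction H V W C → ∀ m l : ℤ,
        MvPolynomial.coeff d (V.oscCoeff H m (W.oscCoeff H l f))
          = zwCoeff m l (ratioSeries C * MvPolynomial.aeval
              (Sum.elim (creationSymbol V W) (annihilationSymbol H V W)) P) := by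
  classical
  induction f using MvPolynomial.induction_on generalizing d with
  | C a =>
    obtain ⟨P, hP⟩ := exists_kernel_one H d
    refine ⟨MvPolynomial.C a * P, fun V W C hC m l => ?_⟩
    have h : MvPolynomial.C a = a • (1 : Osc J) := by
      rw [MvPolynomial.smul_eq_C_mul, mul_one]
    rw [h, map_smul, map_smul, MvPolynomial.coeff_smul, hP V W C hC,
      map_mul (MvPolynomial.aeval _), MvPolynomial.aeval_C, mul_left_comm, zwCoeff_algebraMap_mul,
      smul_eq_mul]
  | add f g hf hg =>
    obtain ⟨P, hP⟩ := hf d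
    obtain ⟨Q, hQ⟩ := hg d
    refine ⟨P + Q, fun V W C hC m l => ?_⟩
    rw [map_add, map_add, MvPolynomial.coeff_add, hP V W C hC, hQ V W C hC, map_add, mul_add,
      map_add]
  | mul_X f x hf =>
    obtain ⟨P, hP⟩ := hf d
    obtain ⟨Q, hQ⟩ := hf (d - Finsupp.single x 1)
    refine ⟨(if x ∈ d.support then Q else 0) + MvPolynomial.X (Sum.inr x) * P,
      fun V W C hC m l => ?_⟩
    rw [mul_comm f, oscCoeff_mulX, map_add, map_smul, oscCoeff_mulX, MvPolynomial.coeff_add,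
      MvPolynomial.coeff_add, MvPolynomial.coeff_smul, MvPolynomial.coeff_smul,
      MvPolynomial.coeff_X_mul', hP V W C hC, hP V W C hC, map_add, mul_add, map_add,
      map_mul (MvPolynomial.aeval _),
      MvPolynomial.aeval_X, Sum.elim_inr, annihilationSymbol, zwCoeff_symbol_mul, add_assoc]
    congr 1
    · split_ifs with h
      · rw [hQ V W C hC]
      · simp

end Kernel
end OspW

namespace OspW

section Macdonald

variable {K : Type} [Field K] [Algebra ℂ K]

variable (K) in
/-- The symmetric Laurent polynomials in two variables with complex coefficients, as functions. -/
def SymLaurent : Submodule ℂ (Kˣ → Kˣ → K) :=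
  Submodule.span ℂ {f | ∃ a b : ℤ, f = fun u v : Kˣ => (u ^ a * v ^ b + u ^ b * v ^ a : K)}

namespace SymLaurent

theorem monomial_mem (a b : ℤ) :
    (fun u v : Kˣ => (u ^ a * v ^ b + u ^ b * v ^ a : K)) ∈ SymLaurent K :=
  Submodule.subset_span ⟨a, b, rfl⟩

theorem one_mem : (1 : Kˣ → Kˣ → K) ∈ SymLaurent K := by
  have h := (SymLaurent K).smul_mem (1 / 2 : ℂ) (monomial_mem (K := K) 0 0)
  convert h using 1
  ext u v
  have h2 : (1 + 1 : K) = algebraMap ℂ K 2 := by rw [map_ofNat]; norm_num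
  simp only [Pi.smul_apply, zpow_zero, mul_one, Pi.one_apply]
  rw [Algebra.smul_def, h2, ← map_mul]
  norm_num

theorem mul_mem {f g : Kˣ → Kˣ → K} (hf : f ∈ SymLaurent K) (hg : g ∈ SymLaurent K) :
    f * g ∈ SymLaurent K := by
  induction hf using Submodule.span_induction with
  | zero => rw [zero_mul]; exact zero_mem _
  | add x y _ _ hx hy => rw [add_mul]; exact add_mem hx hy
  | smul c x _ hx => rw [smul_mul_assoc]; exact Submodule.smul_mem _ _ hx
  | mem x hx =>
    obtain ⟨a, b, rfl⟩ := hx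
    induction hg using Submodule.span_induction with
    | zero => rw [mul_zero]; exact zero_mem _
    | add x y _ _ hx hy => rw [mul_add]; exact add_mem hx hy
    | smul c x _ hx => rw [mul_smul_comm]; exact Submodule.smul_mem _ _ hx
    | mem x hx =>
      obtain ⟨c, d, rfl⟩ := hx
      convert add_mem (monomial_mem (K := K) (a + c) (b + d)) (monomial_mem (K := K) (a + d) (b + c))
        using 1
      ext u v
      simp only [Pi.mul_apply, Pi.add_apply, zpow_add₀ u.ne_zero, zpow_add₀ v.ne_zero]
      ring

theorem exists_divided_difference_add (k : ℕ) (d : ℤ) : ∃ s ∈ SymLaurent K, ∀ u v : Kˣ,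
    (u ^ (d + k) * v ^ d - u ^ d * v ^ (d + k) : K) = (u - v) * s u v := by
  induction k using Nat.strong_induction_on generalizing d with
  | _ k ih =>
  match k with
  | 0 => exact ⟨0, zero_mem _, fun u v => by simp⟩
  | 1 =>
    refine ⟨(1 / 2 : ℂ) • fun u v : Kˣ => (u ^ d * v ^ d + u ^ d * v ^ d : K),
      Submodule.smul_mem _ _ (monomial_mem d d), fun u v => ?_⟩
    have h2 : algebraMap ℂ K (1 / 2) * 2 = 1 := by
      rw [← map_ofNat (algebraMap ℂ K) 2, ← map_mul]; norm_num
    rw [Nat.cast_one, zpow_add_one₀ u.ne_zero, zpow_add_one₀ v.ne_zero, Pi.smul_apply, Pi.smul_apply,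
      Algebra.smul_def]
    linear_combination -(u - v : K) * (u ^ d * v ^ d) * h2
  | k + 2 =>
    obtain ⟨s, hs, h⟩ := ih k (by omega) (d + 1)
    refine ⟨(fun u v : Kˣ => (u ^ (d + k + 1) * v ^ d + u ^ d * v ^ (d + k + 1) : K)) + s,
      add_mem (monomial_mem _ _) hs, fun u v => ?_⟩
    rw [Pi.add_apply, Pi.add_apply, mul_add, ← h]
    have h1 : d + ((k + 2 : ℕ) : ℤ) = d + k + 1 + 1 := by push_cast; ring
    have h2 : d + 1 + (k : ℤ) = d + k + 1 := by ring
    rw [h1, h2]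
    simp only [zpow_add_one₀ u.ne_zero, zpow_add_one₀ v.ne_zero]
    ring

theorem exists_divided_difference (a b : ℤ) : ∃ s ∈ SymLaurent K, ∀ u v : Kˣ,
    (u ^ a * v ^ b - u ^ b * v ^ a : K) = (u - v) * s u v := by
  rcases le_total b a with h | h
  · obtain ⟨k, rfl⟩ := Int.le.dest h
    exact exists_divided_difference_add k b
  · obtain ⟨k, rfl⟩ := Int.le.dest h
    obtain ⟨s, hs, h⟩ := exists_divided_difference_add (K := K) k a
    refine ⟨-s, neg_mem hs, fun u v => ?_⟩
    rw [Pi.neg_apply, Pi.neg_apply, mul_neg, ← h]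
    ring

theorem shift_mem {f : Kˣ → Kˣ → K} (hf : f ∈ SymLaurent K) {p : Kˣ} {q : ℂ}
    (hp : (p : K) = algebraMap ℂ K q) : (fun u v => f (p * u) (p * v)) ∈ SymLaurent K := by
  induction hf using Submodule.span_induction with
  | zero => exact zero_mem _
  | add x y _ _ hx hy => exact add_mem hx hy
  | smul c x _ hx => exact Submodule.smul_mem _ _ hx
  | mem x hx =>
    obtain ⟨a, b, rfl⟩ := hx
    convert Submodule.smul_mem _ (q ^ (a + b)) (monomial_mem (K := K) a b) using 1
    ext u v
    simp only [Pi.smul_apply]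
    rw [Algebra.smul_def, map_zpow₀, ← hp, zpow_add₀ p.ne_zero, Units.val_mul, Units.val_mul]
    simp only [mul_zpow]
    ring

/-- The first Macdonald operator in two variables preserves symmetric Laurent polynomials. -/
theorem exists_macdonald {f : Kˣ → Kˣ → K} (hf : f ∈ SymLaurent K) {p : Kˣ} {q t : ℂ}
    (hp : (p : K) = algebraMap ℂ K q) : ∃ g ∈ SymLaurent K, ∀ u v : Kˣ,
      (algebraMap ℂ K t * u - v) * f (p * u) v + (u - algebraMap ℂ K t * v) * f u (p * v)
        = (u - v) * g u v := by
  induction hf using Submodule.span_induction with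
  | zero => exact ⟨0, zero_mem _, fun u v => by simp⟩
  | add x y _ _ hx hy =>
    obtain ⟨g, hg, h⟩ := hx
    obtain ⟨g', hg', h'⟩ := hy
    refine ⟨g + g', add_mem hg hg', fun u v => ?_⟩
    simp only [Pi.add_apply]
    linear_combination h u v + h' u v
  | smul c x _ hx =>
    obtain ⟨g, hg, h⟩ := hx
    refine ⟨c • g, Submodule.smul_mem _ _ hg, fun u v => ?_⟩
    simp only [Pi.smul_apply]
    rw [Algebra.smul_def, Algebra.smul_def, Algebra.smul_def]
    linear_combination algebraMap ℂ K c * h u v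
  | mem x hx =>
    obtain ⟨a, b, rfl⟩ := hx
    obtain ⟨s, hs, h⟩ := exists_divided_difference (K := K) (a + 1) b
    obtain ⟨s', hs', h'⟩ := exists_divided_difference (K := K) (b + 1) a
    refine ⟨(t * q ^ a + q ^ b) • s + (q ^ a + t * q ^ b) • s',
      add_mem (Submodule.smul_mem _ _ hs) (Submodule.smul_mem _ _ hs'), fun u v => ?_⟩
    simp only [Pi.add_apply, Pi.smul_apply]
    have h1 := h u v
    have h2 := h' u v
    rw [Algebra.smul_def, Algebra.smul_def]
    simp only [zpow_add_one₀ u.ne_zero, zpow_add_one₀ v.ne_zero] at h1 h2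
    simp only [map_add, map_mul, map_zpow₀, ← hp, Units.val_mul, mul_zpow]
    linear_combination (algebraMap ℂ K t * (p : K) ^ a + (p : K) ^ b) * h1
      + ((p : K) ^ a + algebraMap ℂ K t * (p : K) ^ b) * h2

theorem exists_finsupp {f : Kˣ → Kˣ → K} (hf : f ∈ SymLaurent K) :
    ∃ c : ℤ × ℤ →₀ ℂ, ∀ u v : Kˣ, f u v
      = c.sum fun x y => algebraMap ℂ K y * (u ^ x.1 * v ^ x.2 + u ^ x.2 * v ^ x.1) := by
  induction hf using Submodule.span_induction with
  | zero => exact ⟨0, fun u v => by simp⟩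
  | add x y _ _ hx hy =>
    obtain ⟨c, h⟩ := hx
    obtain ⟨c', h'⟩ := hy
    refine ⟨c + c', fun u v => ?_⟩
    rw [Finsupp.sum_add_index' (by simp) (by intros; rw [map_add, add_mul])]
    rw [Pi.add_apply, Pi.add_apply, h, h']
  | smul a x _ hx =>
    obtain ⟨c, h⟩ := hx
    refine ⟨a • c, fun u v => ?_⟩
    rw [Finsupp.sum_smul_index (by simp), Pi.smul_apply, Pi.smul_apply, h, Algebra.smul_def,
      Finsupp.mul_sum]
    simp only [map_mul, mul_assoc]
  | mem x hx =>
    obtain ⟨a, b, rfl⟩ := hx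
    refine ⟨Finsupp.single (a, b) 1, fun u v => ?_⟩
    rw [Finsupp.sum_single_index (by simp)]
    simp

end SymLaurent

/-- `∑_{j ≥ i} ν_j`, with nodes counted from `0`. -/
def level {n : ℕ} (ν : Fin n → Fin 2) (i : ℕ) : ℕ := ∑ j : Fin n, if i ≤ j.val then (ν j).val else 0

theorem level_snoc {n : ℕ} (ν : Fin n → Fin 2) (a : Fin 2) {i : ℕ} (hi : i ≤ n) :
    level (Fin.snoc (α := fun _ => Fin 2) ν a) i = a.val + level ν i := by
  rw [level, Fin.sum_univ_castSucc, level, add_comm]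
  simp [hi]

theorem level_self {n : ℕ} (ν : Fin n → Fin 2) : level ν n = 0 := by
  refine Finset.sum_eq_zero fun j _ => ?_
  rw [if_neg (by omega)]

/-- The coefficients of the Macdonald operator `f ↦ ∑_{a,b} stepFactor a b u v * f (p^a u) (p^b v)`. -/
noncomputable def stepFactor (t : K) (a b : Fin 2) (u v : K) : K :=
  if a = 1 then (if b = 1 then t else (t * u - v) / (u - v))
  else (if b = 1 then (u - t * v) / (u - v) else 1)

/-- The weight of a pair of paths. -/
noncomputable def pathWeight {n : ℕ} (κ : ℕ → ℂ) (t : K) (p : Kˣ) (ν μ : Fin n → Fin 2)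
    (u v : Kˣ) : K :=
  ∏ i : Fin n, algebraMap ℂ K (κ i) ^ ((ν i).val + (μ i).val) *
    stepFactor t (ν i) (μ i) (p ^ level ν (i + 1) * u) (p ^ level μ (i + 1) * v)

theorem exists_sum_stepFactor {f : Kˣ → Kˣ → K} (hf : f ∈ SymLaurent K) {p : Kˣ} {q t : ℂ}
    (hp : (p : K) = algebraMap ℂ K q) (κ : ℂ) : ∃ g ∈ SymLaurent K, ∀ u v : Kˣ, (u : K) ≠ v →
      ∑ a : Fin 2, ∑ b : Fin 2, algebraMap ℂ K κ ^ (a.val + b.val) *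
        stepFactor (algebraMap ℂ K t) a b u v * f (p ^ a.val * u) (p ^ b.val * v) = g u v := by
  obtain ⟨g, hg, h⟩ := SymLaurent.exists_macdonald hf (t := t) hp
  refine ⟨f + κ • g + (κ ^ 2 * t) • fun u v => f (p * u) (p * v), add_mem (add_mem hf
    (Submodule.smul_mem _ _ hg)) (Submodule.smul_mem _ _ (SymLaurent.shift_mem hf hp)),
    fun u v huv => ?_⟩
  have huv' : (u - v : K) ≠ 0 := sub_ne_zero.mpr huv
  have h' : g u v = ((algebraMap ℂ K t * u - v) * f (p * u) v
      + (u - algebraMap ℂ K t * v) * f u (p * v)) / (u - v) := by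
    rw [h, mul_div_cancel_left₀ _ huv']
  simp only [Fin.sum_univ_two, stepFactor, Fin.isValue, Pi.add_apply, Pi.smul_apply]
  rw [h', Algebra.smul_def, Algebra.smul_def]
  simp
  ring

theorem exists_sum_pathWeight_mul_prod {p : Kˣ} {q t : ℂ} (hp : (p : K) = algebraMap ℂ K q)
    (κ : ℕ → ℂ) (m : ℕ → Kˣ → Kˣ → K) (hm : ∀ i, m i ∈ SymLaurent K) (n : ℕ) :
    ∃ g ∈ SymLaurent K, ∀ u v : Kˣ, (∀ a b : ℕ, (p ^ a * u : K) ≠ p ^ b * v) →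
      ∑ ν : Fin n → Fin 2, ∑ μ : Fin n → Fin 2, pathWeight κ (algebraMap ℂ K t) p ν μ u v *
        ∏ i : Fin n, m i (p ^ level ν i * u) (p ^ level μ i * v) = g u v := by
  induction n with
  | zero => exact ⟨1, SymLaurent.one_mem, fun u v _ => by simp [pathWeight]⟩
  | succ n ih =>
    obtain ⟨g, hg, h⟩ := ih
    obtain ⟨g', hg', h'⟩ :=
      exists_sum_stepFactor (t := t) (SymLaurent.mul_mem (hm n) hg) hp (κ n)
    refine ⟨g', hg', fun u v huv => ?_⟩
    rw [← h' u v (by simpa using huv 0 0)]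
    rw [← (Fin.snocEquiv fun _ : Fin (n + 1) => Fin 2).sum_comp, Fintype.sum_prod_type]
    refine Finset.sum_congr rfl fun a _ => ?_
    have h1 : ∀ ν : Fin n → Fin 2, ∑ μ : Fin (n + 1) → Fin 2,
        pathWeight κ (algebraMap ℂ K t) p (Fin.snoc (α := fun _ => Fin 2) ν a) μ u v *
        ∏ i : Fin (n + 1), m i (p ^ level (Fin.snoc (α := fun _ => Fin 2) ν a) i * u)
          (p ^ level μ i * v)
        = ∑ b : Fin 2, ∑ μ : Fin n → Fin 2, (algebraMap ℂ K (κ n) ^ (a.val + b.val) *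
          stepFactor (algebraMap ℂ K t) a b u v * m n (p ^ a.val * u) (p ^ b.val * v)) *
          (pathWeight κ (algebraMap ℂ K t) p ν μ (p ^ a.val * u) (p ^ b.val * v) *
          ∏ i : Fin n, m i (p ^ level ν i * (p ^ a.val * u)) (p ^ level μ i * (p ^ b.val * v))) := by
      intro ν
      rw [← (Fin.snocEquiv fun _ : Fin (n + 1) => Fin 2).sum_comp, Fintype.sum_prod_type]
      refine Finset.sum_congr rfl fun b _ => Finset.sum_congr rfl fun μ _ => ?_
      change pathWeight κ (algebraMap ℂ K t) p (Fin.snoc (α := fun _ => Fin 2) ν a)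
        (Fin.snoc (α := fun _ => Fin 2) μ b) u v * ∏ i : Fin (n + 1),
          m i (p ^ level (Fin.snoc (α := fun _ => Fin 2) ν a) i * u)
          (p ^ level (Fin.snoc (α := fun _ => Fin 2) μ b) i * v) = _
      rw [pathWeight, pathWeight, Fin.prod_univ_castSucc, Fin.prod_univ_castSucc]
      simp only [Fin.snoc_castSucc, Fin.snoc_last, Fin.val_castSucc, Fin.val_last, level_self,
        level_snoc _ _ le_rfl, pow_zero, one_mul, add_zero]
      have h2 : ∀ (x : Fin n) (ξ : Fin n → Fin 2) (c : Fin 2),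
          level (Fin.snoc (α := fun _ => Fin 2) ξ c) (x.val + 1) = c.val + level ξ (x.val + 1) :=
        fun x ξ c => level_snoc ξ c x.isLt
      have h3 : ∀ (x : Fin n) (ξ : Fin n → Fin 2) (c : Fin 2),
          level (Fin.snoc (α := fun _ => Fin 2) ξ c) x.val = c.val + level ξ x.val :=
        fun x ξ c => level_snoc ξ c x.isLt.le
      simp only [h2, h3]
      have h5 : ∀ (i k : ℕ) (x : Kˣ), p ^ (i + k) * x = p ^ k * (p ^ i * x) := by
        intro i k x; rw [pow_add]; group
      have h6 : ∀ (i k : ℕ) (x : Kˣ), (p ^ (i + k) * x : K) = p ^ k * ((p ^ i * x : Kˣ) : K) := by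
        intro i k x; rw [pow_add]; push_cast; ring
      simp only [h5, h6]
      ring
    change ∑ ν : Fin n → Fin 2, ∑ μ : Fin (n + 1) → Fin 2,
        pathWeight κ (algebraMap ℂ K t) p (Fin.snoc (α := fun _ => Fin 2) ν a) μ u v *
        ∏ i : Fin (n + 1), m i (p ^ level (Fin.snoc (α := fun _ => Fin 2) ν a) i * u)
          (p ^ level μ i * v) = _
    rw [Finset.sum_congr rfl fun ν _ => h1 ν, Finset.sum_comm]
    refine Finset.sum_congr rfl fun b _ => ?_
    simp only [← Finset.mul_sum]
    rw [h]
    · simp only [Pi.mul_apply]; ring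
    · intro c d
      have := huv (c + a) (d + b)
      push_cast
      rwa [pow_add, pow_add, mul_assoc, mul_assoc] at this

end Macdonald
end OspW

namespace OspW

section PowerSums

variable {K : Type} [Field K] [Algebra ℂ K]

/-- The power sum `u_i^r + v_i^r` for the pair of points reached by two paths at node `i`. -/
def pathPowerSum {n : ℕ} (p u v : Kˣ) (i : ℕ) (r : ℤ) :
    (Fin n → Fin 2) × (Fin n → Fin 2) → K :=
  fun ω => ((p ^ level ω.1 i * u : Kˣ) : K) ^ r + ((p ^ level ω.2 i * v : Kˣ) : K) ^ r

/-- The algebra of functions of two paths generated by the power sums. -/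
def powerSumAlgebra (n : ℕ) (p u v : Kˣ) :
    Subalgebra ℂ ((Fin n → Fin 2) × (Fin n → Fin 2) → K) :=
  Algebra.adjoin ℂ {f | ∃ i ≤ n, ∃ r : ℤ, f = pathPowerSum p u v i r}

theorem powerSumAlgebra_le_span (n : ℕ) (p u v : Kˣ) :
    Subalgebra.toSubmodule (powerSumAlgebra n p u v) ≤
      Submodule.span ℂ {f | ∃ m : ℕ → Kˣ → Kˣ → K, (∀ i, m i ∈ SymLaurent K) ∧
        f = fun ω => ∏ i ∈ Finset.range (n + 1),
          m i (p ^ level ω.1 i * u) (p ^ level ω.2 i * v)} := by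
  rw [powerSumAlgebra, Algebra.adjoin_eq_span]
  apply Submodule.span_mono
  intro f hf
  induction hf using Submonoid.closure_induction with
  | one => exact ⟨fun _ => 1, fun _ => SymLaurent.one_mem, by ext; simp⟩
  | mul x y _ _ hx hy =>
    obtain ⟨m, hm, rfl⟩ := hx
    obtain ⟨m', hm', rfl⟩ := hy
    exact ⟨fun i => m i * m' i, fun i => SymLaurent.mul_mem (hm i) (hm' i), by
      ext; simp [Finset.prod_mul_distrib]⟩
  | mem x hx =>
    obtain ⟨i, hi, r, rfl⟩ := hx
    refine ⟨fun j => if j = i then fun a b => (a ^ r * b ^ (0 : ℤ) + a ^ (0 : ℤ) * b ^ r : K)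
      else 1, fun j => ?_, ?_⟩
    · beta_reduce
      split_ifs
      · exact SymLaurent.monomial_mem r 0
      · exact SymLaurent.one_mem
    · ext ω
      rw [Finset.prod_eq_single i]
      · simp [pathPowerSum]
      · intro j _ hj
        simp [hj]
      · intro h
        simp at h
        omega

theorem exists_sum_pathWeight_mul {n : ℕ} {p u v : Kˣ} {q t : ℂ} (hp : (p : K) = algebraMap ℂ K q)
    (huv : ∀ a b : ℕ, (p ^ a * u : K) ≠ p ^ b * v) (κ : ℕ → ℂ)
    {G : (Fin n → Fin 2) × (Fin n → Fin 2) → K} (hG : G ∈ powerSumAlgebra n p u v) :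
    ∃ c : ℤ × ℤ →₀ ℂ,
      ∑ ν, ∑ μ, pathWeight κ (algebraMap ℂ K t) p ν μ u v * G (ν, μ)
        = c.sum fun x y => algebraMap ℂ K y * (u ^ x.1 * v ^ x.2 + u ^ x.2 * v ^ x.1) := by
  suffices h : ∃ s ∈ SymLaurent K,
      ∑ ν, ∑ μ, pathWeight κ (algebraMap ℂ K t) p ν μ u v * G (ν, μ) = s u v by
    obtain ⟨s, hs, h⟩ := h
    obtain ⟨c, hc⟩ := SymLaurent.exists_finsupp hs
    exact ⟨c, h.trans (hc u v)⟩
  have hG' := powerSumAlgebra_le_span n p u v hG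
  clear hG
  induction hG' using Submodule.span_induction with
  | zero => exact ⟨0, zero_mem _, by simp⟩
  | add x y _ _ ihx ihy =>
    obtain ⟨s, hs, h⟩ := ihx
    obtain ⟨s', hs', h'⟩ := ihy
    refine ⟨s + s', add_mem hs hs', ?_⟩
    simp only [Pi.add_apply, mul_add, Finset.sum_add_distrib, h, h']
  | smul c x _ hx =>
    obtain ⟨s, hs, h⟩ := hx
    refine ⟨c • s, Submodule.smul_mem _ _ hs, ?_⟩
    simp only [Pi.smul_apply, mul_smul_comm, ← Finset.smul_sum, h]
  | mem x hx =>
    obtain ⟨m, hm, rfl⟩ := hx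
    obtain ⟨g, hg, h⟩ := exists_sum_pathWeight_mul_prod (t := t) hp κ m hm n
    refine ⟨g * m n, SymLaurent.mul_mem hg (hm n), ?_⟩
    rw [Pi.mul_apply, Pi.mul_apply, ← h u v huv, Finset.sum_mul]
    refine Finset.sum_congr rfl fun ν _ => ?_
    rw [Finset.sum_mul]
    refine Finset.sum_congr rfl fun μ _ => ?_
    beta_reduce
    rw [Finset.prod_range_succ, level_self, level_self, pow_zero, one_mul, one_mul, mul_assoc,
      Finset.prod_range]

end PowerSums
end OspW

namespace OspW

section Matrices

/-- The common shape of the symmetrized deformed Cartan matrix and of its limit. -/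
def forkMatrix (n : ℕ) (σ c f g : ℂ) : Matrix (Fin (n + 1)) (Fin (n + 1)) ℂ :=
  Matrix.of fun i j =>
    if 2 ≤ i.val then
      if 2 ≤ j.val then
        if i = j then σ * c
        else if i.val + 1 = j.val ∨ j.val + 1 = i.val then -σ else 0
      else if i.val = 2 then -σ else 0
    else
      if 2 ≤ j.val then
        if j.val = 2 then -σ else 0
      else if i = j then f else g

/-- Extension of a vector by zero. -/
def extendZero {n : ℕ} (x : Fin (n + 1) → ℂ) (i : ℕ) : ℂ :=
  if hi : i < n + 1 then x ⟨i, hi⟩ else 0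

theorem extendZero_val {n : ℕ} (x : Fin (n + 1) → ℂ) (i : Fin (n + 1)) :
    extendZero x i = x i := by
  rw [extendZero, dif_pos i.isLt]

theorem extendZero_of_lt {n : ℕ} (x : Fin (n + 1) → ℂ) {i : ℕ} (h : n < i) :
    extendZero x i = 0 := by
  rw [extendZero, dif_neg (by omega)]

theorem limitMatrix_eq (n : ℕ) (γ : ℂ) : limitMatrix n γ = forkMatrix n γ 2 1 (2 * γ - 1) := by
  ext i j
  simp only [limitMatrix, forkMatrix, Matrix.of_apply, mul_comm γ 2]

theorem symCartan_eq (n : ℕ) (h γ : ℂ) (r : ℤ) {a b : ℂ} (ha : a = s1 h γ ^ r)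
    (hb : b = s2 h γ ^ r) :
    symCartan n h γ r = forkMatrix n (-(t a * t (a * b)⁻¹)) (b + b⁻¹) (t (a * b)⁻¹ ^ 2)
      (t (a * b)⁻¹ * (b * a⁻¹ - a * b⁻¹)) := by
  ext i j
  rw [symCartan, Matrix.diagonal_mul, ← ha, ← hb]
  simp only [symmetrizer, cartan, forkMatrix, Matrix.of_apply]
  split_ifs <;> ring

theorem forkMatrix_transpose (n : ℕ) (σ c f g : ℂ) :
    (forkMatrix n σ c f g).transpose = forkMatrix n σ c f g := by
  ext i j
  simp only [Matrix.transpose_apply, forkMatrix, Matrix.of_apply, eq_comm (a := j) (b := i),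
    or_comm (a := j.val + 1 = i.val)]
  split_ifs <;> rfl

theorem sum_extendZero_ite {n : ℕ} (x : Fin (n + 1) → ℂ) (a : ℂ) (k : ℕ) :
    ∑ j : Fin (n + 1), (if j.val = k then a else 0) * x j = a * extendZero x k := by
  by_cases hk : k < n + 1
  · rw [Finset.sum_eq_single ⟨k, hk⟩]
    · simp [extendZero, hk]
    · intro j _ hj
      rw [if_neg (fun h => hj (Fin.ext h)), zero_mul]
    · simp
  · rw [extendZero_of_lt x (by omega), mul_zero]
    refine Finset.sum_eq_zero fun j _ => ?_
    rw [if_neg (by omega), zero_mul]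

theorem forkMatrix_mulVec_of_two_le {n : ℕ} (σ c f g : ℂ) (x : Fin (n + 1) → ℂ) (i : Fin (n + 1))
    (hi : 2 ≤ i.val) : (forkMatrix n σ c f g).mulVec x i
      = σ * (c * extendZero x i - extendZero x (i + 1) - extendZero x (i - 1)
        - if i.val = 2 then extendZero x 0 else 0) := by
  have h : ∀ j : Fin (n + 1), forkMatrix n σ c f g i j
      = (if j.val = i.val then σ * c else 0) + (if j.val = i.val + 1 then -σ else 0)
        + (if j.val = i.val - 1 then -σ else 0)
        + (if j.val = 0 then (if i.val = 2 then -σ else 0) else 0) := by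
    intro j
    simp only [forkMatrix, Matrix.of_apply, if_pos hi, Fin.ext_iff]
    split_ifs <;> first | omega | simp
  simp only [Matrix.mulVec, dotProduct, h, add_mul, Finset.sum_add_distrib, sum_extendZero_ite]
  split_ifs <;> ring

theorem forkMatrix_mulVec_of_lt_two {n : ℕ} (σ c f g : ℂ) (x : Fin (n + 1) → ℂ) (i : Fin (n + 1))
    (hi : i.val < 2) : (forkMatrix n σ c f g).mulVec x i
      = f * extendZero x i + g * extendZero x (1 - i) - σ * extendZero x 2 := by
  have h : ∀ j : Fin (n + 1), forkMatrix n σ c f g i j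
      = (if j.val = i.val then f else 0) + (if j.val = 1 - i.val then g else 0)
        + (if j.val = 2 then -σ else 0) := by
    intro j
    simp only [forkMatrix, Matrix.of_apply, if_neg (not_le.mpr hi), Fin.ext_iff]
    split_ifs <;> first | omega | simp
  simp only [Matrix.mulVec, dotProduct, h, add_mul, Finset.sum_add_distrib, sum_extendZero_ite]
  ring

theorem isUnit_det_forkMatrix {n : ℕ} (hn : 1 ≤ n) {σ c f g b : ℂ} (hσ : σ ≠ 0) (hfg : f - g ≠ 0)
    (hb : b ≠ 0) (hc : c = b + b⁻¹) (hsum : f + g = σ * c) (hbn : b ^ n + b⁻¹ ^ n ≠ 0) :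
    IsUnit (forkMatrix n σ c f g).det := by
  rw [isUnit_iff_ne_zero]
  intro hdet
  obtain ⟨x, hx0, hx⟩ := Matrix.exists_mulVec_eq_zero_iff.mpr hdet
  apply hx0
  have e0 := congrFun hx ⟨0, by omega⟩
  have e1 := congrFun hx ⟨1, by omega⟩
  rw [forkMatrix_mulVec_of_lt_two _ _ _ _ _ _ (by simp)] at e0 e1
  simp only [Pi.zero_apply, Nat.sub_zero, Nat.sub_self] at e0 e1
  set X := extendZero x with hX
  have h01 : X 0 = X 1 := by
    have : (f - g) * (X 0 - X 1) = 0 := by linear_combination e0 - e1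
    have := (mul_eq_zero.mp this).resolve_left hfg
    linear_combination this
  have h2 : X 2 = (b + b⁻¹) * X 1 := by
    apply mul_left_cancel₀ hσ
    rw [h01] at e0
    rw [← hc]
    linear_combination X 1 * hsum - e0
  have hrec : ∀ i, 2 ≤ i → i ≤ n → X (i + 1) = (b + b⁻¹) * X i - X (i - 1)
      - if i = 2 then X 0 else 0 := by
    intro i h2 hi
    have ei := congrFun hx ⟨i, by omega⟩
    rw [forkMatrix_mulVec_of_two_le _ _ _ _ _ _ h2, Pi.zero_apply] at ei
    have := (mul_eq_zero.mp ei).resolve_left hσ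
    rw [← hc]
    linear_combination -this
  have hbb : b * b⁻¹ = 1 := mul_inv_cancel₀ hb
  have hsol : ∀ k, k + 1 ≤ n → X (k + 2) = (b ^ (k + 1) + b⁻¹ ^ (k + 1)) * X 1 := by
    intro k
    induction k using Nat.strong_induction_on with
    | _ k ih =>
    match k with
    | 0 => intro _; rw [h2]; ring
    | 1 =>
      intro h
      rw [hrec 2 le_rfl (by omega), if_pos rfl, h01, h2]
      linear_combination 2 * X 1 * hbb
    | k + 2 =>
      intro h
      have h3 := hrec (k + 3) (by omega) (by omega)
      have h4 : k + 3 - 1 = k + 2 := by omega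
      rw [if_neg (by omega), h4] at h3
      have h5 := ih (k + 1) (by omega) (by omega)
      have h6 := ih k (by omega) (by omega)
      change X (k + 3 + 1) = _
      change X (k + 3) = _ at h5
      rw [h3, h5, h6]
      linear_combination (b ^ (k + 1) + b⁻¹ ^ (k + 1)) * X 1 * hbb
  have h1 : X 1 = 0 := by
    have h := hsol (n - 1) (by omega)
    have hn' : n - 1 + 2 = n + 1 := by omega
    have hn'' : n - 1 + 1 = n := by omega
    rw [hn', hn'', hX, extendZero_of_lt x (by omega)] at h
    exact (mul_eq_zero.mp h.symm).resolve_left hbn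
  ext i
  rw [← extendZero_val x, ← hX]
  obtain ⟨i, hi⟩ := i
  match i with
  | 0 => rw [h01, h1]; rfl
  | 1 => rw [h1]; rfl
  | k + 2 =>
    change X (k + 2) = 0
    rw [hsol k (by omega), h1, mul_zero]

/-- Solving `x B = y` for a symmetric invertible `B`. -/
theorem sum_mul_forkMatrix_inv {n : ℕ} {σ c f g : ℂ} (hdet : IsUnit (forkMatrix n σ c f g).det)
    {x y : Fin (n + 1) → ℂ} (hxy : (forkMatrix n σ c f g).mulVec x = y) (k : Fin (n + 1)) :
    ∑ i, y i * (forkMatrix n σ c f g)⁻¹ i k = x k := by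
  have h : Matrix.vecMul y (forkMatrix n σ c f g)⁻¹ = x := by
    rw [← hxy, ← Matrix.vecMul_transpose, forkMatrix_transpose, Matrix.vecMul_vecMul,
      Matrix.mul_nonsing_inv _ hdet, Matrix.vecMul_one]
  exact congrFun h k

end Matrices
end OspW

namespace OspW

section Generic

/-- No monomial in `S`, `Q` is equal to `1`, except the trivial one. -/
structure IsGeneric (S Q : ℂ) : Prop where
  ne_zero_left : S ≠ 0
  ne_zero_right : Q ≠ 0
  eq_zero : ∀ a b : ℤ, S ^ a * Q ^ b = 1 → a = 0 ∧ b = 0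

theorem IsGeneric.zpow {S Q : ℂ} (h : IsGeneric S Q) {r : ℤ} (hr : r ≠ 0) :
    IsGeneric (S ^ r) (Q ^ r) where
  ne_zero_left := zpow_ne_zero _ h.ne_zero_left
  ne_zero_right := zpow_ne_zero _ h.ne_zero_right
  eq_zero a b hab := by
    rw [← zpow_mul, ← zpow_mul] at hab
    have := h.eq_zero _ _ hab
    simpa [hr] using this

theorem IsGeneric.t_left_ne_zero {S Q : ℂ} (h : IsGeneric S Q) : t S ≠ 0 := by
  intro h0
  have h1 : S ^ (2 : ℤ) * Q ^ (0 : ℤ) = 1 := by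
    have := h.ne_zero_left
    rw [t] at h0
    rw [zpow_zero, mul_one, zpow_ofNat]
    field_simp at h0
    linear_combination h0
  have := h.eq_zero _ _ h1
  omega

theorem IsGeneric.t_mul_ne_zero {S Q : ℂ} (h : IsGeneric S Q) : t (S * Q)⁻¹ ≠ 0 := by
  intro h0
  have h1 : S ^ (2 : ℤ) * Q ^ (2 : ℤ) = 1 := by
    have := h.ne_zero_left
    have := h.ne_zero_right
    rw [t] at h0
    rw [zpow_ofNat, zpow_ofNat]
    field_simp at h0
    linear_combination -h0
  have := h.eq_zero _ _ h1
  omega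

theorem IsGeneric.inv_sub_ne_zero {S Q : ℂ} (h : IsGeneric S Q) : 1 - Q ^ 2 ≠ 0 := by
  intro h0
  have h1 : S ^ (0 : ℤ) * Q ^ (2 : ℤ) = 1 := by
    rw [zpow_zero, one_mul, zpow_ofNat]
    linear_combination -h0
  have := h.eq_zero _ _ h1
  omega

theorem IsGeneric.add_inv_ne_zero {S Q : ℂ} (h : IsGeneric S Q) : S ^ 2 + 1 ≠ 0 := by
  intro h0
  have h1 : S ^ (4 : ℤ) * Q ^ (0 : ℤ) = 1 := by
    rw [zpow_zero, mul_one, zpow_ofNat]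
    linear_combination (S ^ 2 - 1) * h0
  have := h.eq_zero _ _ h1
  omega

theorem IsGeneric.pow_add_ne_zero {S Q : ℂ} (h : IsGeneric S Q) {n : ℕ} (hn : 1 ≤ n) :
    Q ^ n + Q⁻¹ ^ n ≠ 0 := by
  intro h0
  have h1 : S ^ (0 : ℤ) * Q ^ ((4 * n : ℕ) : ℤ) = 1 := by
    have hQ := pow_ne_zero n h.ne_zero_right
    rw [zpow_zero, one_mul, zpow_natCast, pow_mul']
    rw [inv_pow] at h0
    have h2 : (Q ^ n) * (Q ^ n)⁻¹ = 1 := mul_inv_cancel₀ hQ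
    have h3 : (Q ^ n) ^ 2 = -1 := by linear_combination (Q ^ n) * h0 - h2
    linear_combination ((Q ^ n) ^ 2 - 1) * h3
  have := h.eq_zero _ _ h1
  omega

theorem IsGeneric.isUnit_det {S Q : ℂ} (h : IsGeneric S Q) {n : ℕ} (hn : 1 ≤ n) :
    IsUnit (forkMatrix n (-(t S * t (S * Q)⁻¹)) (Q + Q⁻¹) (t (S * Q)⁻¹ ^ 2)
      (t (S * Q)⁻¹ * (Q * S⁻¹ - S * Q⁻¹))).det := by
  have hS := h.ne_zero_left
  have hQ := h.ne_zero_right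
  refine isUnit_det_forkMatrix hn (neg_ne_zero.mpr (mul_ne_zero h.t_left_ne_zero h.t_mul_ne_zero))
    ?_ hQ rfl ?_ (h.pow_add_ne_zero hn)
  · have h1 : t (S * Q)⁻¹ ^ 2 - t (S * Q)⁻¹ * (Q * S⁻¹ - S * Q⁻¹)
        = t (S * Q)⁻¹ * ((S ^ 2 + 1) * (1 - Q ^ 2) / (S * Q)) := by
      rw [t]; field_simp; ring
    rw [h1]
    exact mul_ne_zero h.t_mul_ne_zero (div_ne_zero (mul_ne_zero h.add_inv_ne_zero
      h.inv_sub_ne_zero) (mul_ne_zero hS hQ))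
  · rw [t, t]; field_simp; ring

end Generic

section Levels

variable {n : ℕ} (ν : Fin n → Fin 2)

theorem nu_succ (i : Fin n) : nu ν (i + 1) = (ν i).val := by
  rw [nu, dif_pos ⟨by omega, by omega⟩]
  rfl

theorem nu_of_lt {i : ℕ} (h : n < i) : nu ν i = 0 := by
  rw [nu, dif_neg (by omega)]

theorem nu_eq_zero_or_one (i : ℕ) : nu ν i = 0 ∨ nu ν i = 1 := by
  rw [nu]
  split_ifs with h
  · have := (ν ⟨i - 1, by omega⟩).isLt
    omega
  · exact Or.inl rfl

theorem level_of_le {i : ℕ} (h : n ≤ i) : level ν i = 0 := by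
  refine Finset.sum_eq_zero fun j _ => ?_
  rw [if_neg (by omega)]

theorem level_eq_add (i : ℕ) : (level ν i : ℤ) = nu ν (i + 1) + level ν (i + 1) := by
  by_cases hi : i < n
  · have h : ∀ j : Fin n, (if i ≤ j.val then (ν j).val else 0)
        = (if j = ⟨i, hi⟩ then (ν j).val else 0) + if i + 1 ≤ j.val then (ν j).val else 0 := by
      intro j
      simp only [Fin.ext_iff]
      split_ifs <;> first | rfl | omega
    rw [level, Finset.sum_congr rfl fun j _ => h j, Finset.sum_add_distrib, ← level]
    rw [Finset.sum_ite_eq' Finset.univ (⟨i, hi⟩ : Fin n) fun j => (ν j).val]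
    have := nu_succ ν ⟨i, hi⟩
    simp only at this
    rw [this]
    simp
  · rw [level_of_le ν (by omega), level_of_le ν (by omega), nu_of_lt ν (by omega)]
    simp

theorem sum_Icc_nu (i : ℕ) : ∑ j ∈ Finset.Icc (i + 1) n, nu ν j = level ν i := by
  by_cases hi : i ≤ n
  · induction hi using Nat.decreasingInduction with
    | self => rw [level_self]; simp
    | of_succ k hk ih =>
      rw [level_eq_add, ← ih, ← Finset.sum_insert (by simp)]
      congr 1
      ext j
      simp only [Finset.mem_Icc, Finset.mem_insert]
      omega
  · rw [level_of_le ν (by omega), Finset.Icc_eq_empty (by omega)]; simp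

end Levels

section VertexFunctionals

variable {J : Type}

theorem Vertex.map_prod {A ι : Type} [AddCommMonoid A] (φ : Vertex J → A) (h1 : φ 1 = 0)
    (hmul : ∀ V W, φ (V * W) = φ V + φ W) (s : Finset ι) (f : ι → Vertex J) :
    φ (∏ i ∈ s, f i) = ∑ i ∈ s, φ (f i) := by
  classical
  induction s using Finset.induction_on with
  | empty => simpa using h1
  | insert a s ha ih => rw [Finset.prod_insert ha, Finset.sum_insert ha, hmul, ih]

end VertexFunctionals
end OspW

namespace OspW

section Modes

variable {n : ℕ} {h γ : ℂ}

theorem node_val (hn : 1 ≤ n) (e : Bool) : (node n e).val = if e then 0 else 1 := by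
  cases e
  · simp only [node, Bool.false_eq_true, if_false, Fin.val_one']
    exact Nat.mod_eq_of_lt (by omega)
  · simp [node]

theorem node_not_val (hn : 1 ≤ n) (e : Bool) : (node n (!e)).val = 1 - (node n e).val := by
  rw [node_val hn, node_val hn]; cases e <;> rfl

theorem node_val_lt (hn : 1 ≤ n) (e : Bool) : (node n e).val < 2 := by
  rw [node_val hn]; split_ifs <;> omega

theorem exp_logMon (r a b : ℤ) : Complex.exp (-(r : ℂ) * logMon h γ a b)
    = (s2 h γ ^ r) ^ (-a) * (s1 h γ ^ r) ^ (-b) := by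
  rw [s1, s2, ← zpow_mul, ← zpow_mul, ← Complex.exp_int_mul, ← Complex.exp_int_mul,
    ← Complex.exp_add, logMon]
  congr 1
  push_cast
  ring

theorem s3_zpow (r : ℤ) : s3 h ^ r = (s1 h γ ^ r * s2 h γ ^ r)⁻¹ := by
  rw [s1, s2, s3, ← Complex.exp_int_mul, ← Complex.exp_int_mul, ← Complex.exp_int_mul,
    ← Complex.exp_add, ← Complex.exp_neg]
  congr 1
  ring

theorem Vertex.zpow_mode {J : Type} (V : Vertex J) (m : ℤ) (r : ℤ) (j : J) :
    (V ^ m).mode r j = m * V.mode r j := by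
  change (m • V.mode) r j = _
  simp

theorem Y_mode_of_two_le (i : Fin (n + 1)) (hi : 2 ≤ i.val) (r : ℤ) (j : Boson n) :
    (Y n h γ i).mode r j = ((s1 h γ ^ r)⁻¹ - s1 h γ ^ r) * (X n h γ i).mode r j := by
  rw [Y, if_pos hi]
  change (Complex.exp _ • (X n h γ i).mode r) j - (Complex.exp _ • (X n h γ i).mode r) j = _
  rw [exp_logMon, exp_logMon]
  simp
  ring

theorem Y_mode_of_lt_two (i : Fin (n + 1)) (hi : i.val < 2) (r : ℤ) (j : Boson n) :
    (Y n h γ i).mode r j = -(X n h γ i).mode r j := by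
  rw [Y, if_neg (by omega)]
  rfl

theorem shift_mode (a b : ℤ) (V : Vertex (Boson n)) (r : ℤ) (j : Boson n) :
    (V.shift (logMon h γ a b)).mode r j
      = (s2 h γ ^ r) ^ (-a) * (s1 h γ ^ r) ^ (-b) * V.mode r j := by
  rw [← exp_logMon]; rfl

/-- The exponents of the bosonic `X_i` in `ξ̃_ν`, at `S = s₁^r`, `Q = s₂^r`. -/
noncomputable def bosonicExponent (S Q : ℂ) (ν : Fin n → Fin 2) (i : ℕ) : ℂ :=
  ((nu ν (i - 1) - nu ν i : ℤ) : ℂ) *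
    (Q ^ (-((i : ℤ) + 2 * level ν i + nu ν i - nu ν (i - 1))) * S⁻¹ * (S⁻¹ - S))

/-- The exponents of the `X_i` in `ξ̃_ν / ξ̃_0`, at `S = s₁^r`, `Q = s₂^r`. -/
noncomputable def exponent (e : Bool) (S Q : ℂ) (ν : Fin n → Fin 2) (i : Fin (n + 1)) : ℂ :=
  if 2 ≤ i.val then bosonicExponent S Q ν i
  else if i = node n e then 1 - Q ^ (-2 * (level ν 0 : ℤ)) * S ^ (-2 * nu ν 1)
  else -S ^ (-2 : ℤ) + Q ^ (-2 * (level ν 0 : ℤ)) * S ^ (2 * nu ν 1 - 2)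

theorem sum_exponent (hn : 1 ≤ n) (e : Bool) (S Q : ℂ) (ν : Fin n → Fin 2)
    (x : Fin (n + 1) → ℂ) :
    ∑ i, exponent e S Q ν i * x i = (∑ i : Fin (n + 1), if 2 ≤ i.val then
        bosonicExponent S Q ν i * x i else 0)
      + (1 - Q ^ (-2 * (level ν 0 : ℤ)) * S ^ (-2 * nu ν 1)) * x (node n e)
      + (-S ^ (-2 : ℤ) + Q ^ (-2 * (level ν 0 : ℤ)) * S ^ (2 * nu ν 1 - 2)) * x (node n (!e)) := by
  have h1 := node_val_lt hn e
  have h2 := node_not_val hn e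
  have h3 : ∀ i : Fin (n + 1), exponent e S Q ν i * x i
      = ((if 2 ≤ i.val then bosonicExponent S Q ν i * x i else 0)
        + if i = node n e then
          (1 - Q ^ (-2 * (level ν 0 : ℤ)) * S ^ (-2 * nu ν 1)) * x i else 0)
        + if i = node n (!e) then
          (-S ^ (-2 : ℤ) + Q ^ (-2 * (level ν 0 : ℤ)) * S ^ (2 * nu ν 1 - 2)) * x i else 0 := by
    intro i
    simp only [exponent, Fin.ext_iff]
    split_ifs <;> first | omega | ring
  rw [Finset.sum_congr rfl fun i _ => h3 i, Finset.sum_add_distrib, Finset.sum_add_distrib,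
    Finset.sum_ite_eq', Finset.sum_ite_eq', if_pos (Finset.mem_univ _),
    if_pos (Finset.mem_univ _)]

theorem mode_eq_add_sum_exponent (hn : 1 ≤ n) (e : Bool) (ν : Fin n → Fin 2) (r : ℤ)
    (j : Boson n) :
    (LamPrime n h γ e * xiTerm n h γ e ν).mode r j = (Pi.single (Sum.inr e) 1 : Boson n → ℂ) j
      + ∑ i, exponent e (s1 h γ ^ r) (s2 h γ ^ r) ν i * (X n h γ i).mode r j := by
  have hS : s1 h γ ^ r ≠ 0 := zpow_ne_zero _ (Complex.exp_ne_zero _)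
  have hmul : ∀ V W : Vertex (Boson n), (V * W).mode r j = V.mode r j + W.mode r j :=
    fun _ _ => rfl
  have hinv : ∀ V : Vertex (Boson n), V⁻¹.mode r j = -V.mode r j := fun _ => rfl
  have hite : ∀ i : Fin (n + 1), (if 2 ≤ i.val then
      (Vertex.shift
        (logMon h γ (i.val + 2 * (∑ j ∈ Finset.Icc (i.val + 1) n, nu ν j)
          + nu ν i.val - nu ν (i.val - 1)) 1)
        (Y n h γ i)) ^ (-nu ν i.val + nu ν (i.val - 1))
      else 1).mode r j = if 2 ≤ i.val then
        bosonicExponent (s1 h γ ^ r) (s2 h γ ^ r) ν i * (X n h γ i).mode r j else 0 := by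
    intro i
    split_ifs with hi
    · rw [Vertex.zpow_mode, shift_mode, Y_mode_of_two_le i hi, bosonicExponent, sum_Icc_nu]
      push_cast
      rw [zpow_neg (s1 h γ ^ r), zpow_one]
      ring
    · rfl
  rw [sum_exponent hn, LamPrime, xiTerm]
  simp only [hmul, hinv, shift_mode]
  rw [Vertex.map_prod (fun V => V.mode r j) rfl hmul, Finset.sum_congr rfl fun i _ => hite i,
    Y_mode_of_lt_two _ (node_val_lt hn e), Y_mode_of_lt_two _ (node_val_lt hn (!e))]
  have hL : (Lam n h γ e).mode r j = (Pi.single (Sum.inr e) 1 : Boson n → ℂ) j := rfl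
  have h1 := sum_Icc_nu ν 0
  rw [zero_add] at h1
  rw [hL, h1]
  have e1 : -(2 * (level ν 0 : ℤ)) = -2 * level ν 0 := by ring
  have e2 : -(2 * nu ν 1) = -2 * nu ν 1 := by ring
  have e3 : -(2 - 2 * nu ν 1) = 2 * nu ν 1 - 2 := by ring
  rw [e1, e2, e3, neg_zero, zpow_zero]
  ring

/-- The exponent of `s_i` in `Λ'(z) ξ̃_ν(z)`; the exponent of `s_1` for `i = 1` and the one of
`s_i` for `i ≥ 2`. -/
noncomputable def screeningExponent (S Q : ℂ) (ν : Fin n → Fin 2) (i : ℕ) : ℂ :=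
  -t (S * Q)⁻¹ * Q ^ (-(i : ℤ)) * S⁻¹ * (1 - Q ^ (-2 * (level ν (i - 1) : ℤ))) / (1 - Q ^ (-2 : ℤ))

/-- The vector of the exponents of the `s_i` in `Λ'(z) ξ̃_ν(z)`. -/
noncomputable def screeningVector (e : Bool) (S Q : ℂ) (ν : Fin n → Fin 2) (i : Fin (n + 1)) : ℂ :=
  if 2 ≤ i.val then screeningExponent S Q ν i
  else if i = node n e then screeningExponent S Q ν 1 else 0

theorem extendZero_screeningVector (e : Bool) (S Q : ℂ) (ν : Fin n → Fin 2) {i : ℕ} (hi : 2 ≤ i) :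
    extendZero (screeningVector e S Q ν) i = screeningExponent S Q ν i := by
  rw [extendZero]
  split_ifs with h
  · rw [screeningVector, if_pos hi]
  · rw [screeningExponent, level_of_le ν (by omega)]; simp

theorem extendZero_screeningVector_node (hn : 1 ≤ n) (e : Bool) (S Q : ℂ) (ν : Fin n → Fin 2) :
    extendZero (screeningVector e S Q ν) (node n e) = screeningExponent S Q ν 1 := by
  have h1 := node_val_lt hn e
  rw [extendZero_val, screeningVector, if_neg (by omega), if_pos rfl]

theorem extendZero_screeningVector_node_not (hn : 1 ≤ n) (e : Bool) (S Q : ℂ)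
    (ν : Fin n → Fin 2) :
    extendZero (screeningVector e S Q ν) (1 - node n e) = 0 := by
  have h1 := node_val_lt hn e
  have h2 := node_not_val hn e
  rw [← h2, extendZero_val, screeningVector, if_neg (by omega), if_neg]
  rw [Fin.ext_iff]
  omega

theorem forkMatrix_mulVec_screeningVector (hn : 1 ≤ n) (e : Bool) {S Q : ℂ} (hSQ : IsGeneric S Q)
    (ν : Fin n → Fin 2) (i : Fin (n + 1)) :
    (forkMatrix n (-(t S * t (S * Q)⁻¹)) (Q + Q⁻¹) (t (S * Q)⁻¹ ^ 2)
      (t (S * Q)⁻¹ * (Q * S⁻¹ - S * Q⁻¹))).mulVec (screeningVector e S Q ν) i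
      = exponent e S Q ν i * t (S * Q)⁻¹ ^ 2 := by
  have hS := hSQ.ne_zero_left
  have hQ := hSQ.ne_zero_right
  have hQ2 := hSQ.inv_sub_ne_zero
  have hQ2' : Q ^ 2 - 1 ≠ 0 := by
    intro h; apply hQ2; linear_combination -h
  have hlt := node_val_lt hn e
  have hnot := node_not_val hn e
  have hval := node_val hn e
  by_cases hi : 2 ≤ i.val
  · rw [forkMatrix_mulVec_of_two_le _ _ _ _ _ _ hi, extendZero_screeningVector _ _ _ _ hi,
      extendZero_screeningVector _ _ _ _ (by omega), exponent, if_pos hi, bosonicExponent]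
    have h1 : extendZero (screeningVector e S Q ν) (i - 1)
        + (if i.val = 2 then extendZero (screeningVector e S Q ν) 0 else 0)
        = screeningExponent S Q ν (i - 1) := by
      have h2 := extendZero_screeningVector_node hn e S Q ν
      have h3 := extendZero_screeningVector_node_not hn e S Q ν
      split_ifs with h
      · rw [h]
        cases e
        · rw [hval] at h2 h3
          simp only [Bool.false_eq_true, if_false, Nat.sub_self] at h2 h3
          rw [h2, h3, add_zero]
        · rw [hval] at h2 h3
          simp only [if_true, Nat.sub_zero] at h2 h3
          rw [h2, h3, zero_add]
      · rw [add_zero, extendZero_screeningVector _ _ _ _ (by omega)]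
    rw [sub_sub _ (extendZero _ (i.val - 1)), h1]
    obtain ⟨i, hi'⟩ := i
    obtain ⟨k, rfl⟩ : ∃ k, i = k + 2 := ⟨i - 2, by simp only at hi; omega⟩
    simp only [screeningExponent]
    have a1 : k + 2 - 1 = k + 1 := by omega
    have a2 : k + 2 + 1 - 1 = k + 2 := by omega
    have a3 : k + 2 - 1 - 1 = k := by omega
    rw [a1, a2]
    have b0 := level_eq_add ν k
    have b1 := level_eq_add ν (k + 1)
    simp only [Nat.add_sub_cancel]
    rw [b0, b1]
    push_cast
    rcases nu_eq_zero_or_one ν (k + 1) with c1 | c1 <;>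
    rcases nu_eq_zero_or_one ν (k + 1 + 1) with c2 | c2 <;>
    · rw [c1, show k + 2 = k + 1 + 1 from rfl, c2]
      generalize (level ν (k + 1 + 1) : ℤ) = l
      have e1 : ∀ x : ℤ, Q ^ (-2 * (x + l)) = Q ^ (-2 * l) * Q ^ (-2 * x) := by
        intro x; rw [← zpow_add₀ hQ]; congr 1; ring
      have e2 : ∀ x y : ℤ, Q ^ (-2 * (x + (y + l))) = Q ^ (-2 * l) * Q ^ (-2 * (x + y)) := by
        intro x y; rw [← zpow_add₀ hQ]; congr 1; ring
      have e3 : ∀ x : ℤ, Q ^ (-((k : ℤ) + x)) = Q ^ (-k : ℤ) * Q ^ (-x) := by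
        intro x; rw [← zpow_add₀ hQ]; congr 1; ring
      have e4 : ∀ x y : ℤ, Q ^ (-((k : ℤ) + 2 + 2 * l + x - y))
          = Q ^ (-k : ℤ) * Q ^ (-2 * l) * Q ^ (y - 2 - x) := by
        intro x y; rw [← zpow_add₀ hQ, ← zpow_add₀ hQ]; congr 1; ring
      rw [e1, e2, e4, e3, add_assoc (k : ℤ) 2 1, e3, e3]
      generalize Q ^ (-k : ℤ) = u
      generalize Q ^ (-2 * l) = L
      simp only [t]
      norm_num [zpow_neg, zpow_ofNat, -mul_eq_zero]
      field_simp
      ring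
  · have hi' : i.val < 2 := by omega
    rw [forkMatrix_mulVec_of_lt_two _ _ _ _ _ _ hi', extendZero_screeningVector _ _ _ _ le_rfl,
      exponent, if_neg hi]
    have b0 := level_eq_add ν 0
    simp only [screeningExponent]
    split_ifs with he
    · rw [he, extendZero_screeningVector_node hn, extendZero_screeningVector_node_not hn]
      simp only [screeningExponent, Nat.sub_self, Nat.reduceSub]
      rw [b0, zero_add]
      rcases nu_eq_zero_or_one ν 1 with c1 | c1 <;>
      · rw [c1]
        generalize (level ν 1 : ℤ) = l
        have e1 : ∀ x : ℤ, Q ^ (-2 * (x + l)) = Q ^ (-2 * l) * Q ^ (-2 * x) := by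
          intro x; rw [← zpow_add₀ hQ]; congr 1; ring
        rw [e1]
        generalize Q ^ (-2 * l) = L
        simp only [t]
        norm_num [zpow_neg, zpow_ofNat, -mul_eq_zero]
        field_simp
        ring
    · have hi2 : i.val = 1 - node n e := by
        rw [Fin.ext_iff] at he; omega
      have hi3 : 1 - i.val = node n e := by omega
      rw [hi3, hi2, extendZero_screeningVector_node hn, extendZero_screeningVector_node_not hn]
      simp only [screeningExponent, Nat.sub_self, Nat.reduceSub]
      rw [b0, zero_add]
      rcases nu_eq_zero_or_one ν 1 with c1 | c1 <;>
      · rw [c1]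
        generalize (level ν 1 : ℤ) = l
        have e1 : ∀ x : ℤ, Q ^ (-2 * (x + l)) = Q ^ (-2 * l) * Q ^ (-2 * x) := by
          intro x; rw [← zpow_add₀ hQ]; congr 1; ring
        rw [e1]
        generalize Q ^ (-2 * l) = L
        simp only [t]
        norm_num [zpow_neg, zpow_ofNat, -mul_eq_zero]
        field_simp
        ring

end Modes
end OspW

namespace OspW

section ContractionExponents

variable {n : ℕ}

/-- The contribution of one node to the exponents of the contraction. -/
noncomputable def stepExponent (S Q : ℂ) (ν μ : Fin n → Fin 2) (j : ℕ) : ℂ :=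
  Q ^ (2 * ((level μ (j + 1) : ℤ) - level ν (j + 1))) *
    ((nu ν (j + 1) : ℂ) * (1 - nu μ (j + 1)) * (1 - (S * Q) ^ (-2 : ℤ))
      + (nu μ (j + 1) : ℂ) * (1 - nu ν (j + 1)) * (1 - (S * Q) ^ (2 : ℤ)))

/-- The potential whose differences give `stepExponent`. -/
noncomputable def stepPotential (S Q : ℂ) (ν μ : Fin n → Fin 2) (j : ℕ) : ℂ :=
  Q ^ (-2 * (level ν j : ℤ)) * S ^ (-2 * nu ν (j + 1)) *
      (-t (S⁻¹ * Q⁻¹)⁻¹ * Q * S * (1 - Q ^ (2 * (level μ j : ℤ))) / (1 - Q ^ (2 : ℤ)))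
    + -t (S * Q)⁻¹ * Q⁻¹ * S⁻¹ * (1 - Q ^ (-2 * (level ν j : ℤ))) / (1 - Q ^ (-2 : ℤ))

theorem stepPotential_sub {S Q : ℂ} (hSQ : IsGeneric S Q) (ν μ : Fin n → Fin 2) (j : ℕ) :
    stepPotential S Q ν μ j - stepPotential S Q ν μ (j + 1)
      - bosonicExponent S Q ν (j + 2) * screeningExponent S⁻¹ Q⁻¹ μ (j + 2)
      = stepExponent S Q ν μ j := by
  have hS := hSQ.ne_zero_left
  have hQ := hSQ.ne_zero_right
  have hQ2 := hSQ.inv_sub_ne_zero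
  have hQ2' : Q ^ 2 - 1 ≠ 0 := by
    intro h; apply hQ2; linear_combination -h
  have a1 : j + 2 - 1 = j + 1 := by omega
  simp only [stepPotential, stepExponent, bosonicExponent, screeningExponent, a1]
  have b0 := level_eq_add ν j
  have b1 := level_eq_add ν (j + 1)
  have b2 := level_eq_add μ j
  have b1' : (level ν (j + 2) : ℤ) = level ν (j + 1) - nu ν (j + 1 + 1) := by
    rw [b1]; ring
  rw [b0, b1', b2]
  push_cast
  generalize (level ν (j + 1) : ℤ) = l
  generalize (level μ (j + 1) : ℤ) = l'
  have e1 : ∀ x : ℤ, Q ^ (-2 * (x + l)) = Q ^ (-2 * l) * Q ^ (-2 * x) := by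
    intro x; rw [← zpow_add₀ hQ]; congr 1; ring
  have e2 : ∀ x : ℤ, Q ^ (2 * (x + l')) = Q ^ (2 * l') * Q ^ (2 * x) := by
    intro x; rw [← zpow_add₀ hQ]; congr 1; ring
  have e3 : Q ^ (2 * (l' - l)) = Q ^ (2 * l') * Q ^ (-2 * l) := by
    rw [← zpow_add₀ hQ]; congr 1; ring
  have e4 : ∀ x y : ℤ, Q ^ (-((j : ℤ) + 2 + 2 * (l - x) + x - y))
      = Q ^ (-j : ℤ) * Q ^ (-2 * l) * Q ^ (y + x - 2) := by
    intro x y; rw [← zpow_add₀ hQ, ← zpow_add₀ hQ]; congr 1; ring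
  have e5 : Q⁻¹ ^ (-((j : ℤ) + 2)) = (Q ^ (-j : ℤ))⁻¹ * Q ^ (2 : ℤ) := by
    rw [inv_zpow', ← zpow_neg, ← zpow_add₀ hQ]; congr 1; ring
  have e6 : ∀ x : ℤ, Q⁻¹ ^ (-2 * x) = Q ^ (2 * x) := by
    intro x; rw [inv_zpow']; congr 1; ring
  have e7 : Q⁻¹ ^ (-2 : ℤ) = Q ^ (2 : ℤ) := by rw [inv_zpow']; norm_num
  have hu : Q ^ (-j : ℤ) ≠ 0 := zpow_ne_zero _ hQ
  rw [e1, e2, e3, e4, e5, e6, e7]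
  generalize Q ^ (-j : ℤ) = u at hu ⊢
  generalize Q ^ (-2 * l) = L
  generalize Q ^ (2 * l') = L'
  have a2 : j + 1 + 1 = j + 2 := rfl
  rw [a2]
  rcases nu_eq_zero_or_one ν (j + 1) with c1 | c1 <;>
  rcases nu_eq_zero_or_one ν (j + 2) with c2 | c2 <;>
  rcases nu_eq_zero_or_one μ (j + 1) with c3 | c3 <;>
  · rw [c1, c2, c3]
    simp only [t]
    norm_num [zpow_neg, zpow_ofNat, -mul_eq_zero] <;> field_simp <;> ring

theorem stepPotential_self (S Q : ℂ) (ν μ : Fin n → Fin 2) : stepPotential S Q ν μ n = 0 := by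
  simp [stepPotential, level_self]

theorem sum_bosonicExponent (hn : 1 ≤ n) (S Q : ℂ) (ν μ : Fin n → Fin 2) :
    (∑ i : Fin (n + 1), if 2 ≤ i.val then
      bosonicExponent S Q ν i * screeningExponent S⁻¹ Q⁻¹ μ i else 0)
      = ∑ j ∈ Finset.range n,
        bosonicExponent S Q ν (j + 2) * screeningExponent S⁻¹ Q⁻¹ μ (j + 2) := by
  rw [Fin.sum_univ_eq_sum_range (fun i => if 2 ≤ i then
      bosonicExponent S Q ν i * screeningExponent S⁻¹ Q⁻¹ μ i else 0)]
  obtain ⟨m, rfl⟩ : ∃ m, n = m + 1 := ⟨n - 1, by omega⟩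
  have h : screeningExponent S⁻¹ Q⁻¹ μ (m + 2) = 0 := by
    rw [screeningExponent, level_of_le μ (by omega)]; simp
  rw [Finset.sum_range_succ', Finset.sum_range_succ', Finset.sum_range_succ, h]
  simp

theorem sum_stepExponent (hn : 1 ≤ n) {S Q : ℂ} (hSQ : IsGeneric S Q) (e : Bool)
    (ν μ : Fin n → Fin 2) :
    screeningExponent S Q ν 1 + screeningExponent S⁻¹ Q⁻¹ μ 1
      - ∑ i, exponent e S Q ν i * screeningVector e S⁻¹ Q⁻¹ μ i
      = ∑ j ∈ Finset.range n, stepExponent S Q ν μ j := by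
  have hlt := node_val_lt hn e
  have hnot := node_not_val hn e
  have h1 := extendZero_screeningVector_node hn e S⁻¹ Q⁻¹ μ
  have h2 := extendZero_screeningVector_node_not hn e S⁻¹ Q⁻¹ μ
  rw [extendZero_val] at h1
  rw [← hnot, extendZero_val] at h2
  have h3 : ∀ i : Fin (n + 1), (if 2 ≤ i.val then
      bosonicExponent S Q ν i * screeningVector e S⁻¹ Q⁻¹ μ i else 0) = if 2 ≤ i.val then
      bosonicExponent S Q ν i * screeningExponent S⁻¹ Q⁻¹ μ i else 0 := by
    intro i
    split_ifs with hi
    · rw [screeningVector, if_pos hi]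
    · rfl
  rw [sum_exponent hn, h1, h2, Finset.sum_congr rfl fun i _ => h3 i, sum_bosonicExponent hn,
    ← Finset.sum_congr rfl fun j _ => stepPotential_sub hSQ ν μ j, Finset.sum_sub_distrib,
    Finset.sum_range_sub', stepPotential_self]
  simp only [stepPotential, screeningExponent, Nat.sub_self, zero_add, Nat.cast_one, zpow_neg_one,
    inv_inv]
  have e6 : ∀ x : ℤ, Q⁻¹ ^ (-2 * x) = Q ^ (2 * x) := by
    intro x; rw [inv_zpow']; congr 1; ring
  have e7 : Q⁻¹ ^ (-2 : ℤ) = Q ^ (2 : ℤ) := by rw [inv_zpow']; norm_num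
  rw [e6, e7]
  ring

variable {h γ : ℂ}

theorem mode_inl (hn : 1 ≤ n) (hgen : IsGeneric (s1 h γ) (s2 h γ)) (e : Bool) (ν : Fin n → Fin 2)
    {r : ℤ} (hr : r ≠ 0) (k : Fin (n + 1)) :
    (LamPrime n h γ e * xiTerm n h γ e ν).mode r (Sum.inl k)
      = screeningVector e (s1 h γ ^ r) (s2 h γ ^ r) ν k := by
  have hg := hgen.zpow hr
  have h1 := sum_mul_forkMatrix_inv (hg.isUnit_det hn)
    (funext fun i => forkMatrix_mulVec_screeningVector hn e hg ν i) k
  rw [mode_eq_add_sum_exponent hn, ← h1, ← symCartan_eq n h γ r rfl rfl, ← s3_zpow]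
  simp only [reduceCtorEq, ne_eq, not_false_eq_true, Pi.single_eq_of_ne, zero_add, X,
    Sum.elim_inl]
  refine Finset.sum_congr rfl fun i _ => ?_
  ring

theorem mode_inr (hn : 1 ≤ n) (e : Bool) (ν : Fin n → Fin 2) (r : ℤ) (b : Bool) :
    (LamPrime n h γ e * xiTerm n h γ e ν).mode r (Sum.inr b) = if b = e then 1 else 0 := by
  rw [mode_eq_add_sum_exponent hn]
  simp [X, Pi.single_apply]

/-- The position of the pole of `:Λ(z) Λ(w):`. -/
noncomputable def polePosition (h : ℂ) (e : Bool) : ℂ := if e then (s3 h ^ 2)⁻¹ else s3 h ^ 2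

theorem sum_annihilationMode_mul_creationMode (hn : 1 ≤ n) (hgen : IsGeneric (s1 h γ) (s2 h γ))
    (e : Bool) (ν μ : Fin n → Fin 2) (k : ℕ) :
    ((k : ℂ) + 1) * ∑ j, (LamPrime n h γ e * xiTerm n h γ e ν).annihilationMode
        (heisenberg n h γ) (j, k) * (LamPrime n h γ e * xiTerm n h γ e μ).creationMode (j, k)
      = (polePosition h e ^ (k + 1) - 1)
        + ∑ j ∈ Finset.range n, stepExponent (s1 h γ ^ (k + 1)) (s2 h γ ^ (k + 1)) ν μ j := by
  have hr : ((k : ℤ) + 1) ≠ 0 := by omega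
  have hg := hgen.zpow hr
  have hk : (k : ℂ) + 1 ≠ 0 := by exact_mod_cast Nat.succ_ne_zero k
  have hcast : ∀ x : ℂ, x ^ ((k : ℤ) + 1) = x ^ (k + 1) := fun x => by
    rw [← zpow_natCast]; norm_cast
  have hneg : ∀ x : ℂ, x ^ (-((k : ℤ) + 1)) = (x ^ (k + 1))⁻¹ := fun x => by
    rw [zpow_neg, hcast]
  rw [hcast, hcast] at hg
  have hsum := sum_stepExponent hn hg e ν μ
  have ht := hg.t_mul_ne_zero
  have hll : ∀ i j, (heisenberg n h γ).osc (k + 1) (Sum.inl i) (Sum.inl j)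
      = -(1 / ((k : ℂ) + 1)) * ((t (s3 h ^ (k + 1))) ^ 2)⁻¹ * symCartan n h γ ((k : ℤ) + 1) i j := by
    intro i j
    rw [← Nat.cast_add_one, ← Nat.cast_add_one]
    rfl
  have hlr : ∀ i, (heisenberg n h γ).osc (k + 1) (Sum.inl i) (Sum.inr e)
      = if i = node n e then 1 / ((k : ℂ) + 1)
        else if i = node n (!e) then -(s1 h γ ^ (2 * (k + 1))) / ((k : ℂ) + 1) else 0 := by
    intro i
    rw [← Nat.cast_add_one]
    rfl
  have hrl : ∀ i, (heisenberg n h γ).osc (k + 1) (Sum.inr e) (Sum.inl i)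
      = if i = node n e then 1 / ((k : ℂ) + 1)
        else if i = node n (!e) then -((s1 h γ ^ (2 * (k + 1)))⁻¹) / ((k : ℂ) + 1) else 0 := by
    intro i
    rw [← Nat.cast_add_one]
    rfl
  have hrr : (heisenberg n h γ).osc (k + 1) (Sum.inr e) (Sum.inr e)
      = (polePosition h e ^ (k + 1) - 1) / ((k : ℂ) + 1) := by
    rw [← Nat.cast_add_one]
    cases e
    · change (s3 h ^ (2 * (k + 1)) - 1) / _ = _
      simp [polePosition, pow_mul]
    · change ((s3 h ^ (2 * (k + 1)))⁻¹ - 1) / _ = _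
      simp [polePosition, pow_mul]
  have hlt := node_val_lt hn e
  have hnot := node_not_val hn e
  have hpair : ∀ (S Q : ℂ) (ξ : Fin n → Fin 2) (c : ℂ) (F : Fin (n + 1) → ℂ),
      (∀ i, F i = if i = node n e then 1 / ((k : ℂ) + 1) else if i = node n (!e) then c else 0) →
      ∑ i, F i * screeningVector e S Q ξ i = screeningExponent S Q ξ 1 / ((k : ℂ) + 1) := by
    intro S Q ξ c F hF
    rw [Finset.sum_eq_single (node n e)]
    · rw [hF, if_pos rfl, screeningVector, if_neg (by omega), if_pos rfl]
      ring
    · intro i _ hi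
      rw [hF, if_neg hi, screeningVector]
      split_ifs with h1 h2 h2
      · rw [Fin.ext_iff] at h1; omega
      · simp
      · simp
      · simp
    · simp
  set S := s1 h γ ^ (k + 1) with hS
  set Q := s2 h γ ^ (k + 1) with hQ
  have hV : ∀ i, (LamPrime n h γ e * xiTerm n h γ e ν).mode ((k : ℤ) + 1) (Sum.inl i)
      = screeningVector e S Q ν i := by
    intro i; rw [mode_inl hn hgen e ν hr, hcast, hcast]
  have hW : ∀ i, (LamPrime n h γ e * xiTerm n h γ e μ).mode (-((k : ℤ) + 1)) (Sum.inl i)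
      = screeningVector e S⁻¹ Q⁻¹ μ i := by
    intro i; rw [mode_inl hn hgen e μ (by omega), hneg, hneg]
  have hBa : ∀ j, ∑ i, screeningVector e S Q ν i *
      (heisenberg n h γ).osc (k + 1) (Sum.inl i) (Sum.inl j)
      = -(1 / ((k : ℂ) + 1)) * exponent e S Q ν j := by
    intro j
    have h1 := forkMatrix_mulVec_screeningVector hn e hg ν j
    rw [← forkMatrix_transpose, Matrix.mulVec_transpose] at h1
    have h2 : s3 h ^ (k + 1) = (S * Q)⁻¹ := by
      rw [← hcast, s3_zpow (γ := γ), hcast, hcast]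
    simp only [hll, h2, symCartan_eq n h γ _ (hcast _).symm (hcast _).symm]
    rw [← hS, ← hQ]
    have h3 : ∑ i, screeningVector e S Q ν i * forkMatrix n (-(t S * t (S * Q)⁻¹)) (Q + Q⁻¹)
        (t (S * Q)⁻¹ ^ 2) (t (S * Q)⁻¹ * (Q * S⁻¹ - S * Q⁻¹)) i j
        = exponent e S Q ν j * t (S * Q)⁻¹ ^ 2 := h1
    have h4 : exponent e S Q ν j = ((t (S * Q)⁻¹) ^ 2)⁻¹ * (exponent e S Q ν j * t (S * Q)⁻¹ ^ 2) := by
      rw [mul_comm (exponent e S Q ν j), ← mul_assoc, inv_mul_cancel₀ (pow_ne_zero 2 ht), one_mul]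
    rw [h4, ← h3, Finset.mul_sum, Finset.mul_sum]
    refine Finset.sum_congr rfl fun i _ => ?_
    ring
  have hbool : ∀ F : Bool → ℂ, ∑ b, (if b = e then (1 : ℂ) else 0) * F b = F e := by
    intro F; simp
  have hbool' : ∀ F : Bool → ℂ, ∑ b, F b * (if b = e then (1 : ℂ) else 0) = F e := by
    intro F; simp
  simp only [Vertex.annihilationMode, Vertex.creationMode, Fintype.sum_sum_type, hV, hW,
    mode_inr hn, hBa, hbool, hbool']
  rw [hrr]
  have p1 := hpair S⁻¹ Q⁻¹ μ _ _ hrl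
  have p2 := hpair S Q ν _ _ hlr
  simp only [add_mul, Finset.sum_add_distrib]
  rw [p1, Finset.sum_congr rfl fun i _ => mul_comm (screeningVector e S Q ν i) _, p2, ← hsum]
  have h5 : ∑ i, -(1 / ((k : ℂ) + 1)) * exponent e S Q ν i * screeningVector e S⁻¹ Q⁻¹ μ i
      = -(1 / ((k : ℂ) + 1)) * ∑ i, exponent e S Q ν i * screeningVector e S⁻¹ Q⁻¹ μ i := by
    rw [Finset.mul_sum]
    exact Finset.sum_congr rfl fun i _ => by ring
  rw [h5]
  field_simp
  ring

end ContractionExponents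
end OspW

namespace OspW

section ZeroModes

variable {n : ℕ} {h γ : ℂ}

theorem charge_eq (e : Bool) (ν : Fin n → Fin 2) :
    (LamPrime n h γ e * xiTerm n h γ e ν).charge = Pi.single (Sum.inr e) 1 := by
  have hmul : ∀ V W : Vertex (Boson n), (V * W).charge = V.charge + W.charge := fun _ _ => rfl
  have hinv : ∀ V : Vertex (Boson n), V⁻¹.charge = -V.charge := fun _ => rfl
  have hshift : ∀ (α : ℂ) (V : Vertex (Boson n)), (V.shift α).charge = V.charge := fun _ _ => rfl
  have hpow : ∀ (V : Vertex (Boson n)) (m : ℤ), (V ^ m).charge = m • V.charge := fun _ _ => rfl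
  rw [LamPrime, xiTerm]
  simp only [hmul, hinv, hshift]
  rw [Vertex.map_prod (fun V => V.charge) rfl hmul, Finset.sum_eq_zero]
  · change Pi.single (Sum.inr e) 1 + _ + _ + _ = _
    abel
  · intro i _
    split_ifs with hi
    · have h0 : (Y n h γ i).charge = 0 := by
        rw [Y, if_pos hi]
        exact sub_self _
      rw [hpow, hshift, h0, smul_zero]
    · rfl

theorem pow_eq (e : Bool) (ν : Fin n → Fin 2) :
    (LamPrime n h γ e * xiTerm n h γ e ν).pow
      = Pi.single (Sum.inr e) 1 - Pi.single (Sum.inr (!e)) 1 := by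
  have hmul : ∀ V W : Vertex (Boson n), (V * W).pow = V.pow + W.pow := fun _ _ => rfl
  have hinv : ∀ V : Vertex (Boson n), V⁻¹.pow = -V.pow := fun _ => rfl
  have hshift : ∀ (α : ℂ) (V : Vertex (Boson n)), (V.shift α).pow = V.pow := fun _ _ => rfl
  have hpow : ∀ (V : Vertex (Boson n)) (m : ℤ), (V ^ m).pow = m • V.pow := fun _ _ => rfl
  rw [LamPrime, xiTerm]
  simp only [hmul, hinv, hshift]
  rw [Vertex.map_prod (fun V => V.pow) rfl hmul, Finset.sum_eq_zero]
  · change (Pi.single (Sum.inr e) 1 - Pi.single (Sum.inr (!e)) 1) + _ + _ + _ = _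
    abel
  · intro i _
    split_ifs with hi
    · have h0 : (Y n h γ i).pow = 0 := by
        rw [Y, if_pos hi]
        exact sub_self _
      rw [hpow, hshift, h0, smul_zero]
    · rfl

/-- The eigenvalue of the zero mode of `X_i` on momentum `p`. -/
noncomputable def zeroModeX (n : ℕ) (h γ : ℂ) (p : Boson n → ℂ) (i : Fin (n + 1)) : ℂ :=
  ∑ j, (X n h γ i).pow j * p j

theorem sum_const_mul (hn : 1 ≤ n) (e : Bool) (ν : Fin n → Fin 2) (p : Boson n → ℂ) :
    ∑ j, (LamPrime n h γ e * xiTerm n h γ e ν).const j * p j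
      = -logMon h γ 0 2 * p (Sum.inr (!e)) - logMon h γ 0 2 * zeroModeX n h γ p (node n (!e))
        + (∑ i : Fin (n + 1), if 2 ≤ i.val then
          ((-nu ν i + nu ν (i.val - 1) : ℤ) : ℂ) * (2 * logMon h γ 0 1 * zeroModeX n h γ p i) else 0)
        - logMon h γ (2 * level ν 0) (2 * nu ν 1) * zeroModeX n h γ p (node n e)
        + logMon h γ (2 * level ν 0) (2 - 2 * nu ν 1) * zeroModeX n h γ p (node n (!e)) := by
  set φ : Vertex (Boson n) → ℂ := fun V => ∑ j, V.const j * p j with hφ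
  set ψ : Vertex (Boson n) → ℂ := fun V => ∑ j, V.pow j * p j with hψ
  have hmul : ∀ V W : Vertex (Boson n), φ (V * W) = φ V + φ W := fun V W => by
    rw [hφ, ← Finset.sum_add_distrib]
    exact Finset.sum_congr rfl fun j _ => add_mul _ _ _
  have hinv : ∀ V : Vertex (Boson n), φ V⁻¹ = -φ V := fun V => by
    rw [hφ, ← Finset.sum_neg_distrib]
    exact Finset.sum_congr rfl fun j _ => neg_mul _ _
  have hdiv : ∀ V W : Vertex (Boson n), φ (V / W) = φ V - φ W := fun V W => by
    rw [hφ, ← Finset.sum_sub_distrib]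
    exact Finset.sum_congr rfl fun j _ => sub_mul _ _ _
  have hpow : ∀ (V : Vertex (Boson n)) (m : ℤ), φ (V ^ m) = m * φ V := fun V m => by
    rw [hφ, Finset.mul_sum]
    refine Finset.sum_congr rfl fun j _ => ?_
    change (m • V.const) j * p j = _
    simp [mul_assoc]
  have hshift : ∀ (α : ℂ) (V : Vertex (Boson n)), φ (V.shift α) = φ V + α * ψ V := fun α V => by
    rw [hφ, hψ, Finset.mul_sum, ← Finset.sum_add_distrib]
    refine Finset.sum_congr rfl fun j _ => ?_
    change (V.const j + α * V.pow j) * p j = _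
    ring
  have hX : ∀ i, φ (X n h γ i) = 0 := fun i =>
    Finset.sum_eq_zero fun j _ => zero_mul (p j)
  have hY : ∀ i : Fin (n + 1), i.val < 2 →
      φ (Y n h γ i) = 0 ∧ ψ (Y n h γ i) = -zeroModeX n h γ p i := by
    intro i hi
    rw [Y, if_neg (by omega), hinv, hX, neg_zero, hψ, zeroModeX, ← Finset.sum_neg_distrib]
    exact ⟨rfl, Finset.sum_congr rfl fun j _ => neg_mul _ _⟩
  have hY2 : ∀ i : Fin (n + 1), 2 ≤ i.val → ∀ α : ℂ,
      φ ((Y n h γ i).shift α) = 2 * logMon h γ 0 1 * zeroModeX n h γ p i := by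
    intro i hi α
    have h0 : ψ (Y n h γ i) = 0 := by
      refine Finset.sum_eq_zero fun j _ => ?_
      rw [Y, if_pos hi]
      change ((X n h γ i).pow j - (X n h γ i).pow j) * p j = 0
      rw [sub_self, zero_mul]
    rw [hshift, h0, mul_zero, add_zero, Y, if_pos hi, hdiv, hshift, hshift, hX]
    change 0 + _ * zeroModeX n h γ p i - (0 + _ * zeroModeX n h γ p i) = _
    rw [logMon, logMon]
    push_cast
    ring
  have hite : ∀ i : Fin (n + 1), φ (if 2 ≤ i.val then
      (Vertex.shift
        (logMon h γ (i.val + 2 * (∑ j ∈ Finset.Icc (i.val + 1) n, nu ν j)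
          + nu ν i.val - nu ν (i.val - 1)) 1)
        (Y n h γ i)) ^ (-nu ν i.val + nu ν (i.val - 1))
      else 1) = if 2 ≤ i.val then
          ((-nu ν i + nu ν (i.val - 1) : ℤ) : ℂ) * (2 * logMon h γ 0 1 * zeroModeX n h γ p i)
        else 0 := by
    intro i
    split_ifs with hi
    · rw [hpow, hY2 i hi]
    · exact Finset.sum_eq_zero fun j _ => zero_mul (p j)
  have hL : φ (Lam n h γ e) = -logMon h γ 0 2 * p (Sum.inr (!e)) := by
    change ∑ j, (Pi.single (Sum.inr (!e)) (-logMon h γ 0 2) : Boson n → ℂ) j * p j = _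
    rw [Finset.sum_eq_single (Sum.inr (!e))]
    · rw [Pi.single_eq_same]
    · intro j _ hj
      rw [Pi.single_eq_of_ne hj, zero_mul]
    · simp
  have h1 := sum_Icc_nu ν 0
  rw [zero_add] at h1
  have hYe := hY _ (node_val_lt hn e)
  have hYe' := hY _ (node_val_lt hn (!e))
  change φ (LamPrime n h γ e * xiTerm n h γ e ν) = _
  rw [LamPrime, xiTerm]
  simp only [hmul, hinv, hshift, hL, hYe.1, hYe.2, hYe'.1, hYe'.2]
  rw [Vertex.map_prod φ (Finset.sum_eq_zero fun j _ => zero_mul (p j)) hmul,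
    Finset.sum_congr rfl fun i _ => hite i, h1]
  ring

/-- The functions of a path which are affine in its steps. -/
def affineFunctions (n : ℕ) : Submodule ℂ ((Fin n → Fin 2) → ℂ) where
  carrier := {f | ∃ (b : ℂ) (ζ : Fin n → ℂ), ∀ ν, f ν = b + ∑ i, ζ i * (ν i).val}
  zero_mem' := ⟨0, 0, fun ν => by simp⟩
  add_mem' := by
    rintro f g ⟨b, ζ, hf⟩ ⟨b', ζ', hg⟩
    refine ⟨b + b', ζ + ζ', fun ν => ?_⟩
    simp only [Pi.add_apply, hf, hg, add_mul, Finset.sum_add_distrib]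
    ring
  smul_mem' := by
    rintro c f ⟨b, ζ, hf⟩
    refine ⟨c * b, c • ζ, fun ν => ?_⟩
    simp only [Pi.smul_apply, hf, smul_eq_mul, mul_add, Finset.mul_sum, mul_assoc]

theorem const_mem_affineFunctions (b : ℂ) : (fun _ => b) ∈ affineFunctions n :=
  ⟨b, 0, fun ν => by simp⟩

theorem nu_mem_affineFunctions (i : ℕ) : (fun ν => (nu ν i : ℂ)) ∈ affineFunctions n := by
  by_cases hi : 1 ≤ i ∧ i ≤ n
  · refine ⟨0, Pi.single ⟨i - 1, by omega⟩ 1, fun ν => ?_⟩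
    change (nu ν i : ℂ) = _
    rw [nu, dif_pos hi, Finset.sum_eq_single ⟨i - 1, by omega⟩]
    · simp
    · intro j _ hj
      rw [Pi.single_eq_of_ne hj, zero_mul]
    · simp
  · convert const_mem_affineFunctions (n := n) 0 with ν
    rw [nu, dif_neg hi, Int.cast_zero]

theorem level_mem_affineFunctions (i : ℕ) : (fun ν => (level ν i : ℂ)) ∈ affineFunctions n := by
  refine ⟨0, fun j => if i ≤ j.val then 1 else 0, fun ν => ?_⟩
  change (level ν i : ℂ) = _
  rw [level]
  push_cast
  simp

theorem sum_const_mul_mem_affineFunctions (hn : 1 ≤ n) (e : Bool) (p : Boson n → ℂ) :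
    (fun ν => ∑ j, (LamPrime n h γ e * xiTerm n h γ e ν).const j * p j) ∈ affineFunctions n := by
  simp only [sum_const_mul hn, logMon]
  have hnu : ∀ i (c : ℂ), (fun ν => (nu ν i : ℂ) * c) ∈ affineFunctions n := fun i c => by
    convert Submodule.smul_mem _ c (nu_mem_affineFunctions i) using 1
    exact funext fun ν => mul_comm _ _
  have hlevel : ∀ c : ℂ, (fun ν => (level ν 0 : ℂ) * c) ∈ affineFunctions n := fun c => by
    convert Submodule.smul_mem _ c (level_mem_affineFunctions 0) using 1
    exact funext fun ν => mul_comm _ _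
  have hlog : ∀ (a b c : ℂ), (fun ν : Fin n → Fin 2 => -(2 * (level ν 0 : ℂ) * (1 - γ)
      + (b + a * (nu ν 1 : ℂ)) * γ) * h * c) ∈ affineFunctions n := by
    intro a b c
    convert add_mem (add_mem (hlevel (-(2 * (1 - γ) * h * c))) (hnu 1 (-(a * γ * h * c))))
      (const_mem_affineFunctions (-(b * γ * h * c))) using 1
    funext ν
    simp only [Pi.add_apply]
    ring
  refine add_mem (sub_mem (add_mem (const_mem_affineFunctions _) ?_) ?_) ?_
  · have : (fun ν : Fin n → Fin 2 => ∑ i : Fin (n + 1), if 2 ≤ i.val then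
        ((-nu ν i + nu ν (i.val - 1) : ℤ) : ℂ) *
          (2 * (-(((0 : ℤ) : ℂ) * (1 - γ) + ((1 : ℤ) : ℂ) * γ) * h) * zeroModeX n h γ p i) else 0)
        = ∑ i : Fin (n + 1), fun ν => if 2 ≤ i.val then
        ((-nu ν i + nu ν (i.val - 1) : ℤ) : ℂ) *
          (2 * (-(((0 : ℤ) : ℂ) * (1 - γ) + ((1 : ℤ) : ℂ) * γ) * h) * zeroModeX n h γ p i) else 0 := by
      funext ν
      rw [Finset.sum_apply]
    rw [this]
    refine sum_mem fun i _ => ?_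
    split_ifs
    · push_cast
      simp only [add_mul, neg_mul]
      exact add_mem (neg_mem (hnu _ _)) (hnu _ _)
    · exact zero_mem _
  · convert hlog 2 0 (zeroModeX n h γ p (node n e)) using 4
    push_cast
    ring
  · convert hlog (-2) 2 (zeroModeX n h γ p (node n (!e))) using 4
    push_cast
    ring

/-- The shift of the momentum by `Λ` or `Λ̄`. -/
noncomputable def momentumShift (n : ℕ) (h γ : ℂ) (e : Bool) : Boson n → ℂ :=
  (heisenberg n h γ).zero.mulVec (Pi.single (Sum.inr e) 1)

theorem momentumShift_inl (e : Bool) (i : Fin (n + 1)) :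
    momentumShift n h γ e (Sum.inl i) = if i = node n e then -1 else if i = node n (!e) then 1
      else 0 := by
  rw [momentumShift, Matrix.mulVec_single_one]
  rfl

theorem momentumShift_inr (e b : Bool) : momentumShift n h γ e (Sum.inr b) = 0 := by
  rw [momentumShift, Matrix.mulVec_single_one]
  rfl

theorem sum_pow_mul_momentumShift (e : Bool) :
    ∑ j, (Pi.single (Sum.inr e) 1 - Pi.single (Sum.inr (!e)) 1 : Boson n → ℂ) j
      * momentumShift n h γ e j = 0 := by
  refine Finset.sum_eq_zero fun j _ => ?_
  rcases j with i | b
  · simp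
  · rw [momentumShift_inr, mul_zero]

theorem gamma_ne_zero (hgen : IsGeneric (s1 h γ) (s2 h γ)) : γ ≠ 0 := by
  rintro rfl
  have := hgen.eq_zero 1 0 (by simp [s1])
  omega

theorem one_sub_gamma_ne_zero (hgen : IsGeneric (s1 h γ) (s2 h γ)) : 1 - γ ≠ 0 := by
  intro h0
  have := hgen.eq_zero 0 1 (by simp [s2, h0])
  omega

theorem zeroModeX_momentumShift (hn : 1 ≤ n) (hgen : IsGeneric (s1 h γ) (s2 h γ)) (e : Bool)
    (i : Fin (n + 1)) : zeroModeX n h γ (momentumShift n h γ e) i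
      = momentumShift n h γ e (Sum.inl i) / (2 * (1 - γ)) := by
  have hγ := gamma_ne_zero hgen
  have hγ' := one_sub_gamma_ne_zero hgen
  have hlt := node_val_lt hn e
  have hnot := node_not_val hn e
  have hdet : IsUnit (limitMatrix n γ).det := by
    rw [limitMatrix_eq]
    refine isUnit_det_forkMatrix (b := 1) hn hγ ?_ one_ne_zero (by norm_num) (by ring) (by norm_num)
    intro h0
    apply hγ'
    linear_combination h0 / 2
  set x : Fin (n + 1) → ℂ := fun k => momentumShift n h γ e (Sum.inl k) with hx
  have hval : ∀ k : ℕ, extendZero x k = if k = (node n e).val then -1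
      else if k = 1 - (node n e).val then 1 else 0 := by
    intro k
    rw [extendZero]
    split_ifs with h1 h2 h3 h2 h3
    · simp only [hx]; rw [momentumShift_inl, if_pos (Fin.ext h2)]
    · simp only [hx]
      rw [momentumShift_inl, if_neg (fun h => h2 (congrArg Fin.val h)),
        if_pos (Fin.ext (by simp only [hnot]; exact h3))]
    · simp only [hx]
      rw [momentumShift_inl, if_neg (fun h => h2 (congrArg Fin.val h)),
        if_neg (fun h => h3 ((congrArg Fin.val h).trans hnot))]
    · omega
    · omega
    · rfl
  have hK : (limitMatrix n γ).mulVec x = (2 * (1 - γ)) • x := by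
    funext k
    rw [limitMatrix_eq, Pi.smul_apply, smul_eq_mul, ← extendZero_val x k]
    by_cases hk : 2 ≤ k.val
    · rw [forkMatrix_mulVec_of_two_le _ _ _ _ _ _ hk]
      simp only [hval]
      split_ifs <;> first | omega | ring
    · rw [forkMatrix_mulVec_of_lt_two _ _ _ _ _ _ (by omega)]
      simp only [hval]
      split_ifs <;> first | omega | ring
  have h1 : (limitMatrix n γ)⁻¹.mulVec x = (2 * (1 - γ))⁻¹ • x := by
    have h2 : x = (2 * (1 - γ))⁻¹ • (limitMatrix n γ).mulVec x := by
      rw [hK, smul_smul, inv_mul_cancel₀ (mul_ne_zero two_ne_zero hγ'), one_smul]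
    conv_lhs => rw [h2]
    rw [Matrix.mulVec_smul, Matrix.mulVec_mulVec, Matrix.nonsing_inv_mul _ hdet, Matrix.one_mulVec]
  have h3 := congrFun h1 i
  rw [zeroModeX, Fintype.sum_sum_type]
  simp only [momentumShift_inr, mul_zero, Finset.sum_const_zero, add_zero]
  change (limitMatrix n γ)⁻¹.mulVec x i = _
  rw [h3, Pi.smul_apply, smul_eq_mul]
  ring

theorem sum_const_mul_momentumShift (hn : 1 ≤ n) (hgen : IsGeneric (s1 h γ) (s2 h γ)) (e : Bool)
    (ν : Fin n → Fin 2) :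
    ∑ j, (LamPrime n h γ e * xiTerm n h γ e ν).const j * momentumShift n h γ e j
      = level ν 0 * (-2 * h) := by
  have hγ' := one_sub_gamma_ne_zero hgen
  have hlt := node_val_lt hn e
  have hnot := node_not_val hn e
  have hne : node n (!e) ≠ node n e := by
    rw [Ne, Fin.ext_iff]; omega
  rw [sum_const_mul hn, Finset.sum_eq_zero]
  · rw [zeroModeX_momentumShift hn hgen, zeroModeX_momentumShift hn hgen, momentumShift_inr,
      momentumShift_inl, momentumShift_inl, if_pos rfl, if_neg hne, if_pos rfl]
    simp only [logMon]
    push_cast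
    field_simp
    ring
  · intro i _
    split_ifs with hi
    · rw [zeroModeX_momentumShift hn hgen, momentumShift_inl, if_neg, if_neg]
      · simp
      · rw [Fin.ext_iff]; omega
      · rw [Fin.ext_iff]; omega
    · rfl

end ZeroModes
end OspW

namespace OspW

section LogarithmicDerivative

/-- `C` has constant term `1` and the logarithmic derivative `∑ g_k x^k`. -/
def HasLogDeriv (C : PowerSeries ℂ) (g : ℕ → ℂ) : Prop :=
  PowerSeries.constantCoeff C = 1 ∧
    PowerSeries.derivative ℂ C = PowerSeries.mk g * C

theorem HasLogDeriv.mul {C D : PowerSeries ℂ} {f g : ℕ → ℂ} (hC : HasLogDeriv C f)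
    (hD : HasLogDeriv D g) : HasLogDeriv (C * D) (f + g) := by
  refine ⟨by rw [map_mul, hC.1, hD.1, mul_one], ?_⟩
  have h : PowerSeries.mk (f + g) = PowerSeries.mk f + PowerSeries.mk g := by
    ext; simp
  rw [Derivation.leibniz, hC.2, hD.2, h, smul_eq_mul, smul_eq_mul]
  ring

theorem HasLogDeriv.one : HasLogDeriv 1 0 := by
  refine ⟨map_one _, ?_⟩
  have h : PowerSeries.mk (0 : ℕ → ℂ) = 0 := by ext; simp
  rw [h, zero_mul]
  exact Derivation.map_one_eq_zero _

theorem HasLogDeriv.prod {ι : Type} (s : Finset ι) {C : ι → PowerSeries ℂ} {g : ι → ℕ → ℂ}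
    (h : ∀ i, HasLogDeriv (C i) (g i)) : HasLogDeriv (∏ i ∈ s, C i) (∑ i ∈ s, g i) := by
  classical
  induction s using Finset.induction_on with
  | empty => simpa using HasLogDeriv.one
  | insert a s ha ih =>
    rw [Finset.prod_insert ha, Finset.sum_insert ha]
    exact (h a).mul ih

/-- The expansion of `(1 - a x) / (1 - b x)`. -/
noncomputable def linearRatio (a b : ℂ) : PowerSeries ℂ :=
  (1 - PowerSeries.C a * PowerSeries.X) * (1 - PowerSeries.C b * PowerSeries.X)⁻¹

theorem mul_inv_one_sub (b : ℂ) : (1 - PowerSeries.C b * PowerSeries.X) *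
    (1 - PowerSeries.C b * PowerSeries.X)⁻¹ = 1 :=
  PowerSeries.mul_inv_cancel _ (by simp)

theorem inv_one_sub_eq_mk (b : ℂ) :
    (1 - PowerSeries.C b * PowerSeries.X)⁻¹ = PowerSeries.mk fun k => b ^ k := by
  have h : (1 - PowerSeries.C b * PowerSeries.X) * (PowerSeries.mk fun k => b ^ k) = 1 := by
    ext k
    rw [sub_mul, one_mul, mul_assoc, map_sub, PowerSeries.coeff_C_mul, PowerSeries.coeff_mk]
    cases k with
    | zero => simp
    | succ k => simp [PowerSeries.coeff_one, PowerSeries.coeff_succ_X_mul, pow_succ']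
  have h1 := mul_inv_one_sub b
  calc _ = (1 - PowerSeries.C b * PowerSeries.X)⁻¹ *
        ((1 - PowerSeries.C b * PowerSeries.X) * PowerSeries.mk fun k => b ^ k) := by rw [h, mul_one]
    _ = _ := by rw [← mul_assoc, mul_comm _⁻¹, h1, one_mul]

theorem coeff_succ_linearRatio (a b : ℂ) (k : ℕ) :
    PowerSeries.coeff (k + 1) (linearRatio a b) = b ^ (k + 1) - a * b ^ k := by
  rw [linearRatio, inv_one_sub_eq_mk, sub_mul, one_mul, mul_assoc, map_sub, PowerSeries.coeff_C_mul,
    PowerSeries.coeff_succ_X_mul, PowerSeries.coeff_mk, PowerSeries.coeff_mk]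

theorem linearRatio_self (a : ℂ) : linearRatio a a = 1 := mul_inv_one_sub a

theorem hasLogDeriv_linearRatio (a b : ℂ) :
    HasLogDeriv (linearRatio a b) fun k => b ^ (k + 1) - a ^ (k + 1) := by
  have hmk : (PowerSeries.mk fun k => b ^ (k + 1) - a ^ (k + 1))
      = PowerSeries.C b * (1 - PowerSeries.C b * PowerSeries.X)⁻¹
        - PowerSeries.C a * (1 - PowerSeries.C a * PowerSeries.X)⁻¹ := by
    ext k
    rw [inv_one_sub_eq_mk, inv_one_sub_eq_mk, map_sub, PowerSeries.coeff_C_mul,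
      PowerSeries.coeff_C_mul, PowerSeries.coeff_mk, PowerSeries.coeff_mk, PowerSeries.coeff_mk,
      pow_succ', pow_succ']
  have hd : ∀ c : ℂ, PowerSeries.derivative ℂ (1 - PowerSeries.C c * PowerSeries.X)
      = -PowerSeries.C c := by
    intro c
    rw [map_sub, Derivation.map_one_eq_zero, Derivation.leibniz, PowerSeries.derivative_C,
      PowerSeries.derivative_X]
    simp
  refine ⟨by simp [linearRatio], ?_⟩
  rw [hmk, linearRatio, Derivation.leibniz, PowerSeries.derivative_inv', hd, hd, smul_eq_mul,
    smul_eq_mul]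
  have h1 := mul_inv_one_sub a
  linear_combination (PowerSeries.C a * (1 - PowerSeries.C b * PowerSeries.X)⁻¹) * h1

theorem HasLogDeriv.isContraction {J : Type} [Fintype J] {H : Heisenberg J} {V W : Vertex J}
    {C : PowerSeries ℂ} {g : ℕ → ℂ} (hC : HasLogDeriv C g)
    (hg : ∀ k : ℕ, ((k : ℂ) + 1) *
      ∑ j, V.annihilationMode H (j, k) * W.creationMode (j, k) = g k) :
    IsContraction H V W C := by
  refine ⟨by rw [PowerSeries.coeff_zero_eq_constantCoeff, hC.1], fun m => ?_⟩
  rcases m with _ | m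
  · simp
  · have h1 := congrArg (PowerSeries.coeff m) hC.2
    rw [PowerSeries.coeff_derivative, PowerSeries.coeff_mul,
      Finset.Nat.sum_antidiagonal_eq_sum_range_succ_mk] at h1
    rw [Nat.cast_add_one, mul_comm, h1]
    refine Finset.sum_congr rfl fun k _ => ?_
    rw [hg, PowerSeries.coeff_mk, Nat.add_sub_add_right]

theorem ratioSeries_linearRatio_mul (a b : ℂ) :
    ratioSeries (linearRatio a b) * (zVar - algebraMap ℂ _ b * wVar)
      = zVar - algebraMap ℂ _ a * wVar := by
  have h : ∀ c : ℂ, zVar - algebraMap ℂ _ c * wVar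
      = zVar * ratioSeries (1 - PowerSeries.C c * PowerSeries.X) := by
    intro c
    rw [map_sub, map_one, map_mul, ratioSeries_C, ratioSeries_X, mul_sub, mul_one, mul_left_comm,
      mul_div_cancel₀ _ zVar_ne_zero]
  rw [h, h, mul_left_comm, ← map_mul, linearRatio, mul_assoc, mul_comm _⁻¹, mul_inv_one_sub,
    mul_one]

end LogarithmicDerivative

section PathContraction

variable {n : ℕ} {h γ : ℂ}

/-- The position of the pole in the factor of the contraction at the node `i + 1`. -/
noncomputable def stepPole (Q : ℂ) (ν μ : Fin n → Fin 2) (i : ℕ) : ℂ :=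
  Q ^ (2 * ((level μ (i + 1) : ℤ) - level ν (i + 1)))

/-- The position of the zero in the factor of the contraction at the node `i + 1`. -/
noncomputable def stepZero (S Q : ℂ) (ν μ : Fin n → Fin 2) (i : ℕ) : ℂ :=
  stepPole Q ν μ i * (S * Q) ^ (2 * (nu μ (i + 1) - nu ν (i + 1)))

theorem stepExponent_pow (S Q : ℂ) (ν μ : Fin n → Fin 2) (i k : ℕ) :
    stepExponent (S ^ k) (Q ^ k) ν μ i = stepPole Q ν μ i ^ k - stepZero S Q ν μ i ^ k := by
  have h1 : ∀ (x : ℂ) (m : ℤ), (x ^ k) ^ m = (x ^ m) ^ k := fun x m => by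
    rw [← zpow_natCast, ← zpow_natCast, ← zpow_mul, ← zpow_mul, mul_comm]
  rw [stepExponent, stepZero, mul_pow, ← mul_pow S Q, h1, h1, h1, stepPole]
  rcases nu_eq_zero_or_one ν (i + 1) with c1 | c1 <;>
  rcases nu_eq_zero_or_one μ (i + 1) with c2 | c2 <;>
  · rw [c1, c2]
    norm_num
    try ring

/-- The contraction of two terms of the current. -/
noncomputable def contractionSeries (h γ : ℂ) (e : Bool) (ν μ : Fin n → Fin 2) : PowerSeries ℂ :=
  linearRatio 1 (polePosition h e) * ∏ i : Fin n,
    linearRatio (stepZero (s1 h γ) (s2 h γ) ν μ i) (stepPole (s2 h γ) ν μ i)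

theorem isContraction_contractionSeries (hn : 1 ≤ n) (hgen : IsGeneric (s1 h γ) (s2 h γ))
    (e : Bool) (ν μ : Fin n → Fin 2) :
    IsContraction (heisenberg n h γ) (LamPrime n h γ e * xiTerm n h γ e ν)
      (LamPrime n h γ e * xiTerm n h γ e μ) (contractionSeries h γ e ν μ) := by
  refine ((hasLogDeriv_linearRatio _ _).mul
    (HasLogDeriv.prod _ fun i : Fin n => hasLogDeriv_linearRatio _ _)).isContraction fun k => ?_
  rw [sum_annihilationMode_mul_creationMode hn hgen, Pi.add_apply, Finset.sum_apply, one_pow]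
  congr 1
  rw [← Fin.sum_univ_eq_sum_range]
  exact Finset.sum_congr rfl fun i _ => stepExponent_pow _ _ _ _ _ _

/-- `z` and `w` as units. -/
noncomputable def zUnit : FormalFieldˣ := Units.mk0 zVar zVar_ne_zero
noncomputable def wUnit : FormalFieldˣ := Units.mk0 wVar wVar_ne_zero

/-- The unit of the field of formal series given by a nonzero number. -/
noncomputable def scalarUnit (c : ℂ) (hc : c ≠ 0) : FormalFieldˣ :=
  Units.map (algebraMap ℂ FormalField).toMonoidHom (Units.mk0 c hc)

theorem zwCoeff_one (m l : ℤ) : zwCoeff m l 1 = if m = 0 ∧ l = 0 then 1 else 0 := by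
  rw [← map_one ratioSeries, zwCoeff_ratioSeries, PowerSeries.coeff_one]
  split_ifs <;> first | rfl | omega

theorem algebraMap_mul_zVar_ne (a b : ℂ) (ha : a ≠ 0) :
    algebraMap ℂ FormalField a * zVar ≠ algebraMap ℂ FormalField b * wVar := by
  intro h0
  have h1 := congrArg (zwCoeff 1 0) h0
  have h2 : ∀ (c : ℂ) (k : FormalField), algebraMap ℂ FormalField c * k
      = algebraMap ℂ FormalField c * (k * 1) := fun c k => by rw [mul_one]
  rw [h2, h2 b, zwCoeff_algebraMap_mul, zwCoeff_algebraMap_mul, zwCoeff_zVar_mul, zwCoeff_wVar_mul,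
    zwCoeff_one, zwCoeff_one] at h1
  simp [ha] at h1

theorem stepFactor_eq {S Q : ℂ} (hS : S ≠ 0) (hQ : Q ≠ 0) (hs : Q ^ 2 ≠ 0) (ν μ : Fin n → Fin 2)
    (i : Fin n) :
    stepFactor (algebraMap ℂ _ ((S * Q) ^ 2)) (ν i) (μ i)
      (scalarUnit (Q ^ 2) hs ^ level ν (i + 1) * zUnit : FormalField)
      (scalarUnit (Q ^ 2) hs ^ level μ (i + 1) * wUnit)
      = algebraMap ℂ _ ((S * Q) ^ 2) ^ (ν i).val *
        ratioSeries (linearRatio (stepZero S Q ν μ i) (stepPole Q ν μ i)) := by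
  have hSQ : (S * Q) ^ 2 ≠ 0 := pow_ne_zero 2 (mul_ne_zero hS hQ)
  have hnu := nu_succ ν i
  have hmu := nu_succ μ i
  have hpow : ∀ k : ℕ, (scalarUnit (Q ^ 2) hs ^ k : FormalField)
      = algebraMap ℂ _ (Q ^ (2 * (k : ℤ))) := by
    intro k
    have h1 : Q ^ (2 * (k : ℤ)) = (Q ^ 2) ^ k := by
      rw [zpow_mul, zpow_natCast, zpow_ofNat]
    rw [h1, map_pow (algebraMap ℂ FormalField)]
    rfl
  have hz : (zUnit : FormalField) = zVar := rfl
  have hw : (wUnit : FormalField) = wVar := rfl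
  rw [hpow, hpow, hz, hw]
  have hA : Q ^ (2 * (level ν (i + 1) : ℤ)) ≠ 0 := zpow_ne_zero _ hQ
  have hpole : Q ^ (2 * (level ν (i + 1) : ℤ)) * stepPole Q ν μ i
      = Q ^ (2 * (level μ (i + 1) : ℤ)) := by
    rw [stepPole, ← zpow_add₀ hQ]; congr 1; ring
  have hzero : Q ^ (2 * (level ν (i + 1) : ℤ)) * stepZero S Q ν μ i
      = Q ^ (2 * (level μ (i + 1) : ℤ)) * (S * Q) ^ (2 * (((μ i).val : ℤ) - (ν i).val)) := by
    rw [stepZero, ← mul_assoc, hpole, hnu, hmu]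
  have hR := ratioSeries_linearRatio_mul (stepZero S Q ν μ i) (stepPole Q ν μ i)
  have hself : (ν i).val = (μ i).val → stepZero S Q ν μ i = stepPole Q ν μ i := by
    intro h; rw [stepZero, hnu, hmu, h]; simp
  generalize stepZero S Q ν μ i = z0 at *
  generalize stepPole Q ν μ i = p0 at *
  generalize Q ^ (2 * (level ν (i + 1) : ℤ)) = A at *
  generalize Q ^ (2 * (level μ (i + 1) : ℤ)) = B at *
  have hne : algebraMap ℂ FormalField A * zVar - algebraMap ℂ FormalField B * wVar ≠ 0 :=
    sub_ne_zero.mpr (algebraMap_mul_zVar_ne _ _ hA)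
  have hR' : ratioSeries (linearRatio z0 p0) *
      (algebraMap ℂ FormalField A * zVar - algebraMap ℂ FormalField B * wVar)
      = algebraMap ℂ FormalField A * zVar - algebraMap ℂ FormalField (A * z0) * wVar := by
    rw [← hpole, map_mul (algebraMap ℂ FormalField), map_mul (algebraMap ℂ FormalField)]
    linear_combination algebraMap ℂ FormalField A * hR
  rw [hzero] at hR'
  generalize ν i = a at *
  generalize μ i = b at *
  generalize hT : (S * Q) ^ 2 = T at *
  have hTm : (S * Q) ^ (2 * (((0 : Fin 2).val : ℤ) - (1 : Fin 2).val)) = T⁻¹ := by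
    rw [← hT, ← zpow_natCast, ← zpow_neg]; rfl
  have hTp : (S * Q) ^ (2 * (((1 : Fin 2).val : ℤ) - (0 : Fin 2).val)) = T := by
    rw [← hT, ← zpow_natCast]; rfl
  fin_cases a <;> fin_cases b
  · rw [hself rfl, linearRatio_self]; simp [stepFactor]
  · change ratioSeries (linearRatio z0 p0) * _ = _ - algebraMap ℂ FormalField (B * (S * Q) ^ (2 * (((1 : Fin 2).val : ℤ) - (0 : Fin 2).val))) * _ at hR'
    rw [hTp, map_mul (algebraMap ℂ FormalField)] at hR'
    simp only [stepFactor, Fin.zero_eta, Fin.mk_one, Fin.isValue, zero_ne_one, if_false, if_true,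
      pow_zero, one_mul]
    rw [div_eq_iff hne, hR']
    ring
  · change ratioSeries (linearRatio z0 p0) * _ = _ - algebraMap ℂ FormalField (B * (S * Q) ^ (2 * (((0 : Fin 2).val : ℤ) - (1 : Fin 2).val))) * _ at hR'
    rw [hTm, map_mul (algebraMap ℂ FormalField)] at hR'
    have h1 : algebraMap ℂ FormalField T * algebraMap ℂ FormalField T⁻¹ = 1 := by
      rw [← map_mul (algebraMap ℂ FormalField), mul_inv_cancel₀ hSQ,
        map_one (algebraMap ℂ FormalField)]
    simp only [stepFactor, Fin.zero_eta, Fin.mk_one, Fin.isValue, zero_ne_one, if_false, if_true,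
      pow_one]
    rw [div_eq_iff hne, mul_assoc, hR']
    linear_combination (algebraMap ℂ FormalField B * wVar) * h1
  · rw [hself rfl, linearRatio_self]; simp [stepFactor]

theorem pathWeight_eq (hgen : IsGeneric (s1 h γ) (s2 h γ)) (hs : s2 h γ ^ 2 ≠ 0) (κ : ℕ → ℂ)
    (e : Bool) (ν μ : Fin n → Fin 2) :
    (zVar - algebraMap ℂ _ (polePosition h e) * wVar) *
        (algebraMap ℂ _ ((∏ i : Fin n, κ i ^ ((ν i).val + (μ i).val))
          * ((s1 h γ * s2 h γ) ^ 2) ^ level ν 0) * ratioSeries (contractionSeries h γ e ν μ))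
      = (zVar - wVar) * pathWeight κ (algebraMap ℂ _ ((s1 h γ * s2 h γ) ^ 2))
          (scalarUnit (s2 h γ ^ 2) hs) ν μ zUnit wUnit := by
  have hlevel : level ν 0 = ∑ i : Fin n, (ν i).val := by
    rw [level]; simp
  have h1 := ratioSeries_linearRatio_mul 1 (polePosition h e)
  rw [map_one (algebraMap ℂ FormalField), one_mul] at h1
  rw [← h1, pathWeight, contractionSeries, map_mul ratioSeries, map_prod]
  simp only [stepFactor_eq hgen.ne_zero_left hgen.ne_zero_right hs, Finset.prod_mul_distrib]
  rw [hlevel, Finset.prod_pow_eq_pow_sum, map_mul (algebraMap ℂ FormalField),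
    map_prod (algebraMap ℂ FormalField)]
  simp only [map_pow (algebraMap ℂ FormalField)]
  ring

end PathContraction
end OspW

namespace OspW

section Symbols

variable {n : ℕ} {h γ : ℂ}

theorem mode_symbol_mem (hn : 1 ≤ n) (hgen : IsGeneric (s1 h γ) (s2 h γ)) (hs : s2 h γ ^ 2 ≠ 0)
    (e : Bool) {r : ℤ} (hr : r ≠ 0) (j : Boson n) :
    (fun ω : (Fin n → Fin 2) × (Fin n → Fin 2) =>
      algebraMap ℂ FormalField ((LamPrime n h γ e * xiTerm n h γ e ω.1).mode r j) * zVar ^ (-r)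
      + algebraMap ℂ FormalField ((LamPrime n h γ e * xiTerm n h γ e ω.2).mode r j) * wVar ^ (-r))
      ∈ powerSumAlgebra n (scalarUnit (s2 h γ ^ 2) hs) zUnit wUnit := by
  have hQ := hgen.ne_zero_right
  have hmem : ∀ i ≤ n, pathPowerSum (n := n) (scalarUnit (s2 h γ ^ 2) hs) zUnit wUnit i (-r)
      ∈ powerSumAlgebra n (scalarUnit (s2 h γ ^ 2) hs) zUnit wUnit := fun i hi =>
    Algebra.subset_adjoin ⟨i, hi, -r, rfl⟩
  have hz : (zUnit : FormalField) = zVar := rfl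
  have hw : (wUnit : FormalField) = wVar := rfl
  have hn0 : pathPowerSum (n := n) (scalarUnit (s2 h γ ^ 2) hs) zUnit wUnit n (-r)
      = fun _ => zVar ^ (-r) + wVar ^ (-r) := by
    funext ω
    rw [pathPowerSum, level_self, level_self, pow_zero, one_mul, one_mul, hz, hw]
  have hpow : ∀ (k : ℕ) (u : FormalFieldˣ),
      ((scalarUnit (s2 h γ ^ 2) hs ^ k * u : FormalFieldˣ) : FormalField) ^ (-r)
      = algebraMap ℂ FormalField ((s2 h γ ^ r) ^ (-2 * (k : ℤ))) * (u : FormalField) ^ (-r) := by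
    intro k u
    have h1 : (s2 h γ ^ r) ^ (-2 * (k : ℤ)) = ((s2 h γ ^ 2) ^ k) ^ (-r) := by
      rw [← zpow_natCast, ← zpow_natCast (s2 h γ), ← zpow_mul, ← zpow_mul, ← zpow_mul]
      congr 1
      push_cast
      ring
    rw [h1, map_zpow₀ (algebraMap ℂ FormalField), map_pow (algebraMap ℂ FormalField), Units.val_mul,
      mul_zpow, Units.val_pow_eq_pow_val]
    rfl
  have hscr : ∀ i, i - 1 ≤ n → (fun ω : (Fin n → Fin 2) × (Fin n → Fin 2) =>
      algebraMap ℂ FormalField (screeningExponent (s1 h γ ^ r) (s2 h γ ^ r) ω.1 i) * zVar ^ (-r)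
      + algebraMap ℂ FormalField (screeningExponent (s1 h γ ^ r) (s2 h γ ^ r) ω.2 i) * wVar ^ (-r))
      ∈ powerSumAlgebra n (scalarUnit (s2 h γ ^ 2) hs) zUnit wUnit := by
    intro i hi
    set ρ : ℂ := -t (s1 h γ ^ r * s2 h γ ^ r)⁻¹ * (s2 h γ ^ r) ^ (-(i : ℤ)) * (s1 h γ ^ r)⁻¹
      / (1 - (s2 h γ ^ r) ^ (-2 : ℤ)) with hρ
    have h1 : ∀ ν : Fin n → Fin 2, screeningExponent (s1 h γ ^ r) (s2 h γ ^ r) ν i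
        = ρ * (1 - (s2 h γ ^ r) ^ (-2 * (level ν (i - 1) : ℤ))) := by
      intro ν; rw [screeningExponent, hρ]; ring
    convert Subalgebra.mul_mem _ (Subalgebra.algebraMap_mem (powerSumAlgebra n
      (scalarUnit (s2 h γ ^ 2) hs) zUnit wUnit) ρ)
      (Subalgebra.sub_mem _ (hmem n le_rfl) (hmem (i - 1) hi)) using 1
    funext ω
    rw [Pi.mul_apply, Pi.sub_apply, hn0, Pi.algebraMap_apply, pathPowerSum, hpow, hpow, hz, hw, h1,
      h1]
    simp only [map_mul (algebraMap ℂ FormalField), map_sub (algebraMap ℂ FormalField),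
      map_one (algebraMap ℂ FormalField)]
    ring
  have hzero : (fun _ : (Fin n → Fin 2) × (Fin n → Fin 2) =>
      algebraMap ℂ FormalField 0 * zVar ^ (-r) + algebraMap ℂ FormalField 0 * wVar ^ (-r))
      ∈ powerSumAlgebra n (scalarUnit (s2 h γ ^ 2) hs) zUnit wUnit := by
    simp only [map_zero (algebraMap ℂ FormalField), zero_mul, add_zero]
    exact Subalgebra.zero_mem _
  rcases j with i | b
  · simp only [mode_inl hn hgen e _ hr, screeningVector]
    split_ifs
    · exact hscr i (by omega)
    · exact hscr 1 (by omega)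
    · exact hzero
  · simp only [mode_inr hn]
    split_ifs
    · simp only [map_one (algebraMap ℂ FormalField), one_mul]
      rw [← hn0]
      exact hmem n le_rfl
    · exact hzero

theorem aeval_symbols_mem (hn : 1 ≤ n) (hgen : IsGeneric (s1 h γ) (s2 h γ)) (hs : s2 h γ ^ 2 ≠ 0)
    (e : Bool) (P : MvPolynomial ((Boson n × ℕ) ⊕ (Boson n × ℕ)) ℂ) :
    (fun ω : (Fin n → Fin 2) × (Fin n → Fin 2) => MvPolynomial.aeval (Sum.elim
      (creationSymbol (LamPrime n h γ e * xiTerm n h γ e ω.1)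
        (LamPrime n h γ e * xiTerm n h γ e ω.2))
      (annihilationSymbol (heisenberg n h γ) (LamPrime n h γ e * xiTerm n h γ e ω.1)
        (LamPrime n h γ e * xiTerm n h γ e ω.2))) P)
      ∈ powerSumAlgebra n (scalarUnit (s2 h γ ^ 2) hs) zUnit wUnit := by
  have hmode := fun {r : ℤ} (hr : r ≠ 0) j => mode_symbol_mem hn hgen hs e hr j
  induction P using MvPolynomial.induction_on with
  | C a =>
    simp only [MvPolynomial.aeval_C]
    exact Subalgebra.algebraMap_mem (powerSumAlgebra n (scalarUnit (s2 h γ ^ 2) hs) zUnit wUnit) a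
  | add P Q hP hQ =>
    simp only [map_add]
    exact Subalgebra.add_mem _ hP hQ
  | mul_X P x hP =>
    simp only [map_mul (MvPolynomial.aeval _), MvPolynomial.aeval_X]
    refine Subalgebra.mul_mem _ hP ?_
    rcases x with ⟨j, k⟩ | ⟨j, k⟩
    · have h1 := hmode (r := -((k : ℤ) + 1)) (by omega) j
      rw [neg_neg] at h1
      exact h1
    · have h1 : ∀ l, (fun ω : (Fin n → Fin 2) × (Fin n → Fin 2) =>
          algebraMap ℂ FormalField ((LamPrime n h γ e * xiTerm n h γ e ω.1).mode ((k : ℤ) + 1) l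
            * (heisenberg n h γ).osc (k + 1) l j) * zVar ^ (-((k : ℤ) + 1))
          + algebraMap ℂ FormalField ((LamPrime n h γ e * xiTerm n h γ e ω.2).mode ((k : ℤ) + 1) l
            * (heisenberg n h γ).osc (k + 1) l j) * wVar ^ (-((k : ℤ) + 1)))
          ∈ powerSumAlgebra n (scalarUnit (s2 h γ ^ 2) hs) zUnit wUnit := by
        intro l
        convert Subalgebra.mul_mem _ (Subalgebra.algebraMap_mem (powerSumAlgebra n
          (scalarUnit (s2 h γ ^ 2) hs) zUnit wUnit) ((heisenberg n h γ).osc (k + 1) l j))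
          (hmode (r := (k : ℤ) + 1) (by omega) l) using 1
        funext ω
        rw [Pi.mul_apply, Pi.algebraMap_apply, map_mul (algebraMap ℂ FormalField),
          map_mul (algebraMap ℂ FormalField)]
        ring
      convert Subalgebra.sum_mem _ fun l (_ : l ∈ Finset.univ) => h1 l using 1
      funext ω
      rw [Finset.sum_apply]
      simp only [Sum.elim_inr, annihilationSymbol, Vertex.annihilationMode,
        map_sum (algebraMap ℂ FormalField), Finset.sum_mul, ← Finset.sum_add_distrib]

theorem exists_symmetric_sum (hn : 1 ≤ n) (hgen : IsGeneric (s1 h γ) (s2 h γ)) (κ : ℕ → ℂ)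
    (e : Bool) (P : MvPolynomial ((Boson n × ℕ) ⊕ (Boson n × ℕ)) ℂ) :
    ∃ c : ℤ × ℤ →₀ ℂ,
      (zVar - algebraMap ℂ _ (polePosition h e) * wVar) * ∑ ν : Fin n → Fin 2, ∑ μ : Fin n → Fin 2,
        algebraMap ℂ _ ((∏ i : Fin n, κ i ^ ((ν i).val + (μ i).val))
          * ((s1 h γ * s2 h γ) ^ 2) ^ level ν 0) * (ratioSeries (contractionSeries h γ e ν μ) *
          MvPolynomial.aeval (Sum.elim
            (creationSymbol (LamPrime n h γ e * xiTerm n h γ e ν)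
              (LamPrime n h γ e * xiTerm n h γ e μ))
            (annihilationSymbol (heisenberg n h γ) (LamPrime n h γ e * xiTerm n h γ e ν)
              (LamPrime n h γ e * xiTerm n h γ e μ))) P)
      = (zVar - wVar) * c.sum fun x y => algebraMap ℂ FormalField y *
          (zVar ^ x.1 * wVar ^ x.2 + zVar ^ x.2 * wVar ^ x.1) := by
  have hs : s2 h γ ^ 2 ≠ 0 := pow_ne_zero 2 hgen.ne_zero_right
  have huv : ∀ a b : ℕ, (scalarUnit (s2 h γ ^ 2) hs ^ a * zUnit : FormalField)
      ≠ scalarUnit (s2 h γ ^ 2) hs ^ b * wUnit := by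
    intro a b
    have h1 : ∀ k : ℕ, (scalarUnit (s2 h γ ^ 2) hs : FormalField) ^ k
        = algebraMap ℂ FormalField ((s2 h γ ^ 2) ^ k) := fun k => by
      rw [map_pow (algebraMap ℂ FormalField)]; rfl
    rw [h1, h1]
    exact algebraMap_mul_zVar_ne _ _ (pow_ne_zero _ hs)
  obtain ⟨c, hc⟩ := exists_sum_pathWeight_mul (n := n) (t := (s1 h γ * s2 h γ) ^ 2)
    (q := s2 h γ ^ 2) rfl huv κ (aeval_symbols_mem hn hgen hs e P)
  refine ⟨c, ?_⟩
  refine Eq.trans ?_ (congrArg (fun k => (zVar - wVar) * k) hc)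
  simp only [Finset.mul_sum]
  refine Finset.sum_congr rfl fun ν _ => Finset.sum_congr rfl fun μ _ => ?_
  have h1 := pathWeight_eq hgen hs κ e ν μ
  linear_combination (MvPolynomial.aeval (Sum.elim
      (creationSymbol (LamPrime n h γ e * xiTerm n h γ e ν)
        (LamPrime n h γ e * xiTerm n h γ e μ))
      (annihilationSymbol (heisenberg n h γ) (LamPrime n h γ e * xiTerm n h γ e ν)
        (LamPrime n h γ e * xiTerm n h γ e μ))) P) * h1

end Symbols
end OspW

namespace OspW

section Products

variable {n : ℕ} {h γ : ℂ}

theorem Vertex.oscCoeffC_intCast {J : Type} [Fintype J] (H : Heisenberg J) (V : Vertex J) (m : ℤ) :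
    V.oscCoeffC H m = V.oscCoeff H m := by
  have hm : ∃ l : ℤ, (l : ℂ) = m := ⟨m, rfl⟩
  rw [Vertex.oscCoeffC, dif_pos hm]
  congr 1
  exact_mod_cast hm.choose_spec

/-- The eigenvalue of the exponent of `z` in `E(z)` or `F(z)` on momentum `p`. -/
noncomputable def powerOffset (e : Bool) (p : Boson n → ℂ) : ℂ :=
  ∑ j, (Pi.single (Sum.inr e) 1 - Pi.single (Sum.inr (!e)) 1 : Boson n → ℂ) j * p j

theorem powerOffset_add_momentumShift (e : Bool) (p : Boson n → ℂ) :
    powerOffset e (p + momentumShift n h γ e) = powerOffset e p := by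
  rw [powerOffset, powerOffset]
  simp only [Pi.add_apply, mul_add, Finset.sum_add_distrib]
  rw [sum_pow_mul_momentumShift, add_zero]

/-- The eigenvalue of the zero mode factor of a term of the current, with its coefficient. -/
noncomputable def termWeight (n : ℕ) (h γ : ℂ) (e : Bool) (p : Boson n → ℂ) (ν : Fin n → Fin 2) :
    ℂ :=
  xiCoeff n h γ ν * Complex.exp (∑ j, (LamPrime n h γ e * xiTerm n h γ e ν).const j * p j)

theorem ratCurrent_single (e : Bool) (a : ℂ) (p : Boson n → ℂ) (f : Osc (Boson n)) :
    ratCurrent n h γ e a (Finsupp.single p f) = Finsupp.single (p + momentumShift n h γ e)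
      (∑ ν, termWeight n h γ e p ν • (LamPrime n h γ e * xiTerm n h γ e ν).oscCoeffC
        (heisenberg n h γ) (a - powerOffset e p) f) := by
  rw [ratCurrent, LinearMap.sum_apply, Finsupp.single_finsetSum]
  refine Finset.sum_congr rfl fun ν _ => ?_
  rw [Vertex.current, LinearMap.smul_apply, Finsupp.lsum_single,
    LinearMap.comp_apply, charge_eq, pow_eq, LinearMap.smul_apply, termWeight, mul_smul,
    Finsupp.lsingle_apply, Finsupp.smul_single]
  rfl

theorem termWeight_add (hn : 1 ≤ n) (hgen : IsGeneric (s1 h γ) (s2 h γ)) (e : Bool)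
    (p : Boson n → ℂ) (ν : Fin n → Fin 2) :
    termWeight n h γ e (p + momentumShift n h γ e) ν
      = termWeight n h γ e p ν * ((s1 h γ * s2 h γ) ^ 2) ^ level ν 0 := by
  have h1 : (s1 h γ * s2 h γ) ^ 2 = Complex.exp (-2 * h) := by
    rw [s1, s2, ← Complex.exp_add, ← Complex.exp_nat_mul]
    congr 1
    push_cast
    ring
  rw [termWeight, termWeight, h1, ← Complex.exp_nat_mul, mul_assoc, ← Complex.exp_add,
    ← sum_const_mul_momentumShift hn hgen e, ← Finset.sum_add_distrib]
  simp only [Pi.add_apply, mul_add]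

theorem sum_Icc_nu_mul (ν : Fin n → Fin 2) (g : ℕ → ℤ) :
    ∑ i ∈ Finset.Icc 1 n, g i * nu ν i = ∑ i : Fin n, g (i + 1) * (ν i).val := by
  have h1 : Finset.Icc 1 n = Finset.Ico 1 (n + 1) := by ext; simp
  rw [h1, Finset.sum_Ico_eq_sum_range, Nat.add_sub_cancel,
    ← Fin.sum_univ_eq_sum_range fun i => g (1 + i) * nu ν (1 + i)]
  refine Finset.sum_congr rfl fun i _ => ?_
  rw [add_comm 1, nu_succ]

theorem xiCoeff_eq (hgen : IsGeneric (s1 h γ) (s2 h γ)) (ν : Fin n → Fin 2) :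
    xiCoeff n h γ ν = s2 h γ ^ (((n * (n - 1) / 2 : ℕ) : ℤ)) *
      ∏ i : Fin n, (-s2 h γ ^ (-2 * (i.val : ℤ))) ^ (ν i).val := by
  have hQ := hgen.ne_zero_right
  have h1 := sum_Icc_nu_mul ν fun _ => 1
  simp only [one_mul] at h1
  have h2 := sum_Icc_nu_mul ν fun i => (i : ℤ) - 1
  rw [xiCoeff, h1, h2, sub_eq_add_neg, zpow_add₀ hQ, mul_left_comm]
  congr 1
  have h3 : ∀ (x : ℂ), x ≠ 0 → ∀ g : Fin n → ℤ, x ^ (∑ i, g i) = ∏ i, x ^ g i := by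
    intro x hx g
    induction (Finset.univ : Finset (Fin n)) using Finset.induction_on with
    | empty => simp
    | insert a s ha ih => rw [Finset.sum_insert ha, Finset.prod_insert ha, zpow_add₀ hx, ih]
  rw [Finset.mul_sum, ← Finset.sum_neg_distrib, h3 _ (by norm_num), h3 _ hQ,
    ← Finset.prod_mul_distrib]
  refine Finset.prod_congr rfl fun i _ => ?_
  rw [neg_pow, zpow_natCast, ← zpow_natCast (s2 h γ ^ _), ← zpow_mul]
  congr 2
  push_cast
  ring

theorem exists_termWeight_eq (hn : 1 ≤ n) (hgen : IsGeneric (s1 h γ) (s2 h γ)) (e : Bool)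
    (p : Boson n → ℂ) : ∃ (A : ℂ) (κ : ℕ → ℂ), ∀ ν : Fin n → Fin 2,
      termWeight n h γ e p ν = A * ∏ i : Fin n, κ i ^ (ν i).val := by
  obtain ⟨b, ζ, hb⟩ := sum_const_mul_mem_affineFunctions (h := h) (γ := γ) hn e p
  refine ⟨s2 h γ ^ (((n * (n - 1) / 2 : ℕ) : ℤ)) * Complex.exp b, fun i =>
    if hi : i < n then -s2 h γ ^ (-2 * (i : ℤ)) * Complex.exp (ζ ⟨i, hi⟩) else 0, fun ν => ?_⟩
  have hb' : ∑ j, (LamPrime n h γ e * xiTerm n h γ e ν).const j * p j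
      = b + ∑ i, ζ i * (ν i).val := hb ν
  rw [termWeight, xiCoeff_eq hgen, hb', Complex.exp_add, Complex.exp_sum, mul_mul_mul_comm,
    ← Finset.prod_mul_distrib]
  congr 1
  refine Finset.prod_congr rfl fun i _ => ?_
  beta_reduce
  rw [dif_pos i.isLt, mul_pow, ← Complex.exp_nat_mul, mul_comm (ζ i)]

theorem prodCoeff_single (e : Bool) (a b : ℂ) (p : Boson n → ℂ) (f : Osc (Boson n)) :
    prodCoeff (ratCurrent n h γ e) (ratCurrent n h γ e) a b (Finsupp.single p f)
      = Finsupp.single (p + momentumShift n h γ e + momentumShift n h γ e)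
      (∑ ν, ∑ μ, (termWeight n h γ e (p + momentumShift n h γ e) ν * termWeight n h γ e p μ) •
        (LamPrime n h γ e * xiTerm n h γ e ν).oscCoeffC (heisenberg n h γ) (a - powerOffset e p)
          ((LamPrime n h γ e * xiTerm n h γ e μ).oscCoeffC (heisenberg n h γ)
            (b - powerOffset e p) f)) := by
  rw [prodCoeff, Module.End.mul_apply, ratCurrent_single, ratCurrent_single,
    powerOffset_add_momentumShift]
  congr 1
  refine Finset.sum_congr rfl fun ν _ => ?_
  rw [map_sum, Finset.smul_sum]
  refine Finset.sum_congr rfl fun μ _ => ?_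
  rw [map_smul, smul_smul]

theorem exists_int_of_prodCoeff_ne_zero {e : Bool} {a b : ℂ} {p : Boson n → ℂ}
    {f : Osc (Boson n)}
    (h0 : prodCoeff (ratCurrent n h γ e) (ratCurrent n h γ e) a b (Finsupp.single p f) ≠ 0) :
    ∃ m l : ℤ, a = m + powerOffset e p ∧ b = l + powerOffset e p := by
  by_contra hcon
  push Not at hcon
  apply h0
  rw [prodCoeff_single, Finsupp.single_eq_zero]
  refine Finset.sum_eq_zero fun ν _ => Finset.sum_eq_zero fun μ _ => ?_
  by_cases ha : ∃ m : ℤ, (m : ℂ) = a - powerOffset e p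
  · by_cases hb : ∃ l : ℤ, (l : ℂ) = b - powerOffset e p
    · obtain ⟨m, hm⟩ := ha
      obtain ⟨l, hl⟩ := hb
      exact absurd (by rw [hl]; ring) (hcon m l (by rw [hm]; ring))
    · rw [Vertex.oscCoeffC, Vertex.oscCoeffC, dif_neg hb, LinearMap.zero_apply, map_zero, smul_zero]
  · rw [Vertex.oscCoeffC, dif_neg ha, LinearMap.zero_apply, smul_zero]

theorem coeff_prodCoeff_single (e : Bool) (m l : ℤ) (p : Boson n → ℂ) (f : Osc (Boson n))
    (d : Boson n × ℕ →₀ ℕ) :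
    MvPolynomial.coeff d (prodCoeff (ratCurrent n h γ e) (ratCurrent n h γ e)
        (m + powerOffset e p) (l + powerOffset e p) (Finsupp.single p f)
        (p + momentumShift n h γ e + momentumShift n h γ e))
      = ∑ ν, ∑ μ, termWeight n h γ e (p + momentumShift n h γ e) ν * termWeight n h γ e p μ *
        MvPolynomial.coeff d ((LamPrime n h γ e * xiTerm n h γ e ν).oscCoeff (heisenberg n h γ) m
          ((LamPrime n h γ e * xiTerm n h γ e μ).oscCoeff (heisenberg n h γ) l f)) := by
  rw [prodCoeff_single, Finsupp.single_eq_same, add_sub_cancel_right, add_sub_cancel_right]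
  simp only [Vertex.oscCoeffC_intCast, MvPolynomial.coeff_sum, MvPolynomial.coeff_smul, smul_eq_mul]

theorem exists_product_kernel (hn : 1 ≤ n) (hgen : IsGeneric (s1 h γ) (s2 h γ)) (e : Bool)
    (p : Boson n → ℂ) (f : Osc (Boson n)) (d : Boson n × ℕ →₀ ℕ) :
    ∃ (G : FormalField) (c : ℤ × ℤ →₀ ℂ),
      (zVar - algebraMap ℂ _ (polePosition h e) * wVar) * G
        = (zVar - wVar) * (c.sum fun x y => algebraMap ℂ FormalField y *
          (zVar ^ x.1 * wVar ^ x.2 + zVar ^ x.2 * wVar ^ x.1)) ∧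
      ∀ m l : ℤ, MvPolynomial.coeff d (prodCoeff (ratCurrent n h γ e) (ratCurrent n h γ e)
        (m + powerOffset e p) (l + powerOffset e p) (Finsupp.single p f)
        (p + momentumShift n h γ e + momentumShift n h γ e)) = zwCoeff m l G := by
  obtain ⟨A, κ, hA⟩ := exists_termWeight_eq hn hgen e p
  obtain ⟨P, hP⟩ := exists_kernel (heisenberg n h γ) d f
  obtain ⟨c, hc⟩ := exists_symmetric_sum hn hgen κ e (MvPolynomial.C (A ^ 2) * P)
  refine ⟨_, c, hc, fun m l => ?_⟩
  rw [coeff_prodCoeff_single, map_sum]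
  refine Finset.sum_congr rfl fun ν _ => ?_
  rw [map_sum]
  refine Finset.sum_congr rfl fun μ _ => ?_
  rw [hP _ _ _ (isContraction_contractionSeries hn hgen e ν μ), termWeight_add hn hgen, hA, hA,
    zwCoeff_algebraMap_mul, map_mul (MvPolynomial.aeval _), MvPolynomial.aeval_C,
    mul_left_comm (ratioSeries _), zwCoeff_algebraMap_mul]
  simp only [pow_add, Finset.prod_mul_distrib]
  ring

theorem zwCoeff_monomial (m l a b : ℤ) : zwCoeff m l (zVar ^ a * wVar ^ b)
    = if (m, l) = (a, b) then 1 else 0 := by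
  rw [zwCoeff_zpow_mul, ← mul_one (wVar ^ b), zwCoeff_wpow_mul, zwCoeff_one]
  simp only [sub_eq_zero, Prod.mk.injEq]

/-- The matrix elements of `(z - θ w) E(z) E(w)` are those of `z - w` times a symmetric Laurent
polynomial. -/
theorem exists_mulProdCoeff_eq (hn : 1 ≤ n) (hgen : IsGeneric (s1 h γ) (s2 h γ)) (e : Bool)
    (p : Boson n → ℂ) (f : Osc (Boson n)) (d : Boson n × ℕ →₀ ℕ) :
    ∃ s : ℤ × ℤ → ℂ, s.support.Finite ∧ (∀ m l, s (m, l) = s (l, m)) ∧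
      ∀ m l : ℤ, MvPolynomial.coeff d (mulProdCoeff (polePosition h e) (ratCurrent n h γ e)
        (ratCurrent n h γ e) (m + powerOffset e p) (l + powerOffset e p) (Finsupp.single p f)
        (p + momentumShift n h γ e + momentumShift n h γ e)) = s (m - 1, l) - s (m, l - 1) := by
  obtain ⟨G, c, hG, hcoeff⟩ := exists_product_kernel hn hgen e p f d
  have hs : ∀ m l : ℤ, zwCoeff m l (c.sum fun x y => algebraMap ℂ FormalField y *
      (zVar ^ x.1 * wVar ^ x.2 + zVar ^ x.2 * wVar ^ x.1)) = c (m, l) + c (l, m) := by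
    intro m l
    have h1 : ∀ x : ℤ × ℤ, ((m, l) = (x.2, x.1)) = ((l, m) = x) := by
      rintro ⟨x, y⟩
      simp only [Prod.mk.injEq, and_comm]
    rw [Finsupp.sum, map_sum]
    simp only [zwCoeff_algebraMap_mul, map_add, zwCoeff_monomial, mul_add, Finset.sum_add_distrib,
      mul_ite, mul_one, mul_zero, Prod.mk.eta, h1, Finset.sum_ite_eq]
    simp only [Finsupp.mem_support_iff, ite_not]
    congr 1 <;> split_ifs with h2 <;> simp [h2]
  refine ⟨fun x => c x + c x.swap, ?_, fun m l => add_comm _ _, fun m l => ?_⟩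
  · refine Set.Finite.subset (c.support.finite_toSet.union
      (c.support.finite_toSet.preimage Prod.swap_injective.injOn)) fun x hx => ?_
    by_contra hcon
    simp only [Set.mem_union, Finset.mem_coe, Finsupp.mem_support_iff, Set.mem_preimage, not_or,
      not_not] at hcon
    exact hx (by simp [hcon])
  · have h1 := congrArg (zwCoeff m l) hG
    rw [sub_mul, sub_mul, map_sub, map_sub, mul_assoc, zwCoeff_algebraMap_mul, zwCoeff_zVar_mul,
      zwCoeff_wVar_mul, zwCoeff_zVar_mul, zwCoeff_wVar_mul, hs, hs, ← hcoeff, ← hcoeff] at h1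
    have e1 : (m : ℂ) + powerOffset e p - 1 = ((m - 1 : ℤ) : ℂ) + powerOffset e p := by
      push_cast; ring
    have e2 : (l : ℂ) + powerOffset e p - 1 = ((l - 1 : ℤ) : ℂ) + powerOffset e p := by
      push_cast; ring
    rw [mulProdCoeff, e1, e2, LinearMap.sub_apply, LinearMap.smul_apply, Finsupp.sub_apply,
      Finsupp.smul_apply, MvPolynomial.coeff_sub, MvPolynomial.coeff_smul, smul_eq_mul]
    exact h1

theorem exists_int_of_mulProdCoeff_ne_zero {e : Bool} {θ a b : ℂ} {p : Boson n → ℂ}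
    {f : Osc (Boson n)} (h0 : mulProdCoeff θ (ratCurrent n h γ e) (ratCurrent n h γ e) a b
      (Finsupp.single p f) ≠ 0) :
    ∃ m l : ℤ, a = m + powerOffset e p ∧ b = l + powerOffset e p := by
  rw [mulProdCoeff, LinearMap.sub_apply, LinearMap.smul_apply] at h0
  by_cases h1 : prodCoeff (ratCurrent n h γ e) (ratCurrent n h γ e) (a - 1) b
      (Finsupp.single p f) = 0
  · have h2 : prodCoeff (ratCurrent n h γ e) (ratCurrent n h γ e) a (b - 1)
        (Finsupp.single p f) ≠ 0 := by
      intro h2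
      rw [h1, h2, smul_zero, sub_zero] at h0
      exact h0 rfl
    obtain ⟨m, l, hm, hl⟩ := exists_int_of_prodCoeff_ne_zero h2
    exact ⟨m, l + 1, hm, by push_cast; linear_combination hl⟩
  · obtain ⟨m, l, hm, hl⟩ := exists_int_of_prodCoeff_ne_zero h1
    exact ⟨m + 1, l, by push_cast; linear_combination hm, hl⟩

theorem mulProdCoeff_single_apply_of_ne {e : Bool} {θ a b : ℂ} {p p' : Boson n → ℂ}
    {f : Osc (Boson n)} (hp : p' ≠ p + momentumShift n h γ e + momentumShift n h γ e) :
    mulProdCoeff θ (ratCurrent n h γ e) (ratCurrent n h γ e) a b (Finsupp.single p f) p' = 0 := by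
  rw [mulProdCoeff, LinearMap.sub_apply, LinearMap.smul_apply, prodCoeff_single, prodCoeff_single,
    Finsupp.sub_apply, Finsupp.smul_apply, Finsupp.single_eq_of_ne hp, Finsupp.single_eq_of_ne hp,
    smul_zero, sub_zero]

theorem isRegular_mulProdCoeff (hn : 1 ≤ n) (hgen : IsGeneric (s1 h γ) (s2 h γ)) (e : Bool) :
    IsRegular (mulProdCoeff (polePosition h e) (ratCurrent n h γ e) (ratCurrent n h γ e)) := by
  intro v p' d
  induction v using Finsupp.induction_linear with
  | zero => simp
  | add v w hv hw =>
    refine (hv.union hw).subset fun x hx => ?_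
    by_contra hcon
    simp only [Set.mem_union, Set.mem_ofPred_eq, not_or, not_not] at hcon
    apply hx
    rw [map_add, Finsupp.add_apply, MvPolynomial.coeff_add, hcon.1, hcon.2, add_zero]
  | single p f =>
    obtain ⟨s, hs, -, hcoeff⟩ := exists_mulProdCoeff_eq hn hgen e p f d
    have hfin : {x : ℤ × ℤ | s (x.1 - 1, x.2) - s (x.1, x.2 - 1) ≠ 0}.Finite := by
      have i1 : Function.Injective fun x : ℤ × ℤ => (x.1 - 1, x.2) := by
        rintro ⟨a, b⟩ ⟨a', b'⟩ hx
        simpa using hx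
      have i2 : Function.Injective fun x : ℤ × ℤ => (x.1, x.2 - 1) := by
        rintro ⟨a, b⟩ ⟨a', b'⟩ hx
        simpa using hx
      refine ((hs.preimage i1.injOn).union (hs.preimage i2.injOn)).subset fun x hx => ?_
      by_contra hcon
      simp only [Set.mem_union, Set.mem_preimage, Function.mem_support, not_or, not_not] at hcon
      exact hx (by rw [hcon.1, hcon.2, sub_zero])
    refine (hfin.image fun x => ((x.1 : ℂ) + powerOffset e p, (x.2 : ℂ) + powerOffset e p)).subset
      ?_
    rintro ⟨a, b⟩ hab
    have h0 : mulProdCoeff (polePosition h e) (ratCurrent n h γ e) (ratCurrent n h γ e) a b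
        (Finsupp.single p f) ≠ 0 := by
      intro h0
      apply hab
      simp only [h0, Finsupp.zero_apply, MvPolynomial.coeff_zero]
    obtain ⟨m, l, rfl, rfl⟩ := exists_int_of_mulProdCoeff_ne_zero h0
    have hp' : p' = p + momentumShift n h γ e + momentumShift n h γ e := by
      by_contra hp'
      apply hab
      simp only [mulProdCoeff_single_apply_of_ne hp', MvPolynomial.coeff_zero]
    subst hp'
    refine ⟨(m, l), ?_, rfl⟩
    rw [Set.mem_ofPred_eq, ← hcoeff]
    exact hab

theorem mulProdCoeff_add_mulProdCoeff (hn : 1 ≤ n) (hgen : IsGeneric (s1 h γ) (s2 h γ)) (e : Bool)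
    (a b : ℂ) :
    mulProdCoeff (polePosition h e) (ratCurrent n h γ e) (ratCurrent n h γ e) a b
      + mulProdCoeff (polePosition h e) (ratCurrent n h γ e) (ratCurrent n h γ e) b a = 0 := by
  refine Finsupp.lhom_ext fun p f => ?_
  rw [LinearMap.add_apply, LinearMap.zero_apply]
  by_cases hab : ∃ m l : ℤ, a = m + powerOffset e p ∧ b = l + powerOffset e p
  · obtain ⟨m, l, rfl, rfl⟩ := hab
    ext p' d
    rw [Finsupp.add_apply, Finsupp.zero_apply, MvPolynomial.coeff_add, MvPolynomial.coeff_zero]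
    by_cases hp' : p' = p + momentumShift n h γ e + momentumShift n h γ e
    · subst hp'
      obtain ⟨s, -, hsymm, hcoeff⟩ := exists_mulProdCoeff_eq hn hgen e p f d
      rw [hcoeff, hcoeff, hsymm m, hsymm _ l]
      ring
    · rw [mulProdCoeff_single_apply_of_ne hp', mulProdCoeff_single_apply_of_ne hp',
        MvPolynomial.coeff_zero, add_zero]
  · have h1 : mulProdCoeff (polePosition h e) (ratCurrent n h γ e) (ratCurrent n h γ e) a b
        (Finsupp.single p f) = 0 := by
      by_contra h0
      exact hab (exists_int_of_mulProdCoeff_ne_zero h0)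
    have h2 : mulProdCoeff (polePosition h e) (ratCurrent n h γ e) (ratCurrent n h γ e) b a
        (Finsupp.single p f) = 0 := by
      by_contra h0
      obtain ⟨m, l, hm, hl⟩ := exists_int_of_mulProdCoeff_ne_zero h0
      exact hab ⟨l, m, hl, hm⟩
    rw [h1, h2, add_zero]

end Products
end OspW

namespace OspW

section Pole

variable {n : ℕ} {h γ : ℂ}

theorem level_le (ν : Fin n → Fin 2) : level ν 0 ≤ n := by
  rw [level]
  calc _ ≤ ∑ _i : Fin n, 1 := Finset.sum_le_sum fun i _ => by
        have := (ν i).isLt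
        split_ifs <;> omega
    _ = n := by simp

theorem level_eq_zero_iff (ν : Fin n → Fin 2) : level ν 0 = 0 ↔ ν = 0 := by
  rw [level, Finset.sum_eq_zero_iff]
  constructor
  · intro h0
    funext i
    have := h0 i (Finset.mem_univ i)
    rw [if_pos (Nat.zero_le _)] at this
    exact Fin.ext this
  · rintro rfl i -
    simp

theorem contractionSeries_zero (h γ : ℂ) (e : Bool) :
    contractionSeries h γ e (0 : Fin n → Fin 2) 0 = linearRatio 1 (polePosition h e) := by
  rw [contractionSeries, Finset.prod_eq_one, mul_one]
  intro i _
  rw [stepZero, stepPole, sub_self, sub_self, mul_zero, zpow_zero, zpow_zero, mul_one,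
    linearRatio_self]

theorem polePosition_ne_one (hgen : IsGeneric (s1 h γ) (s2 h γ)) (e : Bool) :
    polePosition h e ≠ 1 := by
  have h1 : s3 h ^ 2 ≠ 1 := by
    intro h0
    have h2 := s3_zpow (h := h) (γ := γ) 2
    rw [zpow_ofNat, h0, eq_comm, inv_eq_one] at h2
    exact two_ne_zero (hgen.eq_zero 2 2 h2).1
  rw [polePosition]
  split_ifs
  · rwa [Ne, inv_eq_one]
  · exact h1

theorem coeff_contractionSeries_zero_ne (hgen : IsGeneric (s1 h γ) (s2 h γ)) (e : Bool) (l : ℕ) :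
    PowerSeries.coeff (l + 1) (contractionSeries h γ e (0 : Fin n → Fin 2) 0) ≠ 0 := by
  have h0 : polePosition h e ≠ 0 := by
    have hs : s3 h ^ 2 ≠ 0 := pow_ne_zero 2 (Complex.exp_ne_zero h)
    rw [polePosition]
    split_ifs
    · exact inv_ne_zero hs
    · exact hs
  rw [contractionSeries_zero, coeff_succ_linearRatio, pow_succ', ← sub_mul]
  exact mul_ne_zero (sub_ne_zero.mpr (polePosition_ne_one hgen e)) (pow_ne_zero l h0)

theorem xiCoeff_ne_zero (hgen : IsGeneric (s1 h γ) (s2 h γ)) (ν : Fin n → Fin 2) :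
    xiCoeff n h γ ν ≠ 0 :=
  mul_ne_zero (zpow_ne_zero _ (by norm_num)) (zpow_ne_zero _ hgen.ne_zero_right)

theorem termWeight_nsmul_momentumShift (hn : 1 ≤ n) (hgen : IsGeneric (s1 h γ) (s2 h γ))
    (e : Bool) (k : ℕ) (ν : Fin n → Fin 2) :
    termWeight n h γ e (k • momentumShift n h γ e) ν
      = xiCoeff n h γ ν * (((s1 h γ * s2 h γ) ^ 2) ^ k) ^ level ν 0 := by
  induction k with
  | zero => simp [termWeight]
  | succ k ih =>
    rw [succ_nsmul, termWeight_add hn hgen, ih, mul_assoc, ← mul_pow, pow_succ _ k]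

theorem powerOffset_nsmul_momentumShift (e : Bool) (k : ℕ) :
    powerOffset e (k • momentumShift n h γ e) = 0 := by
  induction k with
  | zero => simp [powerOffset]
  | succ k ih => rw [succ_nsmul, powerOffset_add_momentumShift, ih]

theorem not_isRegular_prodCoeff (hn : 1 ≤ n) (hgen : IsGeneric (s1 h γ) (s2 h γ)) (e : Bool) :
    ¬ IsRegular (prodCoeff (ratCurrent n h γ e) (ratCurrent n h γ e)) := by
  intro hreg
  set τ : ℂ := (s1 h γ * s2 h γ) ^ 2 with hτ
  set Pol : ℕ → Polynomial ℂ := fun l => ∑ ν : Fin n → Fin 2, ∑ μ : Fin n → Fin 2,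
    Polynomial.C (xiCoeff n h γ ν * xiCoeff n h γ μ * τ ^ level ν 0 *
      PowerSeries.coeff l (contractionSeries h γ e ν μ)) * Polynomial.X ^ (level ν 0 + level μ 0)
    with hPol
  have hcoeff : ∀ k l : ℕ, MvPolynomial.coeff 0 (prodCoeff (ratCurrent n h γ e)
      (ratCurrent n h γ e) (-(l : ℂ)) l (Finsupp.single (k • momentumShift n h γ e) 1)
      (k • momentumShift n h γ e + momentumShift n h γ e + momentumShift n h γ e))
      = (Pol l).eval (τ ^ k) := by
    intro k l
    have h1 := coeff_prodCoeff_single (h := h) (γ := γ) e (-l) l (k • momentumShift n h γ e) 1 0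
    rw [powerOffset_nsmul_momentumShift, add_zero, add_zero] at h1
    push_cast at h1
    rw [h1, hPol, Polynomial.eval_finsetSum]
    refine Finset.sum_congr rfl fun ν _ => ?_
    rw [Polynomial.eval_finsetSum]
    refine Finset.sum_congr rfl fun μ _ => ?_
    rw [constantCoeff_oscCoeff_oscCoeff_one _ _ _
      (isContraction_contractionSeries hn hgen e ν μ), zwCoeff_ratioSeries, if_pos (by simp),
      termWeight_add hn hgen, termWeight_nsmul_momentumShift hn hgen,
      termWeight_nsmul_momentumShift hn hgen, Polynomial.eval_mul, Polynomial.eval_C,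
      Polynomial.eval_pow, Polynomial.eval_X, pow_add, Int.toNat_natCast]
    ring
  have hfin : ∀ k : ℕ, {l : ℕ | (Pol l).eval (τ ^ k) ≠ 0}.Finite := by
    intro k
    have h1 := hreg (Finsupp.single (k • momentumShift n h γ e) 1)
      (k • momentumShift n h γ e + momentumShift n h γ e + momentumShift n h γ e) 0
    refine (h1.preimage (f := fun l : ℕ => ((-(l : ℂ), (l : ℂ)) : ℂ × ℂ)) ?_).subset fun l hl => ?_
    · intro a _ b _ hab
      exact Nat.cast_injective (R := ℂ) (Prod.ext_iff.mp hab).2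
    · rw [Set.mem_preimage, Set.mem_ofPred_eq, hcoeff]
      exact hl
  have hfin' : (⋃ k ∈ Finset.range (2 * n + 1), {l : ℕ | (Pol l).eval (τ ^ k) ≠ 0}).Finite :=
    Set.Finite.biUnion (Finset.finite_toSet _) fun k _ => hfin k
  obtain ⟨N, hN⟩ := hfin'.bddAbove
  have hroot : ∀ k ∈ Finset.range (2 * n + 1), (Pol (N + 1)).eval (τ ^ k) = 0 := by
    intro k hk
    by_contra h0
    have := hN (Set.mem_biUnion (Finset.mem_coe.mpr hk) h0)
    omega
  have hinj : Function.Injective fun k : ℕ => τ ^ k := by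
    have hSQ := mul_ne_zero hgen.ne_zero_left hgen.ne_zero_right
    have hτ1 : ∀ a b : ℕ, a < b → τ ^ a ≠ τ ^ b := by
      intro a b hab h0
      have h1 : τ ^ (b - a) = 1 := by
        have h2 : τ ^ a * τ ^ (b - a) = τ ^ a * 1 := by
          rw [← pow_add, Nat.add_sub_cancel' hab.le, h0, mul_one]
        exact mul_left_cancel₀ (pow_ne_zero _ (pow_ne_zero _ hSQ)) h2
      have h3 := hgen.eq_zero ((2 * (b - a) : ℕ) : ℤ) ((2 * (b - a) : ℕ) : ℤ) (by
        rw [zpow_natCast, zpow_natCast, ← mul_pow, pow_mul, ← hτ, h1])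
      omega
    intro a b hab
    rcases lt_trichotomy a b with h1 | h1 | h1
    · exact absurd hab (hτ1 a b h1)
    · exact h1
    · exact absurd hab.symm (hτ1 b a h1)
  have hdeg : (Pol (N + 1)).natDegree < 2 * n + 1 := by
    rw [Nat.lt_succ_iff]
    refine Polynomial.natDegree_sum_le_of_forall_le _ _ fun ν _ =>
      Polynomial.natDegree_sum_le_of_forall_le _ _ fun μ _ => ?_
    have h1 := level_le ν
    have h2 := level_le μ
    exact (Polynomial.natDegree_C_mul_X_pow_le _ _).trans (by omega)
  have hzero : Pol (N + 1) = 0 := by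
    refine Polynomial.eq_zero_of_natDegree_lt_card_of_eval_eq_zero' _
      ((Finset.range (2 * n + 1)).image fun k => τ ^ k) ?_ ?_
    · intro x hx
      obtain ⟨k, hk, rfl⟩ := Finset.mem_image.mp hx
      exact hroot k hk
    · rw [Finset.card_image_of_injective _ hinj, Finset.card_range]
      exact hdeg
  have hconst : (Pol (N + 1)).coeff 0 = xiCoeff n h γ 0 * xiCoeff n h γ 0 *
      PowerSeries.coeff (N + 1) (contractionSeries h γ e (0 : Fin n → Fin 2) 0) := by
    have h0 : level (0 : Fin n → Fin 2) 0 = 0 := (level_eq_zero_iff _).mpr rfl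
    rw [hPol, Polynomial.finsetSum_coeff, Finset.sum_eq_single 0]
    · rw [Polynomial.finsetSum_coeff, Finset.sum_eq_single 0]
      · rw [Polynomial.coeff_C_mul_X_pow, h0, if_pos rfl, pow_zero, mul_one]
      · intro μ _ hμ
        rw [Polynomial.coeff_C_mul_X_pow, if_neg]
        have := (level_eq_zero_iff μ).not.mpr hμ
        omega
      · simp
    · intro ν _ hν
      rw [Polynomial.finsetSum_coeff]
      refine Finset.sum_eq_zero fun μ _ => ?_
      rw [Polynomial.coeff_C_mul_X_pow, if_neg]
      have := (level_eq_zero_iff ν).not.mpr hν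
      omega
    · simp
  rw [hzero, Polynomial.coeff_zero] at hconst
  exact mul_ne_zero (mul_ne_zero (xiCoeff_ne_zero hgen 0) (xiCoeff_ne_zero hgen 0))
    (coeff_contractionSeries_zero_ne hgen e N) hconst.symm

end Pole
end OspW

theorem mainTheorem4 (n : ℕ) (hn : 1 ≤ n) (h γ : ℂ)
    (hgen : ∀ a b : ℤ, OspW.s1 h γ ^ a * OspW.s2 h γ ^ b = 1 → a = 0 ∧ b = 0) :
    OspW.RegularExceptSimplePole (OspW.s3 h ^ 2) (OspW.E n h γ) (OspW.E n h γ) ∧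
    OspW.RegularExceptSimplePole ((OspW.s3 h ^ 2)⁻¹) (OspW.F n h γ) (OspW.F n h γ) ∧
    (∀ a b : ℂ,
      (OspW.E n h γ (a - 1) * OspW.E n h γ b
          - OspW.s3 h ^ 2 • (OspW.E n h γ a * OspW.E n h γ (b - 1)))
        + (OspW.E n h γ (b - 1) * OspW.E n h γ a
          - OspW.s3 h ^ 2 • (OspW.E n h γ b * OspW.E n h γ (a - 1))) = 0) ∧
    (∀ a b : ℂ,
      (OspW.F n h γ (a - 1) * OspW.F n h γ b
          - (OspW.s3 h ^ 2)⁻¹ • (OspW.F n h γ a * OspW.F n h γ (b - 1)))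
        + (OspW.F n h γ (b - 1) * OspW.F n h γ a
          - (OspW.s3 h ^ 2)⁻¹ • (OspW.F n h γ b * OspW.F n h γ (a - 1))) = 0) := by
  have hg : OspW.IsGeneric (OspW.s1 h γ) (OspW.s2 h γ) :=
    ⟨Complex.exp_ne_zero _, Complex.exp_ne_zero _, hgen⟩
  exact ⟨⟨OspW.isRegular_mulProdCoeff hn hg false, OspW.not_isRegular_prodCoeff hn hg false⟩,
    ⟨OspW.isRegular_mulProdCoeff hn hg true, OspW.not_isRegular_prodCoeff hn hg true⟩,
    OspW.mulProdCoeff_add_mulProdCoeff hn hg false, OspW.mulProdCoeff_add_mulProdCoeff hn hg true⟩
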